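/- Let $N\ge 1$ and let $\varphi\in\mathcal S(\mathbb R^N)$ be radial, supported in $\{\frac34\le|\xi|\le\frac83\}$, with $\sum_{j\in\mathbb Z}\varphi(2^{-j}\xi)=1$ for all $\xi\ne0$; put $\Delta_j=\varphi(2^{-j}D)$. Let $\mathcal Z'$ be the dual of $\mathcal Z=\{\psi\in\mathcal S(\mathbb R^N):\ \partial^\alpha\hat\psi(0)=0\ \forall\alpha\}$ (tempered distributions modulo polynomials). For $s\in\mathbb R$, $p\in[1,\infty]$, let $\dot B^s_{p,1}$ be the space of $f\in\mathcal Z'$ with $\|f\|_{\dot B^s_{p,1}}=\sum_k2^{ks}\|\Delta_kf\|_{L^p}<\infty$. Weights: let $e_k:[0,\infty)\to[0,1]$, $k\in\mathbb Z$, satisfy $e_k(t)\le e_{k'}(t)$ for $k\le k'$ and $e_{k+1}(t)\le K e_k(t)$ for some constant $K$ and all $k,t$; put $\omega_k(t)=\sum_{\ell\ge k}2^{k-\ell}e_\ell(t)$. For a fixed $0<T<\infty$ and $t\in[0,T]$ let $$\|f\|_{\dot B^s_{p,1}(\omega)}=\sum_k2^{ks}\omega_k(T)\|\Delta_kf\|_{L^p},\qquad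 \|f\|_{\widetilde L^\infty_t(\dot B^s_{p,1}(\omega))}=\sum_k2^{ks}\omega_k(T)\|\Delta_kf\|_{L^\infty(0,t;L^p)}.$$ Proposition. Let $p\in[1,\infty]$, $\frac1p+\frac1{p'}=1$, and $s\in\bigl(-N\min(\frac1p,\frac1{p'}),\frac Np\bigr]$. There is a constant $C>0$, depending only on $N,p,s,\varphi$, such that the following holds for all weights as above and all $T\in(0,\infty)$. Let $v\in L^1_{loc}([0,T]\times\mathbb R^N;\mathbb R^N)$ be a vector field with $\nabla v\in L^1(0,T;\dot B^{N/p}_{p,1})$, where for a.e. $t$ the gradient $\nabla v(t)$ is a bounded function equal to $\sum_k\Delta_k\nabla v(t)$ (the usual realization of $\dot B^{N/p}_{p,1}$ as a space of bounded continuous functions). Let $f_0\in\dot B^s_{p,1}$, $g\in L^1(0,T;\dot B^s_{p,1})$, and let $f\in L^\infty(0,T;\dot B^s_{p,1})$ be a solution of $$\partial_tf+v\cdot\nabla f=g,\qquad f(0)=f_0,$$ on $[0,T]$ in the sense that $f(t)=f_0+\int_0^t(g-v\cdot\nabla f)\,d\tau$ in $\mathcal Z'$ for every $t\in[0,T]$,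 where $v\cdot\nabla f=\sum_{k}v\cdot\nabla\Delta_kf$, the series being summable in $\mathcal Z'$ for a.e. time and $g$, $v\cdot\nabla f$ being integrable in time when tested against each $\psi\in\mathcal Z$. Then for every $t\in[0,T]$ $$\|f\|_{\widetilde L^\infty_t(\dot B^s_{p,1}(\omega))}\le e^{CV(t)}\Bigl(\|f_0\|_{\dot B^s_{p,1}(\omega)}+\int_0^te^{-CV(\tau)}\|g(\tau)\|_{\dot B^s_{p,1}(\omega)}\,d\tau\Bigr),\qquad V(t)=\int_0^t\|\nabla v(\tau)\|_{\dot B^{N/p}_{p,1}}\,d\tau .$$ -/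

import Mathlib

open MeasureTheory Set
open scoped ENNReal SchwartzMap FourierTransform

noncomputable section

/-- The space `ℝᴺ` with its Euclidean norm. -/
abbrev Space (N : ℕ) : Type := EuclideanSpace ℝ (Fin N)

/-- The space `𝒵(ℝᴺ)` of Schwartz functions whose Fourier transform vanishes to infinite order
at the origin. It carries the topology induced by `𝓢(ℝᴺ)`. -/
def ZSpace (N : ℕ) : Submodule ℂ 𝓢(Space N, ℂ) where
  carrier := {ψ | ∀ n : ℕ, iteratedFDeriv ℝ n (⇑(𝓕 ψ : 𝓢(Space N, ℂ))) 0 = 0}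
  add_mem' := by
    intro a b ha hb n
    have h : (⇑(𝓕 (a + b) : 𝓢(Space N, ℂ)) : Space N → ℂ) = ⇑(𝓕 a : 𝓢(Space N, ℂ)) + ⇑(𝓕 b : 𝓢(Space N, ℂ)) := by
      rw [FourierAdd.fourier_add]; rfl
    rw [h, iteratedFDeriv_add_apply ((𝓕 a).smooth n).contDiffAt ((𝓕 b).smooth n).contDiffAt,
      ha n, hb n, add_zero]
  zero_mem' := by
    intro n
    have h : (⇑(𝓕 (0 : 𝓢(Space N, ℂ)) : 𝓢(Space N, ℂ)) : Space N → ℂ) = fun _ => 0 := by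
      rw [FourierTransform.fourier_zero]; rfl
    rw [h, iteratedFDeriv_fun_zero]; rfl
  smul_mem' := by
    intro c a ha n
    have h : (⇑(𝓕 (c • a) : 𝓢(Space N, ℂ)) : Space N → ℂ) = c • ⇑(𝓕 a : 𝓢(Space N, ℂ)) := by
      rw [FourierSMul.fourier_smul]; rfl
    rw [h, iteratedFDeriv_const_smul_apply ((𝓕 a).smooth n).contDiffAt, ha n, smul_zero]

/-- The dual space `𝒵'(ℝᴺ)`, that is, tempered distributions modulo polynomials. -/
abbrev ZDual (N : ℕ) : Type := ZSpace N →L[ℂ] ℂ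

/-- The class in `𝒵'` of a tempered distribution. -/
def ZDual.ofTempered {N : ℕ} (F : 𝓢'(Space N, ℂ)) : ZDual N where
  toFun ψ := F (ψ : 𝓢(Space N, ℂ))
  map_add' a b := by simp
  map_smul' c a := by simp
  cont := F.continuous.comp continuous_subtype_val

open Classical in
/-- The element `ψ ↦ ∫ u ψ` of `𝒵'` given by a bounded measurable function `u`
(and `0` if `u` is not such a function). -/
def ZDual.ofFun {N : ℕ} (u : Space N → ℂ) : ZDual N :=
  if h : MemLp u ∞ volume then ZDual.ofTempered (Lp.toTemperedDistribution (h.toLp u)) else 0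

/-- A radial Schwartz function `φ`, supported in the annulus `3/4 ≤ |ξ| ≤ 8/3`, with
`∑_{j ∈ ℤ} φ(2^{-j} ξ) = 1` for all `ξ ≠ 0`. -/
structure LittlewoodPaley (N : ℕ) where
  φ : 𝓢(Space N, ℂ)
  radial : ∀ ξ η : Space N, ‖ξ‖ = ‖η‖ → φ ξ = φ η
  support : tsupport (⇑φ) ⊆ {ξ : Space N | 3 / 4 ≤ ‖ξ‖ ∧ ‖ξ‖ ≤ 8 / 3}
  partition : ∀ ξ : Space N, ξ ≠ 0 → HasSum (fun j : ℤ => φ ((2 : ℝ) ^ (-j) • ξ)) 1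

namespace LittlewoodPaley

variable {N : ℕ} (L : LittlewoodPaley N)

/-- The symbol `ξ ↦ φ(2^{-j} ξ)`. -/
def symbol (j : ℤ) : 𝓢(Space N, ℂ) :=
  SchwartzMap.compCLMOfContinuousLinearEquiv ℂ
    (ContinuousLinearEquiv.smulLeft (Units.mk0 ((2 : ℝ) ^ (-j)) (by positivity))) L.φ

theorem symbol_apply (j : ℤ) (ξ : Space N) : L.symbol j ξ = L.φ ((2 : ℝ) ^ (-j) • ξ) := rfl

/-- The function `y ↦ h_j(x - y)`, where `h_j` is the inverse Fourier transform of
`φ(2^{-j} ·)`. -/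
def kernel (j : ℤ) (x : Space N) : 𝓢(Space N, ℂ) :=
  SchwartzMap.compSubConstCLM ℂ x (𝓕 (L.symbol j))

theorem kernel_apply (j : ℤ) (x y : Space N) : L.kernel j x y = 𝓕⁻ (L.symbol j) (x - y) := by
  rw [kernel, SchwartzMap.compSubConstCLM_apply, SchwartzMap.fourier_coe,
    SchwartzMap.fourierInv_coe, Real.fourierInv_eq_fourier_neg, neg_sub]

theorem kernel_mem (j : ℤ) (x : Space N) : L.kernel j x ∈ ZSpace N := by
  have h1 : ∀ ξ : Space N, ‖ξ‖ < 3 / 4 → L.φ ξ = 0 := by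
    intro ξ hξ
    by_contra h
    have := (L.support (subset_tsupport _ h)).1
    linarith
  have h2 : ∀ᶠ ξ in nhds (0 : Space N), 𝓕 (L.kernel j x) ξ = 0 := by
    have hlim : Filter.Tendsto (fun ξ : Space N => ‖(2 : ℝ) ^ (-j) • (-ξ)‖) (nhds 0)
        (nhds ‖(2 : ℝ) ^ (-j) • (-(0 : Space N))‖) := by
      apply Continuous.tendsto
      fun_prop
    have hsmall := hlim.eventually_lt_const (u := 3 / 4) (by simp)
    filter_upwards [hsmall] with ξ hξ
    have hk : (⇑(L.kernel j x) : Space N → ℂ) = (fun y => 𝓕 (L.symbol j) (y + -x)) := by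
      ext y
      rw [kernel, SchwartzMap.compSubConstCLM_apply, sub_eq_add_neg]
    have hz : 𝓕 (⇑(𝓕 (L.symbol j) : 𝓢(Space N, ℂ)) : Space N → ℂ) ξ = 0 := by
      have h3 : 𝓕 (⇑(𝓕 (L.symbol j) : 𝓢(Space N, ℂ)) : Space N → ℂ) ξ
          = (𝓕⁻ (𝓕 (L.symbol j) : 𝓢(Space N, ℂ)) : 𝓢(Space N, ℂ)) (-ξ) := by
        rw [SchwartzMap.fourierInv_coe, Real.fourierInv_eq_fourier_neg, neg_neg]
      rw [h3, FourierTransform.fourierInv_fourier_eq, symbol_apply]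
      exact h1 _ hξ
    rw [SchwartzMap.fourier_coe, hk]
    have h4 := congrFun (VectorFourier.fourierIntegral_comp_add_right Real.fourierChar volume
      (innerₗ (Space N)) (⇑(𝓕 (L.symbol j) : 𝓢(Space N, ℂ)) : Space N → ℂ) (-x)) ξ
    refine h4.trans ?_
    change _ • 𝓕 (⇑(𝓕 (L.symbol j) : 𝓢(Space N, ℂ)) : Space N → ℂ) ξ = 0
    rw [hz, smul_zero]
  intro n
  have h5 : (⇑(𝓕 (L.kernel j x) : 𝓢(Space N, ℂ)) : Space N → ℂ) =ᶠ[nhds 0] fun _ => 0 := h2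
  rw [h5.iteratedFDeriv ℝ n |>.eq_of_nhds, iteratedFDeriv_fun_zero]; rfl

/-- The dyadic block `Δ_j f = φ(2^{-j} D) f = h_j * f`, a function on `ℝᴺ`. -/
def block (j : ℤ) (f : ZDual N) (x : Space N) : ℂ := f ⟨L.kernel j x, L.kernel_mem j x⟩

/-- The norm `∑_k 2^{ks} w_k ‖Δ_k f‖_{L^p}` of the homogeneous Besov space `Ḃ^s_{p,1}(w)` with
weights `w_k ≥ 0`. -/
def besovNorm (w : ℤ → ℝ) (s : ℝ) (p : ℝ≥0∞) (f : ZDual N) : ℝ≥0∞ :=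
  ∑' k : ℤ, ENNReal.ofReal ((2 : ℝ) ^ ((k : ℝ) * s) * w k) * eLpNorm (L.block k f) p volume

/-- The norm of `L^q(0, t; Ḃ^s_{p,1}(w))`. -/
def timeBesovNorm (q : ℝ≥0∞) (t : ℝ) (w : ℤ → ℝ) (s : ℝ) (p : ℝ≥0∞) (f : ℝ → ZDual N) : ℝ≥0∞ :=
  eLpNorm (fun τ => L.besovNorm w s p (f τ)) q (volume.restrict (Ioc 0 t))

/-- The Chemin–Lerner norm `∑_k 2^{ks} w_k ‖Δ_k f‖_{L^q(0, t; L^p)}`. -/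
def tildeBesovNorm (q : ℝ≥0∞) (t : ℝ) (w : ℤ → ℝ) (s : ℝ) (p : ℝ≥0∞) (f : ℝ → ZDual N) : ℝ≥0∞ :=
  ∑' k : ℤ, ENNReal.ofReal ((2 : ℝ) ^ ((k : ℝ) * s) * w k) *
    eLpNorm (fun τ => eLpNorm (L.block k (f τ)) p volume) q (volume.restrict (Ioc 0 t))

end LittlewoodPaley

/-- The partial derivative `∂_i u^l` of a vector field `u` on `ℝᴺ`, as a complex-valued function. -/
def partialDeriv {N : ℕ} (u : Space N → Space N) (i l : Fin N) (x : Space N) : ℂ :=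
  ((fderiv ℝ u x (EuclideanSpace.single i 1) l : ℝ) : ℂ)

namespace LittlewoodPaley

variable {N : ℕ} (L : LittlewoodPaley N)

/-- The norm `‖∇u‖_{Ḃ^s_{p,1}}`, as the sum of the norms of the entries of `∇u`. -/
def gradBesovNorm (s : ℝ) (p : ℝ≥0∞) (u : Space N → Space N) : ℝ≥0∞ :=
  ∑ i : Fin N, ∑ l : Fin N, L.besovNorm (fun _ => 1) s p (ZDual.ofFun (partialDeriv u i l))

/-- The function `V(t) = ∫_0^t ‖∇v(τ)‖_{Ḃ^{N/p}_{p,1}} dτ`. -/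
def gradIntegral (p : ℝ≥0∞) (v : ℝ → Space N → Space N) (t : ℝ) : ℝ≥0∞ :=
  ∫⁻ τ in Ioc 0 t, L.gradBesovNorm ((N : ℝ) * (1 / p).toReal) p (v τ)

/-- Elements of `Ḃ^{N/p}_{p,1}` are identified with the bounded continuous functions which are
the sums of their dyadic blocks. The vector field `u` has a gradient of this kind:
`∇u` is a bounded function and `∇u = ∑_k Δ_k ∇u`. -/
structure HasRealizedGradient (u : Space N → Space N) : Prop where
  differentiable : Differentiable ℝ u
  bounded : ∀ i l, MemLp (partialDeriv u i l) ∞ volume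
  hasSum : ∀ i l x,
    HasSum (fun k : ℤ => L.block k (ZDual.ofFun (partialDeriv u i l)) x) (partialDeriv u i l x)

/-- The pairing `⟨u · ∇(Δ_k f), ψ⟩ = ∫ (u · ∇(Δ_k f)) ψ`. -/
def blockTransport (u : Space N → Space N) (k : ℤ) (f : ZDual N) (ψ : ZSpace N) : ℂ :=
  ∫ x, fderiv ℝ (L.block k f) x (u x) * (ψ : 𝓢(Space N, ℂ)) x

/-- The pairing `⟨u · ∇f, ψ⟩`, where the product is `u · ∇f = ∑_k u · ∇(Δ_k f)`. -/
def transport (u : Space N → Space N) (f : ZDual N) (ψ : ZSpace N) : ℂ :=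
  ∑' k : ℤ, L.blockTransport u k f ψ

/-- `f` is a (weak) solution on `[0, T]` of `∂_t f + v · ∇f = g`, `f(0) = f₀`, in the integrated
form `f(t) = f₀ + ∫_0^t (g - v · ∇f) dτ` in `𝒵'`; the first two fields say that the terms
of the equation are meaningful. -/
structure IsTransportSolution (T : ℝ) (v : ℝ → Space N → Space N) (g : ℝ → ZDual N)
    (f₀ : ZDual N) (f : ℝ → ZDual N) : Prop where
  summable : ∀ᵐ τ ∂(volume.restrict (Ioc 0 T)), ∀ ψ : ZSpace N,
    Summable fun k : ℤ => L.blockTransport (v τ) k (f τ) ψ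
  integrable : ∀ ψ : ZSpace N,
    IntegrableOn (fun τ => g τ ψ) (Ioc 0 T) ∧
      IntegrableOn (fun τ => L.transport (v τ) (f τ) ψ) (Ioc 0 T)
  equation : ∀ t ∈ Icc (0 : ℝ) T, ∀ ψ : ZSpace N,
    f t ψ = f₀ ψ + ∫ τ in (0 : ℝ)..t, (g τ ψ - L.transport (v τ) (f τ) ψ)

end LittlewoodPaley

/-- The conditions on the functions `e_k : [0, ∞) → [0, 1]`: they increase with `k`, and
`e_k` and `e_{k'}` are comparable, uniformly in time, for neighbouring `k` and `k'`. -/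
structure IsWeightSequence (e : ℤ → ℝ → ℝ) : Prop where
  mem_Icc : ∀ k t, 0 ≤ t → e k t ∈ Icc (0 : ℝ) 1
  mono : ∀ k k' t, 0 ≤ t → k ≤ k' → e k t ≤ e k' t
  comparable : ∃ K : ℝ, ∀ k t, 0 ≤ t → e (k + 1) t ≤ K * e k t

/-- The weight `ω_k(t) = ∑_{ℓ ≥ k} 2^{k - ℓ} e_ℓ(t)`, with `ℓ = k + m`. -/
def weight (e : ℤ → ℝ → ℝ) (t : ℝ) (k : ℤ) : ℝ :=
  ∑' m : ℕ, (2 : ℝ) ^ (-(m : ℤ)) * e (k + m) t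

end

/-!
The estimate is the one for Lipschitz transport, applied to each dyadic block and summed with
weights.

*The blocks.* A functional on `𝒵` factors through finitely many Schwartz seminorms, so that by the
Hahn–Banach theorem it extends to a finite product of Banach spaces of bounded continuous
functions, where an integral of translates is a Bochner integral
(`ZDual.continuous_and_apply_eq_integral`). Hence `Δ_j f` is a continuous function, it is reproduced
by convolution with a slightly larger dyadic kernel, and Young's inequality gives the Bernstein
inequalities for it. Testing the equation against the kernel of `Δ_k` at `x` gives, pointwise in `x`,

  `∂_t Δ_k f + v · ∇Δ_k f = Δ_k g + R_k`,  `R_k = v · ∇Δ_k f - Δ_k (v · ∇f)`,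

see `LittlewoodPaley.IsTransportSolution.isLipschitzTransport`.

*The commutators.* Only `∇v` has a dyadic decomposition. The pieces `Δ_m w` of a component `w` of `v`
are therefore built from `∇w`, and they sum up to `w` after subtraction of values at a point:
`w(x) - w(y) = ∑ (Δ_m w(x) - Δ_m w(y))` (`LittlewoodPaley.IsRealized.exists_hasSum_gradPiece_sub`).
This is all a commutator sees. Let `a_j = 2^{js} ω_j ‖Δ_j f‖_{L^p}`. The contribution of `Δ_j f` to
`2^{ks} ω_k ‖R_k‖_{L^p}` is bounded as follows.

* If `j ≤ k - 5`, only the pieces of `v` with `|m - k| ≤ 2` matter, and Bernstein's inequality for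
  `∇Δ_j f` gives `2^{(j-k)(1 + N/p - s)} (ω_k / ω_j) 2^{kN/p} ‖Δ_k ∇v‖_{L^p} a_j`, with `Δ_k` replaced
  by a few neighbouring blocks. As `ω_k ≤ 2^{k-j} ω_j` and `s ≤ N/p`, the power of `2` is at most one,
  and the sum over `k` is that of the norm of `∇v`.
* If `|j - k| ≤ 4`, the Lipschitz bound for `v` gains `2^{-k}`, which compensates the derivative.
* If `j ≥ k + 5`, only the pieces with `|m - j| ≤ 3` matter. With `q = max(p, p')`, these are in
  `L^q`, and the kernel of `Δ_k` in `L^{q'}` has norm of order `2^{kN/q}`, so that the contribution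
  is at most of order `2^{(k-j)(s + N/q)} a_j ‖∇v‖`, since `ω_k ≤ ω_j`. The exponent is positive
  because `1/q = min(1/p, 1/p')`.

So `∑ 2^{ks} ω_k ‖R_k‖_{L^p} ≤ c ‖∇v‖ ‖f‖`, with a constant independent of the weights, of which only
`ω_k ≤ ω_{k'} ≤ 2^{k'-k} ω_k` for `k ≤ k'` was used
(`LittlewoodPaley.exists_tsum_commutator_le`, `isSlowWeight_weight`).

*The transport estimate.* No flow of `v` is constructed. Over a short time interval `[s, t]` the
solution is compared with its value at `s`, transported along `x ↦ x - ∫_s^t v(τ, x) dτ`. This map is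
antilipschitz with a constant close to one, which controls the `L^p` norm of the composition, and
the consistency error on a bounded set is a small multiple of the time integral of the growth bound
of `v`, by uniform continuity of the gradient of the solution (`IsLipschitzTransport.eLpNorm_le`).

Multiplying the `L^p` estimates of the blocks by `2^{ks} ω_k` and summing them, Gronwall's
inequality `gronwall_lintegral` absorbs the commutators. The range of `s` is empty for `p = ∞`, so
that `p` is finite throughout.
-/

open scoped LineDeriv BoundedContinuousFunction

noncomputable section

/-! ### Integral inequalities -/

/-- Minkowski's integral inequality for a measurable function. With `n(y) = ‖F(·, y)‖_r` and `r'`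
conjugate to `r`, Hölder's inequality is applied to `F(x, y) n(y)^{-1/r'}` and `n(y)^{1/r'}`. -/
theorem lintegral_rpow_lintegral_le_of_measurable {α β : Type*} [MeasurableSpace α]
    [MeasurableSpace β] {μ : Measure α} {ν : Measure β} [SFinite μ] [SFinite ν]
    {F : α → β → ℝ≥0∞} (hF : Measurable (Function.uncurry F)) {r : ℝ} (hr : 1 ≤ r) :
    (∫⁻ x, (∫⁻ y, F x y ∂ν) ^ r ∂μ) ^ (1 / r) ≤ ∫⁻ y, (∫⁻ x, F x y ^ r ∂μ) ^ (1 / r) ∂ν := by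
  rcases hr.eq_or_lt with rfl | hr1
  · simp only [ENNReal.rpow_one, div_one]
    exact (lintegral_lintegral_swap hF.aemeasurable).le
  have hr0 : 0 < r := by linarith
  set n : β → ℝ≥0∞ := fun y => (∫⁻ x, F x y ^ r ∂μ) ^ (1 / r) with hn
  have hnm : Measurable n := by
    refine Measurable.pow_const ?_ _
    exact Measurable.lintegral_prod_left' (f := fun z : α × β => F z.1 z.2 ^ r) (hF.pow_const r)
  set S := ∫⁻ y, n y ∂ν with hS
  rcases eq_or_ne S ∞ with hSt | hSt
  · rw [hSt]; exact le_top
  have hc : r.HolderConjugate (r / (r - 1)) := Real.HolderConjugate.conjExponent hr1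
  set r' := r / (r - 1) with hr'
  have hr'0 : 0 < r' := hc.symm.pos
  have hrr : r / r' = r - 1 := by rw [hr']; field_simp
  have hfin : ∀ᵐ y ∂ν, n y < ∞ := ae_lt_top hnm hSt
  -- where `n y = 0` the function `F · y` vanishes almost everywhere
  have hae : ∀ᵐ x ∂μ, ∀ᵐ y ∂ν, F x y ≤ (F x y * n y ^ (-(1 / r'))) * n y ^ (1 / r') := by
    have hset : MeasurableSet {z : α × β |
        F z.1 z.2 ≤ (F z.1 z.2 * n z.2 ^ (-(1 / r'))) * n z.2 ^ (1 / r')} := by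
      have h2 : Measurable fun z : α × β => n z.2 := hnm.comp measurable_snd
      exact measurableSet_le hF ((hF.mul (h2.pow_const _)).mul (h2.pow_const _))
    rw [Measure.ae_ae_comm hset]
    filter_upwards [hfin] with y hy
    rcases eq_or_ne (n y) 0 with h0 | h0
    · have h1 : ∫⁻ x, F x y ^ r ∂μ = 0 := by
        have := h0
        simp only [hn] at this
        rcases ENNReal.rpow_eq_zero_iff.1 this with h | h
        · exact h.1
        · exact absurd h.2 (by positivity : (0 : ℝ) < 1 / r).not_gt
      have hm : Measurable fun x => F x y ^ r := (hF.comp measurable_prodMk_right).pow_const r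
      rw [lintegral_eq_zero_iff hm] at h1
      filter_upwards [h1] with x hx
      have : F x y = 0 := by
        rcases ENNReal.rpow_eq_zero_iff.1 hx with h | h
        · exact h.1
        · linarith [h.2]
      simp [this]
    · refine Filter.Eventually.of_forall fun x => ?_
      rw [mul_assoc, ← ENNReal.rpow_add _ _ h0 hy.ne]
      simp
  have key : ∀ᵐ x ∂μ, (∫⁻ y, F x y ∂ν) ^ r ≤
      (∫⁻ y, F x y ^ r * n y ^ (-(r - 1)) ∂ν) * S ^ (r - 1) := by
    filter_upwards [hae] with x hx
    have hFx : Measurable (F x) := hF.comp measurable_prodMk_left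
    have h1 := (lintegral_mono_ae hx).trans
      (ENNReal.lintegral_mul_le_Lp_mul_Lq ν hc (f := fun y => F x y * n y ^ (-(1 / r')))
        (g := fun y => n y ^ (1 / r')) (hFx.mul (hnm.pow_const _)).aemeasurable
        (hnm.pow_const _).aemeasurable)
    have h2 := ENNReal.rpow_le_rpow h1 hr0.le
    refine h2.trans_eq ?_
    rw [ENNReal.mul_rpow_of_nonneg _ _ hr0.le, ← ENNReal.rpow_mul, ← ENNReal.rpow_mul,
      one_div_mul_cancel hr0.ne', ENNReal.rpow_one]
    congr 1
    · refine lintegral_congr fun y => ?_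
      rw [ENNReal.mul_rpow_of_nonneg _ _ hr0.le, ← ENNReal.rpow_mul]
      congr 2
      rw [← hrr]; ring
    · congr 1
      · refine lintegral_congr fun y => ?_
        rw [← ENNReal.rpow_mul, one_div_mul_cancel hr'0.ne', ENNReal.rpow_one]
      · rw [← hrr]; ring
  have hn2 : Measurable fun y => n y ^ (-(r - 1)) := hnm.pow_const _
  have h3 : ∫⁻ x, (∫⁻ y, F x y ∂ν) ^ r ∂μ ≤ S ^ r := by
    calc ∫⁻ x, (∫⁻ y, F x y ∂ν) ^ r ∂μ
        ≤ ∫⁻ x, (∫⁻ y, F x y ^ r * n y ^ (-(r - 1)) ∂ν) * S ^ (r - 1) ∂μ := lintegral_mono_ae key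
      _ = (∫⁻ x, ∫⁻ y, F x y ^ r * n y ^ (-(r - 1)) ∂ν ∂μ) * S ^ (r - 1) :=
          lintegral_mul_const' _ _ (ENNReal.rpow_ne_top_of_nonneg (by linarith) hSt)
      _ = (∫⁻ y, ∫⁻ x, F x y ^ r * n y ^ (-(r - 1)) ∂μ ∂ν) * S ^ (r - 1) := by
          rw [lintegral_lintegral_swap]
          exact ((hF.pow_const r).mul (hn2.comp measurable_snd)).aemeasurable
      _ ≤ (∫⁻ y, n y ∂ν) * S ^ (r - 1) := by
          gcongr ?_ * _
          refine lintegral_mono_ae ?_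
          filter_upwards [hfin] with y hy
          have hm : Measurable fun x => F x y ^ r := (hF.comp measurable_prodMk_right).pow_const r
          rw [lintegral_mul_const _ hm]
          have : ∫⁻ x, F x y ^ r ∂μ = n y ^ r := by
            simp only [hn]
            rw [← ENNReal.rpow_mul, one_div_mul_cancel hr0.ne', ENNReal.rpow_one]
          rw [this]
          rcases eq_or_ne (n y) 0 with h0 | h0
          · rw [h0, ENNReal.zero_rpow_of_pos hr0, zero_mul]
          · rw [← ENNReal.rpow_add _ _ h0 hy.ne]
            simp
      _ = S ^ r := by
          rw [← hS]
          rcases eq_or_ne S 0 with h0 | h0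
          · rw [h0, zero_mul, ENNReal.zero_rpow_of_pos hr0]
          · conv_lhs => enter [1]; rw [← ENNReal.rpow_one S]
            rw [← ENNReal.rpow_add _ _ h0 hSt]; congr 1; ring
  calc _ ≤ (S ^ r) ^ (1 / r) := ENNReal.rpow_le_rpow h3 (by positivity)
    _ = S := by rw [← ENNReal.rpow_mul, mul_one_div_cancel hr0.ne', ENNReal.rpow_one]

/-- **Minkowski's integral inequality.** -/
theorem lintegral_rpow_lintegral_le {α β : Type*} [MeasurableSpace α]
    [MeasurableSpace β] {μ : Measure α} {ν : Measure β} [SFinite μ] [SFinite ν]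
    {F : α → β → ℝ≥0∞} (hF : AEMeasurable (Function.uncurry F) (μ.prod ν)) {r : ℝ} (hr : 1 ≤ r) :
    (∫⁻ x, (∫⁻ y, F x y ∂ν) ^ r ∂μ) ^ (1 / r) ≤ ∫⁻ y, (∫⁻ x, F x y ^ r ∂μ) ^ (1 / r) ∂ν := by
  have h := lintegral_rpow_lintegral_le_of_measurable (μ := μ) (ν := ν)
    (F := fun x y => hF.mk _ (x, y)) hF.measurable_mk hr
  have h1 : ∀ᵐ x ∂μ, ∀ᵐ y ∂ν, F x y = hF.mk _ (x, y) := Measure.ae_ae_of_ae_prod hF.ae_eq_mk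
  have h2 : ∀ᵐ y ∂ν, ∀ᵐ x ∂μ, F x y = hF.mk _ (x, y) := by
    have := (Measure.measurePreserving_swap (μ := ν) (ν := μ)).quasiMeasurePreserving.ae
      hF.ae_eq_mk
    exact Measure.ae_ae_of_ae_prod this
  have e1 : ∫⁻ x, (∫⁻ y, F x y ∂ν) ^ r ∂μ = ∫⁻ x, (∫⁻ y, hF.mk _ (x, y) ∂ν) ^ r ∂μ := by
    refine lintegral_congr_ae ?_
    filter_upwards [h1] with x hx
    rw [lintegral_congr_ae hx]
  have e2 : ∫⁻ y, (∫⁻ x, F x y ^ r ∂μ) ^ (1 / r) ∂ν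
      = ∫⁻ y, (∫⁻ x, hF.mk _ (x, y) ^ r ∂μ) ^ (1 / r) ∂ν := by
    refine lintegral_congr_ae ?_
    filter_upwards [h2] with y hy
    congr 1
    refine lintegral_congr_ae ?_
    filter_upwards [hy] with x hx
    rw [hx]
  rw [e1, e2]
  exact h

/-- Minkowski's integral inequality in terms of `eLpNorm`. -/
theorem eLpNorm_le_lintegral_eLpNorm {α β E E' : Type*} [MeasurableSpace α]
    [MeasurableSpace β] [NormedAddCommGroup E] [NormedAddCommGroup E']
    {μ : Measure α} {ν : Measure β} [SFinite μ] [SFinite ν]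
    {F : β → α → E} (hF : AEMeasurable (fun z : α × β => ‖F z.2 z.1‖ₑ) (μ.prod ν))
    {p : ℝ≥0∞} (hp : 1 ≤ p) (hp' : p ≠ ∞) {R : α → E'}
    (hR : ∀ᵐ x ∂μ, ‖R x‖ₑ ≤ ∫⁻ y, ‖F y x‖ₑ ∂ν) :
    eLpNorm R p μ ≤ ∫⁻ y, eLpNorm (F y) p μ ∂ν := by
  have hp0 : p ≠ 0 := (zero_lt_one.trans_le hp).ne'
  have hr : 1 ≤ p.toReal := by
    rw [← ENNReal.toReal_one]; exact ENNReal.toReal_mono hp' hp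
  have h := lintegral_rpow_lintegral_le (F := fun x y => ‖F y x‖ₑ) hF hr
  simp only [eLpNorm_eq_lintegral_rpow_enorm_toReal hp0 hp'] at *
  refine le_trans (ENNReal.rpow_le_rpow (lintegral_mono_ae ?_) (by positivity)) h
  filter_upwards [hR] with x hx
  exact ENNReal.rpow_le_rpow hx (by positivity)


/-- A trilinear form of Young's convolution inequality:
`‖|H| * |b c|‖_{L^p} ≤ ‖H‖_{L^{q'}} ‖b‖_{L^q} ‖c‖_{L^p}` for conjugate exponents `q, q'` with
`q' ≤ p`. -/
theorem eLpNorm_le_of_enorm_le_lintegral_mul {N : ℕ} {E₁ E₂ E₃ E₄ : Type*}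
    [NormedAddCommGroup E₁] [NormedAddCommGroup E₂] [NormedAddCommGroup E₃] [NormedAddCommGroup E₄]
    {H : Space N → E₁} {b : Space N → E₂} {c : Space N → E₃} {R : Space N → E₄}
    (hH : Continuous H) (hb : Continuous b) (hc : Continuous c)
    {p q q' : ℝ≥0∞} [hq : q.HolderConjugate q'] (hp : 1 ≤ p) (hp' : p ≠ ∞) (hqp : q' ≤ p)
    (hR : ∀ x, ‖R x‖ₑ ≤ ∫⁻ y, ‖H (x - y)‖ₑ * (‖b y‖ₑ * ‖c y‖ₑ)) :
    eLpNorm R p volume ≤ eLpNorm H q' volume * eLpNorm b q volume * eLpNorm c p volume := by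
  have hq1 : 1 ≤ q' := ENNReal.HolderConjugate.one_le q' q
  have hqt : q' ≠ ∞ := ne_top_of_le_ne_top hp' hqp
  have hp0 : p ≠ 0 := (zero_lt_one.trans_le hp).ne'
  have hq0 : q' ≠ 0 := (zero_lt_one.trans_le hq1).ne'
  set r := p.toReal with hr
  set t := q'.toReal with ht
  have hr0 : 0 < r := ENNReal.toReal_pos hp0 hp'
  have ht0 : 0 < t := ENNReal.toReal_pos hq0 hqt
  have htr : t ≤ r := ENNReal.toReal_mono hp' hqp
  have hrt : 1 ≤ r / t := (one_le_div ht0).2 htr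
  have h1 : ∀ x, ‖R x‖ₑ ≤ eLpNorm b q volume *
      (∫⁻ y, ‖H y‖ₑ ^ t * ‖c (x - y)‖ₑ ^ t) ^ (1 / t) := by
    intro x
    have hm : AEStronglyMeasurable (fun y => ‖H (x - y)‖ * ‖c y‖) volume := by
      exact Continuous.aestronglyMeasurable (by fun_prop)
    have := eLpNorm_smul_le_mul_eLpNorm (p := q) (q := q') (r := 1) hm
      (hb.norm.aestronglyMeasurable (μ := volume))
    have e1 : eLpNorm ((fun y => ‖b y‖) • fun y => ‖H (x - y)‖ * ‖c y‖) 1 volume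
        = ∫⁻ y, ‖H (x - y)‖ₑ * (‖b y‖ₑ * ‖c y‖ₑ) := by
      rw [eLpNorm_one_eq_lintegral_enorm]
      refine lintegral_congr fun y => ?_
      simp only [Pi.smul_apply', smul_eq_mul, enorm_mul, enorm_norm]
      ring
    have e2 : eLpNorm (fun y => ‖H (x - y)‖ * ‖c y‖) q' volume
        = (∫⁻ y, ‖H y‖ₑ ^ t * ‖c (x - y)‖ₑ ^ t) ^ (1 / t) := by
      rw [eLpNorm_eq_lintegral_rpow_enorm_toReal hq0 hqt]
      congr 1
      rw [← lintegral_sub_left_eq_self (μ := volume) _ x]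
      refine lintegral_congr fun y => ?_
      rw [enorm_mul, enorm_norm, enorm_norm, ENNReal.mul_rpow_of_nonneg _ _ ht0.le, sub_sub_cancel]
    rw [e1, e2, eLpNorm_norm] at this
    exact (hR x).trans this
  have h2 : Measurable (Function.uncurry fun x y : Space N => ‖H y‖ₑ ^ t * ‖c (x - y)‖ₑ ^ t) := by
    refine Measurable.mul ?_ ?_
    · exact ((hH.enorm.comp continuous_snd).measurable.pow_const _)
    · exact ((hc.enorm.comp (continuous_fst.sub continuous_snd)).measurable.pow_const _)
  have h3 := lintegral_rpow_lintegral_le_of_measurable (μ := volume) (ν := volume) h2 hrt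
  have h4 : ∫⁻ y, (∫⁻ x, (‖H y‖ₑ ^ t * ‖c (x - y)‖ₑ ^ t) ^ (r / t)) ^ (1 / (r / t))
      = (eLpNorm H q' volume * eLpNorm c p volume) ^ t := by
    rw [ENNReal.mul_rpow_of_nonneg _ _ ht0.le, eLpNorm_eq_lintegral_rpow_enorm_toReal hq0 hqt,
      ← ENNReal.rpow_mul, one_div_mul_cancel ht0.ne', ENNReal.rpow_one, ← lintegral_mul_const _
        (hH.enorm.measurable.pow_const _)]
    refine lintegral_congr fun y => ?_
    have : ∀ x, (‖H y‖ₑ ^ t * ‖c (x - y)‖ₑ ^ t) ^ (r / t) = ‖H y‖ₑ ^ r * ‖c (x - y)‖ₑ ^ r := by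
      intro x
      rw [ENNReal.mul_rpow_of_nonneg _ _ (by positivity), ← ENNReal.rpow_mul, ← ENNReal.rpow_mul,
        mul_div_cancel₀ _ ht0.ne']
    simp only [this]
    have hm : Measurable fun x => ‖c (x - y)‖ₑ ^ r :=
      ((hc.enorm.comp (continuous_id.sub continuous_const)).measurable.pow_const _)
    rw [lintegral_const_mul _ hm,
      lintegral_sub_right_eq_self (μ := volume) (fun x => ‖c x‖ₑ ^ r) y,
      ENNReal.mul_rpow_of_nonneg _ _ (by positivity), ← ENNReal.rpow_mul,
      eLpNorm_eq_lintegral_rpow_enorm_toReal hp0 hp', ← ENNReal.rpow_mul]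
    congr 2 <;> simp only [← hr, ← ht] <;> field_simp
  calc eLpNorm R p volume
      ≤ eLpNorm b q volume * (∫⁻ x, (∫⁻ y, ‖H y‖ₑ ^ t * ‖c (x - y)‖ₑ ^ t) ^ (r / t)) ^ (1 / r) := by
        rw [eLpNorm_eq_lintegral_rpow_enorm_toReal hp0 hp']
        calc (∫⁻ x, ‖R x‖ₑ ^ r) ^ (1 / r)
            ≤ (∫⁻ x, eLpNorm b q volume ^ r *
                (∫⁻ y, ‖H y‖ₑ ^ t * ‖c (x - y)‖ₑ ^ t) ^ (r / t)) ^ (1 / r) := by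
              refine ENNReal.rpow_le_rpow (lintegral_mono fun x => ?_) (by positivity)
              refine (ENNReal.rpow_le_rpow (h1 x) hr0.le).trans_eq ?_
              rw [ENNReal.mul_rpow_of_nonneg _ _ hr0.le, ← ENNReal.rpow_mul]
              congr 2; ring
          _ = _ := by
              have hm : Measurable fun x : Space N =>
                  (∫⁻ y, ‖H y‖ₑ ^ t * ‖c (x - y)‖ₑ ^ t) ^ (r / t) :=
                (Measurable.lintegral_prod_right h2).pow_const _
              rw [lintegral_const_mul _ hm, ENNReal.mul_rpow_of_nonneg _ _ (by positivity),
                ← ENNReal.rpow_mul, mul_one_div_cancel hr0.ne', ENNReal.rpow_one]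
    _ ≤ eLpNorm b q volume * (eLpNorm H q' volume * eLpNorm c p volume) := by
        gcongr
        rw [h4] at h3
        have := ENNReal.rpow_le_rpow h3 (z := 1 / t) (by positivity)
        rw [← ENNReal.rpow_mul, ← ENNReal.rpow_mul, mul_one_div_cancel ht0.ne',
          ENNReal.rpow_one] at this
        refine le_trans (le_of_eq ?_) this
        congr 1; field_simp
    _ = _ := by ring

/-- Young's inequality `‖|H| * |c|‖_{L^p} ≤ ‖H‖_{L^1} ‖c‖_{L^p}`. -/
theorem eLpNorm_le_of_enorm_le_lintegral {N : ℕ} {E₁ E₃ E₄ : Type*}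
    [NormedAddCommGroup E₁] [NormedAddCommGroup E₃] [NormedAddCommGroup E₄]
    {H : Space N → E₁} {c : Space N → E₃} {R : Space N → E₄}
    (hH : Continuous H) (hc : Continuous c) {p : ℝ≥0∞} (hp : 1 ≤ p)
    (hR : ∀ x, ‖R x‖ₑ ≤ ∫⁻ y, ‖H (x - y)‖ₑ * ‖c y‖ₑ) :
    eLpNorm R p volume ≤ eLpNorm H 1 volume * eLpNorm c p volume := by
  rcases eq_or_ne p ∞ with rfl | hp'
  · simp only [eLpNorm_exponent_top]
    refine essSup_le_of_ae_le _ (Filter.Eventually.of_forall fun x => (hR x).trans ?_)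
    calc ∫⁻ y, ‖H (x - y)‖ₑ * ‖c y‖ₑ ≤ ∫⁻ y, ‖H (x - y)‖ₑ * eLpNormEssSup c volume := by
          refine lintegral_mono_ae ?_
          filter_upwards [enorm_ae_le_eLpNormEssSup c volume] with y hy
          gcongr
      _ = _ := by
          have hm : Measurable fun y => ‖H (x - y)‖ₑ :=
            (hH.enorm.comp (continuous_const.sub continuous_id)).measurable
          rw [lintegral_mul_const _ hm,
            lintegral_sub_left_eq_self (μ := volume) (fun y => ‖H y‖ₑ) x,
            eLpNorm_one_eq_lintegral_enorm]
  have h := eLpNorm_le_of_enorm_le_lintegral_mul (b := fun _ : Space N => (1 : ℝ)) hH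
    continuous_const hc (q := ∞) (q' := 1) hp hp' hp (R := R) (by simpa using hR)
  refine h.trans ?_
  have : eLpNorm (fun _ : Space N => (1 : ℝ)) ∞ volume ≤ 1 := by
    rw [eLpNorm_exponent_top]
    exact essSup_le_of_ae_le _ (Filter.Eventually.of_forall fun x => by simp)
  calc _ ≤ eLpNorm H 1 volume * 1 * eLpNorm c p volume := by gcongr
    _ = _ := by rw [mul_one]

/-- Hölder's inequality for a convolution: `‖|H| * |c|‖_{L^∞} ≤ ‖H‖_{L^{p'}} ‖c‖_{L^p}`. -/
theorem lintegral_enorm_mul_enorm_le {N : ℕ} {E₁ E₃ : Type*}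
    [NormedAddCommGroup E₁] [NormedAddCommGroup E₃]
    {H : Space N → E₁} {c : Space N → E₃} (hH : Continuous H) (hc : AEStronglyMeasurable c volume)
    {p p' : ℝ≥0∞} [hq : p'.HolderConjugate p] (x : Space N) :
    ∫⁻ y, ‖H (x - y)‖ₑ * ‖c y‖ₑ ≤ eLpNorm H p' volume * eLpNorm c p volume := by
  have hm : AEStronglyMeasurable (fun y => ‖H (x - y)‖) volume :=
    Continuous.aestronglyMeasurable (by fun_prop)
  have := eLpNorm_smul_le_mul_eLpNorm (p := p') (q := p) (r := 1) hc.norm hm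
  have e1 : eLpNorm ((fun y => ‖H (x - y)‖) • fun y => ‖c y‖) 1 volume
      = ∫⁻ y, ‖H (x - y)‖ₑ * ‖c y‖ₑ := by
    rw [eLpNorm_one_eq_lintegral_enorm]
    refine lintegral_congr fun y => ?_
    simp only [Pi.smul_apply', smul_eq_mul, enorm_mul, enorm_norm]
  have e2 : eLpNorm (fun y => H (x - y)) p' volume = eLpNorm H p' volume :=
    eLpNorm_comp_measurePreserving (g := H) hH.aestronglyMeasurable
      (Measure.measurePreserving_sub_left volume x)
  rw [e1, eLpNorm_norm, eLpNorm_norm, e2] at this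
  exact this

/-- Interpolation between `L^p` and `L^∞`. -/
theorem eLpNorm_le_rpow_mul_of_enorm_le {α E : Type*} [MeasurableSpace α] [NormedAddCommGroup E]
    {μ : Measure α} {a : α → E} {K p q : ℝ≥0∞} (hp : 1 ≤ p) (hp' : p ≠ ∞) (hpq : p ≤ q) (hKt : K ≠ ∞)
    (hK : ∀ x, ‖a x‖ₑ ≤ K * eLpNorm a p μ) (ha : eLpNorm a p μ ≠ ∞) :
    eLpNorm a q μ ≤ K ^ (p.toReal * (1 / p.toReal - (1 / q).toReal)) * eLpNorm a p μ := by
  have hp0 : p ≠ 0 := (zero_lt_one.trans_le hp).ne'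
  set r := p.toReal with hr
  have hr0 : 0 < r := ENNReal.toReal_pos hp0 hp'
  rcases eq_or_ne q ∞ with rfl | hq
  · have e : r * (1 / r - (1 / (∞ : ℝ≥0∞)).toReal) = 1 := by
      simp [hr0.ne']
    rw [e, ENNReal.rpow_one, eLpNorm_exponent_top]
    exact essSup_le_of_ae_le _ (Filter.Eventually.of_forall hK)
  have hq0 : q ≠ 0 := (zero_lt_one.trans_le (hp.trans hpq)).ne'
  set t := q.toReal with ht
  have ht0 : 0 < t := ENNReal.toReal_pos hq0 hq
  have hrt : r ≤ t := ENNReal.toReal_mono hq hpq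
  set A := eLpNorm a p μ with hA
  have hApow : ∫⁻ x, ‖a x‖ₑ ^ r ∂μ = A ^ r := by
    rw [hA, eLpNorm_eq_lintegral_rpow_enorm_toReal hp0 hp', ← ENNReal.rpow_mul,
      one_div_mul_cancel hr0.ne', ENNReal.rpow_one]
  have hpt : (1 / q).toReal = 1 / t := by rw [one_div, ENNReal.toReal_inv, one_div]
  rcases eq_or_ne A 0 with hA0 | hA0
  · have hz : eLpNorm a q μ = 0 := by
      have : ∀ x, ‖a x‖ₑ = 0 := fun x => by simpa [hA0] using hK x
      rw [eLpNorm_eq_lintegral_rpow_enorm_toReal hq0 hq]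
      simp [this, ← ht, ht0]
    rw [hz]; exact zero_le
  rw [eLpNorm_eq_lintegral_rpow_enorm_toReal hq0 hq, hpt]
  have h1 : ∫⁻ x, ‖a x‖ₑ ^ t ∂μ ≤ (K * A) ^ (t - r) * A ^ r := by
    rw [← hApow]
    rw [← lintegral_const_mul' _ _ (ENNReal.rpow_ne_top_of_nonneg (by linarith)
      (ENNReal.mul_ne_top hKt ha))]
    refine lintegral_mono fun x => ?_
    have e : ‖a x‖ₑ ^ t = ‖a x‖ₑ ^ (t - r) * ‖a x‖ₑ ^ r := by
      rw [← ENNReal.rpow_add_of_nonneg _ _ (by linarith) hr0.le]; congr 1; ring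
    rw [e]
    have := ENNReal.rpow_le_rpow (hK x) (z := t - r) (by linarith)
    gcongr
  refine (ENNReal.rpow_le_rpow h1 (by positivity)).trans_eq ?_
  rw [ENNReal.mul_rpow_of_nonneg _ _ (by positivity), ← ENNReal.rpow_mul, ← ENNReal.rpow_mul,
    ENNReal.mul_rpow_of_nonneg _ _ (by rw [mul_one_div]; exact div_nonneg (by linarith) ht0.le),
    mul_assoc, ← ENNReal.rpow_add _ _ hA0 ha]
  have e1 : (t - r) * (1 / t) + r * (1 / t) = 1 := by field_simp; ring
  have e2 : (t - r) * (1 / t) = r * (1 / r - 1 / t) := by field_simp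
  rw [e1, ENNReal.rpow_one, e2]

/-! ### A Gronwall inequality -/

/-- The derivative of `t ↦ exp (-∫_0^t m)` is `-m exp (-∫_0^t m)`, in integrated form. -/
theorem integral_mul_exp_neg_integral {m : ℝ → ℝ} (hm0 : ∀ t, 0 ≤ m t) {T a b : ℝ}
    (hm : IntervalIntegrable m volume 0 T) (ha : 0 ≤ a) (hab : a ≤ b) (hb : b ≤ T) :
    ∫ t in a..b, m t * Real.exp (-∫ s in (0 : ℝ)..t, m s) =
      Real.exp (-∫ s in (0 : ℝ)..a, m s) - Real.exp (-∫ s in (0 : ℝ)..b, m s) := by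
  have hsub : uIcc a b ⊆ uIcc 0 T := by
    rw [uIcc_of_le hab, uIcc_of_le (by linarith)]
    exact Icc_subset_Icc ha hb
  have hV : AbsolutelyContinuousOnInterval (fun t => ∫ s in (0 : ℝ)..t, m s) 0 T :=
    hm.absolutelyContinuousOnInterval_intervalIntegral left_mem_uIcc
  have hlip : ∀ x y : ℝ, 0 ≤ x → 0 ≤ y → |Real.exp (-x) - Real.exp (-y)| ≤ |x - y| := by
    have key : ∀ x y : ℝ, 0 ≤ x → x ≤ y → |Real.exp (-x) - Real.exp (-y)| ≤ |x - y| := by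
      intro x y hx hxy
      have h1 : Real.exp (-y) ≤ Real.exp (-x) := Real.exp_le_exp.2 (by linarith)
      have h2 : Real.exp (-x) ≤ 1 := Real.exp_le_one_iff.2 (by linarith)
      have h3 := Real.add_one_le_exp (x - y)
      have h4 : Real.exp (-y) = Real.exp (-x) * Real.exp (x - y) := by
        rw [← Real.exp_add]; ring_nf
      rw [abs_of_nonneg (by linarith), abs_of_nonpos (by linarith)]
      nlinarith [Real.exp_pos (-x)]
    intro x y hx hy
    rcases le_total x y with h | h
    · exact key x y hx h
    · rw [abs_sub_comm, abs_sub_comm x]; exact key y x hy h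
  have hE : AbsolutelyContinuousOnInterval
      (fun t => Real.exp (-∫ s in (0 : ℝ)..t, m s)) 0 T := by
    rw [absolutelyContinuousOnInterval_iff] at hV ⊢
    intro ε hε
    obtain ⟨δ, hδ, h⟩ := hV ε hε
    refine ⟨δ, hδ, fun E hE hs => (Finset.sum_le_sum fun i hi => ?_).trans_lt (h E hE hs)⟩
    have hnn : ∀ t ∈ uIcc 0 T, 0 ≤ ∫ s in (0 : ℝ)..t, m s := by
      intro t ht
      rw [uIcc_of_le (by linarith)] at ht
      exact intervalIntegral.integral_nonneg ht.1 fun s _ => hm0 s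
    have hm := hE.1 i hi
    exact hlip _ _ (hnn _ hm.1) (hnn _ hm.2)
  have h1 := (hE.mono hsub).integral_deriv_eq_sub
  have h2 : ∫ t in a..b, m t * Real.exp (-∫ s in (0 : ℝ)..t, m s)
      = -∫ t in a..b, deriv (fun t => Real.exp (-∫ s in (0 : ℝ)..t, m s)) t := by
    rw [← intervalIntegral.integral_neg]
    refine intervalIntegral.integral_congr_ae ?_
    filter_upwards [hm.ae_hasDerivAt_integral] with t ht htm
    have h3 : HasDerivAt (fun t => Real.exp (-∫ s in (0 : ℝ)..t, m s)) _ t :=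
      (ht (hsub (uIoc_subset_uIcc htm)) 0 left_mem_uIcc).neg.exp
    rw [h3.deriv]
    simp only [Pi.neg_apply]; ring
  rw [h2, h1]; ring

/-- **Gronwall's inequality**, in integral form with extended nonnegative functions. The hypothesis
is multiplied by `m e^{-V}`, where `V` is the primitive of `m`, integrated over `[0, T]`, and the
order of integration is exchanged. The bound `B` on `y` makes the integral of `m y` finite, so that
it can be cancelled. -/
theorem gronwall_lintegral {T : ℝ} (hT : 0 ≤ T) {m : ℝ → ℝ} (hm0 : ∀ t, 0 ≤ m t)
    (hm : IntervalIntegrable m volume 0 T) {y α : ℝ → ℝ≥0∞}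
    (hy : AEMeasurable y (volume.restrict (Ioc 0 T)))
    (hα : AEMeasurable α (volume.restrict (Ioc 0 T))) {A B : ℝ≥0∞} (hB : B ≠ ∞)
    (hyB : ∀ᵐ τ ∂volume.restrict (Ioc 0 T), y τ ≤ B)
    (h : ∀ᵐ τ ∂volume.restrict (Ioc 0 T),
      y τ ≤ A + ((∫⁻ s in Ioc 0 τ, α s) + ∫⁻ s in Ioc 0 τ, ENNReal.ofReal (m s) * y s)) :
    A + ((∫⁻ s in Ioc 0 T, α s) + ∫⁻ s in Ioc 0 T, ENNReal.ofReal (m s) * y s) ≤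
      ENNReal.ofReal (Real.exp (∫ s in (0 : ℝ)..T, m s)) *
        (A + ∫⁻ τ in Ioc 0 T, ENNReal.ofReal (Real.exp (-∫ s in (0 : ℝ)..τ, m s)) * α τ) := by
  set V : ℝ → ℝ := fun t => ∫ s in (0 : ℝ)..t, m s with hV
  set μ := volume.restrict (Ioc 0 T) with hμ
  have hmI : Integrable m μ := (intervalIntegrable_iff_integrableOn_Ioc_of_le hT).1 hm
  have hVc : ContinuousOn V (Icc 0 T) := by
    have := intervalIntegral.continuousOn_primitive_interval
      (μ := volume) (f := m) (a := 0) (b := T) (by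
        rw [uIcc_of_le hT]; exact (integrableOn_Icc_iff_integrableOn_Ioc (by simp)).2 hmI)
    rwa [uIcc_of_le hT] at this
  have hEm : AEMeasurable (fun t => ENNReal.ofReal (Real.exp (-V t))) μ := by
    have h1 : AEMeasurable V μ :=
      ((hVc.mono Ioc_subset_Icc_self).aemeasurable measurableSet_Ioc)
    exact (Real.measurable_exp.comp_aemeasurable h1.neg).ennreal_ofReal
  have hm' : AEMeasurable (fun t => ENNReal.ofReal (m t)) μ := hmI.1.aemeasurable.ennreal_ofReal
  set k : ℝ → ℝ≥0∞ := fun t => ENNReal.ofReal (m t) * ENNReal.ofReal (Real.exp (-V t)) with hk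
  have hkm : AEMeasurable k μ := hm'.mul hEm
  set J : ℝ → ℝ≥0∞ := fun τ => ∫⁻ t in Ioc τ T, k t with hJ
  set e := ENNReal.ofReal (Real.exp (-V T)) with he
  have hJe : ∀ τ ∈ Icc 0 T, J τ + e = ENNReal.ofReal (Real.exp (-V τ)) := by
    intro τ hτ
    have h1 := integral_mul_exp_neg_integral hm0 hm hτ.1 hτ.2 le_rfl
    have h2 : J τ = ENNReal.ofReal (∫ t in τ..T, m t * Real.exp (-V t)) := by
      rw [intervalIntegral.integral_of_le hτ.2, ofReal_integral_eq_lintegral_ofReal]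
      · refine lintegral_congr fun t => ?_
        rw [ENNReal.ofReal_mul (hm0 t)]
      · have hsub : Ioc τ T ⊆ Ioc 0 T := Ioc_subset_Ioc_left hτ.1
        have hmτ : IntegrableOn m (Ioc τ T) := IntegrableOn.mono_set hmI hsub
        refine hmτ.mul_bdd (c := 1) ?_ ?_
        · exact (Real.continuous_exp.comp_continuousOn
            (hVc.mono (hsub.trans Ioc_subset_Icc_self)).neg).aestronglyMeasurable measurableSet_Ioc
        · refine (ae_restrict_iff' measurableSet_Ioc).2 (Filter.Eventually.of_forall fun t ht => ?_)
          rw [Real.norm_eq_abs, Real.abs_exp, Real.exp_le_one_iff, neg_nonpos]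
          exact intervalIntegral.integral_nonneg (hτ.1.trans ht.1.le) fun s _ => hm0 s
      · exact Filter.Eventually.of_forall fun t => mul_nonneg (hm0 t) (Real.exp_pos _).le
    rw [h2, he, ← ENNReal.ofReal_add _ (Real.exp_pos _).le, h1]
    · congr 1; ring
    · rw [h1, sub_nonneg]
      refine Real.exp_le_exp.2 (neg_le_neg ?_)
      have := intervalIntegral.integral_interval_sub_left (hm)
        (hm.mono_set (c := 0) (d := τ) (by
          rw [uIcc_of_le hT, uIcc_of_le hτ.1]; exact Icc_subset_Icc_right hτ.2))
      have h3 := intervalIntegral.integral_nonneg (μ := volume) hτ.2 fun s _ => hm0 s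
      linarith
  -- exchanging the order of integration over the triangle `0 < s ≤ t ≤ T`
  have hfub : ∀ G : ℝ → ℝ≥0∞, AEMeasurable G μ →
      ∫⁻ t, (k t * ∫⁻ s in Ioc 0 t, G s) ∂μ = ∫⁻ s, G s * J s ∂μ := by
    intro G hG
    have h1 : ∀ t ∈ Ioc 0 T, k t * ∫⁻ s in Ioc 0 t, G s
        = ∫⁻ s, k t * (Iic t).indicator G s ∂μ := by
      intro t ht
      have hkt : k t ≠ ∞ := ENNReal.mul_ne_top ENNReal.ofReal_ne_top ENNReal.ofReal_ne_top
      rw [lintegral_const_mul' _ _ hkt, lintegral_indicator measurableSet_Iic, hμ,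
        Measure.restrict_restrict measurableSet_Iic]
      congr 3
      ext s; simp only [mem_Ioc, mem_inter_iff, mem_Iic]; constructor
      · rintro ⟨a, b⟩; exact ⟨b, a, b.trans ht.2⟩
      · rintro ⟨a, b, -⟩; exact ⟨b, a⟩
    have h2 : ∀ s ∈ Ioc 0 T, G s * J s = ∫⁻ t, k t * (Iic t).indicator G s ∂μ := by
      intro s hs
      have h3 : ∀ t, k t * (Iic t).indicator G s = (Ici s).indicator k t * G s := by
        intro t
        by_cases hst : s ≤ t
        · rw [indicator_of_mem (show s ∈ Iic t from hst), indicator_of_mem (show t ∈ Ici s from hst)]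
        · rw [indicator_of_notMem (show s ∉ Iic t from hst),
            indicator_of_notMem (show t ∉ Ici s from hst), mul_zero, zero_mul]
      simp only [h3]
      rw [lintegral_mul_const'' _ (hkm.indicator measurableSet_Ici), mul_comm,
        lintegral_indicator measurableSet_Ici, hμ, Measure.restrict_restrict measurableSet_Ici]
      congr 1
      have : Ici s ∩ Ioc 0 T = Icc s T := by
        ext t; simp only [mem_inter_iff, mem_Ici, mem_Ioc, mem_Icc]; constructor
        · rintro ⟨a, -, b⟩; exact ⟨a, b⟩
        · rintro ⟨a, b⟩; exact ⟨a, hs.1.trans_le a, b⟩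
      rw [this]
      exact setLIntegral_congr Ioc_ae_eq_Icc
    rw [setLIntegral_congr_fun measurableSet_Ioc h1, setLIntegral_congr_fun measurableSet_Ioc h2,
      lintegral_lintegral_swap]
    have h4 : (Function.uncurry fun t s => k t * (Iic t).indicator G s)
        = {z : ℝ × ℝ | z.2 ≤ z.1}.indicator (fun z => k z.1 * G z.2) := by
      ext ⟨t, s⟩
      by_cases hst : s ≤ t
      · rw [indicator_of_mem (show (t, s) ∈ {z : ℝ × ℝ | z.2 ≤ z.1} from hst)]
        simp only [Function.uncurry_apply_pair]
        rw [indicator_of_mem (show s ∈ Iic t from hst)]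
      · rw [indicator_of_notMem (show (t, s) ∉ {z : ℝ × ℝ | z.2 ≤ z.1} from hst)]
        simp only [Function.uncurry_apply_pair]
        rw [indicator_of_notMem (show s ∉ Iic t from hst), mul_zero]
    rw [h4]
    exact (hkm.comp_fst.mul hG.comp_snd).indicator (measurableSet_le measurable_snd measurable_fst)
  set P := ∫⁻ s, ENNReal.ofReal (m s) * y s ∂μ with hP
  set X := ∫⁻ s, ENNReal.ofReal (m s) * y s * J s ∂μ with hX
  have hmy : AEMeasurable (fun s => ENNReal.ofReal (m s) * y s) μ := hm'.mul hy
  have hae : ∀ᵐ τ ∂μ, τ ∈ Ioc 0 T := ae_restrict_mem measurableSet_Ioc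
  have hJm : ∀ G : ℝ → ℝ≥0∞, AEMeasurable G μ →
      ∫⁻ s, G s * J s ∂μ + e * ∫⁻ s, G s ∂μ
        = ∫⁻ s, ENNReal.ofReal (Real.exp (-V s)) * G s ∂μ := by
    intro G hG
    rw [mul_comm, ← lintegral_mul_const'' _ hG, ← lintegral_add_right' _ (hG.mul_const _)]
    refine lintegral_congr_ae ?_
    filter_upwards [hae] with s hs
    rw [← mul_add, hJe s (Ioc_subset_Icc_self hs), mul_comm]
  have hXfin : X ≠ ∞ := by
    have hb : X ≤ ∫⁻ s, ENNReal.ofReal (m s) * B ∂μ := by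
      refine lintegral_mono_ae ?_
      filter_upwards [hae, hyB] with s hs hsB
      have hJ1 : J s ≤ 1 := by
        have h0 : J s ≤ J s + e := le_self_add
        rw [hJe s (Ioc_subset_Icc_self hs)] at h0
        refine h0.trans (ENNReal.ofReal_le_one.2 (Real.exp_le_one_iff.2 (neg_nonpos.2 ?_)))
        exact intervalIntegral.integral_nonneg hs.1.le fun s _ => hm0 s
      calc _ ≤ ENNReal.ofReal (m s) * B * 1 := by gcongr
        _ = _ := mul_one _
    refine ne_top_of_le_ne_top ?_ hb
    rw [lintegral_mul_const'' _ hm']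
    refine ENNReal.mul_ne_top ?_ hB
    rw [← ofReal_integral_eq_lintegral_ofReal hmI (Filter.Eventually.of_forall hm0)]
    exact ENNReal.ofReal_ne_top
  have hmain : X + e * P ≤ X + (A * J 0 + ∫⁻ s, α s * J s ∂μ) := by
    rw [hJm _ hmy]
    calc ∫⁻ s, ENNReal.ofReal (Real.exp (-V s)) * (ENNReal.ofReal (m s) * y s) ∂μ
        ≤ ∫⁻ s, (k s * A + (k s * ∫⁻ u in Ioc 0 s, α u) +
            k s * ∫⁻ u in Ioc 0 s, ENNReal.ofReal (m u) * y u) ∂μ := by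
          refine lintegral_mono_ae ?_
          filter_upwards [h] with s hs
          calc _ = k s * y s := by simp only [hk]; ring
            _ ≤ k s * (A + ((∫⁻ u in Ioc 0 s, α u) +
                ∫⁻ u in Ioc 0 s, ENNReal.ofReal (m u) * y u)) := by gcongr
            _ = _ := by rw [mul_add, mul_add, add_assoc]
      _ ≤ (∫⁻ s, k s * A ∂μ + ∫⁻ s, (k s * ∫⁻ u in Ioc 0 s, α u) ∂μ) +
            ∫⁻ s, (k s * ∫⁻ u in Ioc 0 s, ENNReal.ofReal (m u) * y u) ∂μ := by
          have hmon : ∀ G : ℝ → ℝ≥0∞, AEMeasurable (fun s => k s * ∫⁻ u in Ioc 0 s, G u) μ := by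
            intro G
            refine hkm.mul (Measurable.aemeasurable ?_)
            exact Monotone.measurable fun a b hab => lintegral_mono_set (Ioc_subset_Ioc_right hab)
          rw [lintegral_add_right' _ (hmon _), lintegral_add_right' _ (hmon _)]
      _ = X + (A * J 0 + ∫⁻ s, α s * J s ∂μ) := by
          rw [hfub _ hα, hfub _ hmy, lintegral_mul_const'' _ hkm]
          simp only [hX, hJ, hμ]; ring
  have h5 : e * P ≤ A * J 0 + ∫⁻ s, α s * J s ∂μ := (ENNReal.add_le_add_iff_left hXfin).1 hmain
  have h6 : e * (A + ((∫⁻ s, α s ∂μ) + P))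
      ≤ A + ∫⁻ s, ENNReal.ofReal (Real.exp (-V s)) * α s ∂μ := by
    have hV0 : V 0 = 0 := intervalIntegral.integral_same
    calc e * (A + ((∫⁻ s, α s ∂μ) + P)) = e * A + e * (∫⁻ s, α s ∂μ) + e * P := by ring
      _ ≤ e * A + e * (∫⁻ s, α s ∂μ) + (A * J 0 + ∫⁻ s, α s * J s ∂μ) := by gcongr
      _ = A * (J 0 + e) + ((∫⁻ s, α s * J s ∂μ) + e * ∫⁻ s, α s ∂μ) := by ring
      _ = _ := by rw [hJe 0 ⟨le_rfl, hT⟩, hJm _ hα, hV0]; simp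
  calc A + ((∫⁻ s, α s ∂μ) + P)
      = ENNReal.ofReal (Real.exp (V T)) * (e * (A + ((∫⁻ s, α s ∂μ) + P))) := by
        rw [← mul_assoc, he, ← ENNReal.ofReal_mul (Real.exp_pos _).le, ← Real.exp_add]
        simp
    _ ≤ _ := by gcongr

/-! ### Convolution with Schwartz functions -/

/-- The convolution `H * a`, as a function. -/
def conv {N : ℕ} (H a : Space N → ℂ) (x : Space N) : ℂ := ∫ y, H (x - y) * a y

theorem SchwartzMap.exists_norm_le_one_add_rpow {E F : Type*} [NormedAddCommGroup E]
    [NormedSpace ℝ E] [NormedAddCommGroup F] [NormedSpace ℝ F] (G : 𝓢(E, F)) (n : ℕ) :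
    ∃ C, 0 ≤ C ∧ ∀ z, ‖G z‖ ≤ C * (1 + ‖z‖) ^ (-(n : ℝ)) := by
  refine ⟨2 ^ n * (Finset.Iic (n, 0)).sup (fun m => SchwartzMap.seminorm ℝ m.1 m.2) G, by positivity,
    fun z => ?_⟩
  have h := SchwartzMap.one_add_le_sup_seminorm_apply (𝕜 := ℝ) (m := (n, 0)) (k := n) (n := 0)
    le_rfl le_rfl G z
  rw [norm_iteratedFDeriv_zero] at h
  have h1 : (0 : ℝ) < 1 + ‖z‖ := by positivity
  rw [Real.rpow_neg h1.le, Real.rpow_natCast, ← div_eq_mul_inv, le_div_iff₀ (by positivity),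
    mul_comm]
  exact h

section conv

variable {N : ℕ}

theorem SchwartzMap.integrable_sub_left {F : Type*} [NormedAddCommGroup F] [NormedSpace ℝ F]
    (H : 𝓢(Space N, F)) (x : Space N) : Integrable (fun y => H (x - y)) volume :=
  (integrable_comp_sub_left (μ := volume) (fun y => H y) x).2 H.integrable

theorem integrable_conv (H : 𝓢(Space N, ℂ)) {a : Space N → ℂ} (ha : AEStronglyMeasurable a volume)
    {B : ℝ} (hB : ∀ x, ‖a x‖ ≤ B) (x : Space N) : Integrable (fun y => H (x - y) * a y) volume :=
  (H.integrable_sub_left x).mul_bdd ha (Filter.Eventually.of_forall hB)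

theorem norm_conv_le (H : 𝓢(Space N, ℂ)) {a : Space N → ℂ}
    {B : ℝ} (hB : ∀ x, ‖a x‖ ≤ B) (x : Space N) : ‖conv H a x‖ ≤ (∫ y, ‖H y‖) * B := by
  rw [← integral_sub_left_eq_self (μ := volume) _ x, ← integral_mul_const]
  refine norm_integral_le_of_norm_le ((H.integrable_sub_left x).norm.mul_const B) ?_
  refine Filter.Eventually.of_forall fun y => ?_
  rw [norm_mul]
  exact mul_le_mul_of_nonneg_left (hB y) (norm_nonneg _)

theorem enorm_conv_le (H a : Space N → ℂ) (x : Space N) :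
    ‖conv H a x‖ₑ ≤ ∫⁻ y, ‖H (x - y)‖ₑ * ‖a y‖ₑ := by
  refine (enorm_integral_le_lintegral_enorm _).trans_eq ?_
  simp only [enorm_mul]

theorem conv_congr_left {H H' : Space N → ℂ} (h : ∀ x, H x = H' x) (a : Space N → ℂ) (x : Space N) :
    conv H a x = conv H' a x := by
  simp only [conv, h]

theorem conv_const_mul_left (c : ℂ) (H a : Space N → ℂ) (x : Space N) :
    conv (fun y => c * H y) a x = c * conv H a x := by
  simp only [conv, mul_assoc]
  exact integral_const_mul _ _

/-- The derivative of a convolution falls on the Schwartz factor. -/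
theorem hasFDerivAt_conv (H : 𝓢(Space N, ℂ)) {a : Space N → ℂ}
    (ha : AEStronglyMeasurable a volume) {B : ℝ} (hB : ∀ x, ‖a x‖ ≤ B) (x : Space N) :
    HasFDerivAt (conv H a) (∫ y, a y • fderiv ℝ H (x - y)) x := by
  have hB0 : 0 ≤ B := (norm_nonneg _).trans (hB 0)
  obtain ⟨C, hC, hCb⟩ := (SchwartzMap.fderivCLM ℝ (Space N) ℂ H).exists_norm_le_one_add_rpow (N + 1)
  simp only [SchwartzMap.fderivCLM_apply] at hCb
  have hc0 : Continuous (fderiv ℝ H) := (SchwartzMap.fderivCLM ℝ (Space N) ℂ H).continuous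
  have hc : ∀ x : Space N, Continuous fun y => fderiv ℝ H (x - y) := fun x =>
    hc0.comp (continuous_const.sub continuous_id)
  refine hasFDerivAt_integral_of_dominated_of_fderiv_le (F' := fun x y => a y • fderiv ℝ H (x - y))
    (s := Metric.ball x 1)
    (bound := fun y => B * (C * (2 ^ (N + 1) * (1 + ‖x - y‖) ^ (-((N + 1 : ℕ) : ℝ)))))
    (Metric.ball_mem_nhds x one_pos) ?_ ?_ ?_ ?_ ?_ ?_
  · exact Filter.Eventually.of_forall fun x' => (integrable_conv H ha hB x').1
  · exact integrable_conv H ha hB x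
  · exact ha.smul (hc x).aestronglyMeasurable
  · refine Filter.Eventually.of_forall fun y x' hx' => ?_
    rw [norm_smul]
    refine mul_le_mul (hB y) ((hCb _).trans ?_) (norm_nonneg _) hB0
    refine mul_le_mul_of_nonneg_left ?_ hC
    have h1 : ‖x - y‖ ≤ ‖x' - y‖ + 1 := by
      have := norm_add_le (x' - y) (x - x')
      rw [show x' - y + (x - x') = x - y by abel] at this
      have h2 : ‖x - x'‖ < 1 := by rw [← dist_eq_norm, dist_comm]; exact hx'
      linarith
    have h3 : 1 + ‖x - y‖ ≤ 2 * (1 + ‖x' - y‖) := by linarith [norm_nonneg (x' - y)]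
    rw [Real.rpow_neg (by positivity), Real.rpow_neg (by positivity), Real.rpow_natCast,
      Real.rpow_natCast, ← div_eq_mul_inv, inv_eq_one_div, div_le_div_iff₀ (by positivity)
      (by positivity), one_mul, ← mul_pow]
    gcongr
  · refine (((Integrable.const_mul ?_ _).const_mul C).const_mul B)
    have : Integrable (fun y : Space N => (1 + ‖y‖) ^ (-((N + 1 : ℕ) : ℝ))) volume := by
      apply integrable_one_add_norm
      simp
    exact (integrable_comp_sub_left (μ := volume) (fun y => (1 + ‖y‖) ^ (-((N + 1 : ℕ) : ℝ))) x).2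
      this
  · refine Filter.Eventually.of_forall fun y x' _ => ?_
    have h1 : HasFDerivAt (fun x => H (x - y)) (fderiv ℝ H (x' - y)) x' := by
      have := (H.hasFDerivAt (x' - y)).comp x' ((hasFDerivAt_id x').sub_const y)
      rwa [ContinuousLinearMap.comp_id] at this
    exact h1.mul_const (a y)

theorem fderiv_conv_apply (H : 𝓢(Space N, ℂ)) {a : Space N → ℂ}
    (ha : AEStronglyMeasurable a volume) {B : ℝ} (hB : ∀ x, ‖a x‖ ≤ B) (x m : Space N) :
    fderiv ℝ (conv H a) x m = conv (∂_{m} H : 𝓢(Space N, ℂ)) a x := by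
  have hi : Integrable (fun y => a y • fderiv ℝ H (x - y)) volume := by
    have := (SchwartzMap.fderivCLM ℝ (Space N) ℂ H).integrable_sub_left x
    simp only [SchwartzMap.fderivCLM_apply] at this
    exact this.bdd_smul B ha (Filter.Eventually.of_forall hB)
  rw [(hasFDerivAt_conv H ha hB x).fderiv, ContinuousLinearMap.integral_apply hi]
  refine integral_congr_ae (Filter.Eventually.of_forall fun y => ?_)
  simp [SchwartzMap.lineDerivOp_apply_eq_fderiv, mul_comm]

theorem continuous_conv (H : 𝓢(Space N, ℂ)) {a : Space N → ℂ}
    (ha : AEStronglyMeasurable a volume) {B : ℝ} (hB : ∀ x, ‖a x‖ ≤ B) : Continuous (conv H a) :=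
  continuous_iff_continuousAt.2 fun x => (hasFDerivAt_conv H ha hB x).continuousAt

/-- The adjoint of convolution with `H` is convolution with `H(-·)`. -/
theorem integral_conv_mul (H : 𝓢(Space N, ℂ)) {a g : Space N → ℂ}
    (ha : AEStronglyMeasurable a volume) {B : ℝ} (hB : ∀ x, ‖a x‖ ≤ B)
    (hg : Integrable g volume) :
    ∫ y, conv H a y * g y = ∫ z, a z * ∫ y, H (y - z) * g y := by
  have h1 : ∀ y, conv H a y * g y = ∫ z, H (y - z) * a z * g y := fun y =>
    (integral_mul_const _ _).symm
  have h2 : ∀ z, a z * ∫ y, H (y - z) * g y = ∫ y, H (y - z) * a z * g y := fun z => by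
    rw [← integral_const_mul]; congr 1; ext y; ring
  simp only [h1, h2]
  refine integral_integral_swap ?_
  have hneg : Integrable (fun z => H (-z)) volume := H.integrable.comp_neg
  have h3 := (hg.convolution_integrand (ContinuousLinearMap.mul ℝ ℂ) hneg).swap
  have h4 : Integrable (fun z : Space N × Space N => a z.2 * (g z.1 * H (-(z.2 - z.1))))
      (volume.prod volume) := by
    refine Integrable.bdd_mul (c := B) (g := fun z : Space N × Space N => g z.1 * H (-(z.2 - z.1)))
      h3 ha.comp_snd
      (Filter.Eventually.of_forall fun z => hB z.2)
  refine h4.congr (Filter.Eventually.of_forall fun z => ?_)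
  simp only [Function.uncurry, neg_sub]
  ring

/-- Associativity of convolution. -/
theorem conv_conv (H G : 𝓢(Space N, ℂ)) {a : Space N → ℂ}
    (ha : AEStronglyMeasurable a volume) {B : ℝ} (hB : ∀ x, ‖a x‖ ≤ B) (x : Space N) :
    conv H (conv G a) x = conv (conv H G) a x := by
  have h := integral_conv_mul G ha hB (H.integrable_sub_left x)
  have h1 : conv H (conv G a) x = ∫ y, conv G a y * H (x - y) := by
    simp only [conv, mul_comm]
  rw [h1, h]
  refine integral_congr_ae (Filter.Eventually.of_forall fun z => ?_)
  simp only [conv]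
  rw [mul_comm, ← integral_sub_right_eq_self (μ := volume) (fun y => H (x - z - y) * G y) z]
  simp only [sub_sub_sub_cancel_right, mul_comm]

/-- Integration by parts in a convolution with a function of at most linear growth. -/
theorem conv_lineDeriv_eq (H : 𝓢(Space N, ℂ)) {w : Space N → ℂ} (hw : Differentiable ℝ w)
    {M : ℝ} (hM : ∀ x, ‖fderiv ℝ w x‖ ≤ M) (x m : Space N) :
    conv (∂_{m} H : 𝓢(Space N, ℂ)) w x = conv H (fun y => fderiv ℝ w y m) x := by
  have hlip : ∀ y, ‖w y‖ ≤ ‖w x‖ + M * ‖x - y‖ := by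
    intro y
    have h := Convex.norm_image_sub_le_of_norm_fderiv_le (𝕜 := ℝ) (s := univ) (x := x) (y := y)
      (fun z _ => hw z) (fun z _ => hM z) convex_univ (mem_univ _) (mem_univ _)
    rw [norm_sub_rev y x] at h
    have := norm_add_le (w y - w x) (w x)
    rw [sub_add_cancel] at this
    linarith
  have hM0 : 0 ≤ M := (norm_nonneg _).trans (hM 0)
  have hgrow : ∀ G : 𝓢(Space N, ℂ), Integrable (fun y => G (x - y) * w y) volume := by
    intro G
    have h1 : Integrable (fun z => ‖w x‖ * ‖G z‖ + M * (‖z‖ ^ 1 * ‖G z‖)) volume :=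
      (G.integrable.norm.const_mul _).add ((G.integrable_pow_mul volume 1).const_mul _)
    have h2 := (integrable_comp_sub_left (μ := volume)
      (fun z => ‖w x‖ * ‖G z‖ + M * (‖z‖ ^ 1 * ‖G z‖)) x).2 h1
    refine h2.mono' ?_ (Filter.Eventually.of_forall fun y => ?_)
    · exact Continuous.aestronglyMeasurable
        ((G.continuous.comp (continuous_const.sub continuous_id)).mul hw.continuous)
    · rw [norm_mul]
      have := mul_le_mul_of_nonneg_left (hlip y) (norm_nonneg (G (x - y)))
      refine this.trans_eq ?_
      ring
  have hd : ∀ y, HasFDerivAt (fun y => H (x - y)) (-fderiv ℝ H (x - y)) y := by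
    intro y
    have := (H.hasFDerivAt (x - y)).comp y ((hasFDerivAt_id y).const_sub x)
    convert! this using 1
    ext v; simp
  have hd' : ∀ y, fderiv ℝ (fun y => H (x - y)) y m = -(∂_{m} H : 𝓢(Space N, ℂ)) (x - y) := by
    intro y; rw [(hd y).fderiv, SchwartzMap.lineDerivOp_apply_eq_fderiv]; rfl
  have hmeas : AEStronglyMeasurable (fun y => fderiv ℝ w y m) volume :=
    (measurable_fderiv_apply_const ℝ w m).aestronglyMeasurable
  have hDB : ∀ y, ‖fderiv ℝ w y m‖ ≤ M * ‖m‖ := fun y =>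
    (ContinuousLinearMap.le_opNorm _ _).trans (mul_le_mul_of_nonneg_right (hM y) (norm_nonneg _))
  have key := integral_mul_fderiv_eq_neg_fderiv_mul_of_integrable (μ := volume)
    (f := fun y => H (x - y)) (g := w) (v := m) ?_ ?_ (hgrow H)
    (fun y _ => (hd y).differentiableAt) (fun y _ => hw y)
  · simp only [conv]
    rw [key, ← integral_neg]
    simp only [hd', neg_mul, neg_neg]
  · simp only [hd', neg_mul]
    exact (hgrow _).neg
  · exact integrable_conv H hmeas hDB x

end conv

/-! ### Frequency supports of products -/

section spectrum

variable {N : ℕ}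

/-- The Fourier transform turns a convolution into a product. -/
theorem conv_eq_of_fourier_eq_mul {H G K : 𝓢(Space N, ℂ)} (h : ∀ ξ, 𝓕 K ξ = 𝓕 H ξ * 𝓕 G ξ)
    (x : Space N) : conv H G x = K x := by
  have h1 : 𝓕 (SchwartzMap.convolution (ContinuousLinearMap.mul ℂ ℂ) G H) = 𝓕 K := by
    ext ξ
    rw [SchwartzMap.fourier_convolution, SchwartzMap.pairing_apply_apply, h ξ]
    simp [mul_comm]
  have h2 : SchwartzMap.convolution (ContinuousLinearMap.mul ℂ ℂ) G H = K := by
    have := congrArg (fun f : 𝓢(Space N, ℂ) => (𝓕⁻ f : 𝓢(Space N, ℂ))) h1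
    simpa using this
  rw [← h2, SchwartzMap.convolution_apply, convolution_def]
  simp [conv, mul_comm]

/-- The frequencies of a product `A B` are sums of frequencies of `A` and `B`, as `A B` is the
Fourier transform of a convolution. If none of them is the opposite of a frequency of `C`, then the
integral of `A B C` vanishes. -/
theorem integral_mul_mul_eq_zero {A B C : 𝓢(Space N, ℂ)}
    (h : ∀ ξ η, 𝓕 A ξ ≠ 0 → 𝓕 B η ≠ 0 → 𝓕 C (-(ξ + η)) = 0) : ∫ y, A y * B y * C y = 0 := by
  set f : 𝓢(Space N, ℂ) := 𝓕⁻ A with hf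
  set g : 𝓢(Space N, ℂ) := 𝓕⁻ B with hg
  set c := SchwartzMap.convolution (ContinuousLinearMap.mul ℂ ℂ) f g with hc
  have hfA : ∀ (F : 𝓢(Space N, ℂ)) t, (𝓕⁻ F : 𝓢(Space N, ℂ)) t = 𝓕 F (-t) := fun F t => by
    rw [SchwartzMap.fourierInv_coe, SchwartzMap.fourier_coe, Real.fourierInv_eq_fourier_neg]
  have h1 : ∀ y, A y * B y = 𝓕 c y := by
    intro y
    rw [hc, SchwartzMap.fourier_convolution, SchwartzMap.pairing_apply_apply, hf, hg]
    simp
  simp only [h1]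
  rw [SchwartzMap.integral_fourier_mul_eq]
  refine integral_eq_zero_of_ae (Filter.Eventually.of_forall fun ζ => ?_)
  by_cases hζ : 𝓕 C ζ = 0
  · simp [hζ]
  have : c ζ = 0 := by
    rw [hc, SchwartzMap.convolution_apply, convolution_def]
    refine integral_eq_zero_of_ae (Filter.Eventually.of_forall fun t => ?_)
    simp only [ContinuousLinearMap.mul_apply', Pi.zero_apply, hf, hg, hfA]
    by_contra hne
    refine hζ ?_
    have := h (-t) (-(ζ - t)) (left_ne_zero_of_mul hne) (right_ne_zero_of_mul hne)
    rwa [show -(-t + -(ζ - t)) = ζ by abel] at this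
  simp [this]

theorem fourier_compSubConst_ne_zero {f : 𝓢(Space N, ℂ)} {z ξ : Space N}
    (h : 𝓕 (SchwartzMap.compSubConstCLM ℂ z f) ξ ≠ 0) : 𝓕 f ξ ≠ 0 := by
  intro h0
  refine h ?_
  have hk : (⇑(SchwartzMap.compSubConstCLM ℂ z f) : Space N → ℂ) = (fun y => f (y + -z)) := by
    ext y
    rw [SchwartzMap.compSubConstCLM_apply, sub_eq_add_neg]
  rw [SchwartzMap.fourier_coe, hk]
  refine (congrFun (VectorFourier.fourierIntegral_comp_add_right Real.fourierChar volume
      (innerₗ (Space N)) (⇑f : Space N → ℂ) (-z)) ξ).trans ?_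
  change _ • 𝓕 (⇑f : Space N → ℂ) ξ = 0
  rw [← SchwartzMap.fourier_coe, h0, smul_zero]

/-- If the sums of frequencies of `β` and `γ` avoid the frequencies of `κ`, then
`κ * ((β * b) (γ * c)) = 0`. -/
theorem integral_conv_mul_conv_mul_eq_zero {β γ κ : 𝓢(Space N, ℂ)}
    (h : ∀ ξ η, 𝓕 β ξ ≠ 0 → 𝓕 γ η ≠ 0 → 𝓕 κ (ξ + η) = 0)
    {b c : Space N → ℂ} (hb : AEStronglyMeasurable b volume) (hc : AEStronglyMeasurable c volume)
    {B C : ℝ} (hB : ∀ x, ‖b x‖ ≤ B) (hC : ∀ x, ‖c x‖ ≤ C) (x : Space N) :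
    ∫ y, conv β b y * conv γ c y * κ (x - y) = 0 := by
  have hκ := κ.integrable_sub_left x
  have h1 : Integrable (fun y => conv γ c y * κ (x - y)) volume :=
    hκ.bdd_mul (continuous_conv γ hc hC).aestronglyMeasurable
      (Filter.Eventually.of_forall (norm_conv_le γ hC))
  have e1 := integral_conv_mul β hb hB h1
  simp only [mul_assoc]
  rw [e1]
  refine integral_eq_zero_of_ae (Filter.Eventually.of_forall fun z => ?_)
  have h2 : Integrable (fun y => β (y - z) * κ (x - y)) volume :=
    hκ.bdd_mul (c := SchwartzMap.seminorm ℝ 0 0 β) (Continuous.aestronglyMeasurable (by fun_prop))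
      (Filter.Eventually.of_forall fun y => SchwartzMap.norm_le_seminorm ℝ β _)
  have e2 := integral_conv_mul γ hc hC h2
  have e3 : ∀ w, ∫ y, γ (y - w) * (β (y - z) * κ (x - y)) = 0 := by
    intro w
    set κ' : 𝓢(Space N, ℂ) := SchwartzMap.compSubConstCLM ℂ x
      (SchwartzMap.compCLMOfContinuousLinearEquiv ℂ (ContinuousLinearEquiv.neg ℝ) κ) with hκ'
    have hk : ∀ y, κ' y = κ (x - y) := by
      intro y
      simp [hκ', SchwartzMap.compSubConstCLM_apply]
    have := integral_mul_mul_eq_zero (A := SchwartzMap.compSubConstCLM ℂ z β)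
      (B := SchwartzMap.compSubConstCLM ℂ w γ) (C := κ') (fun ξ η hξ hη => ?_)
    · rw [← this]
      refine integral_congr_ae (Filter.Eventually.of_forall fun y => ?_)
      simp only [SchwartzMap.compSubConstCLM_apply, hk]
      ring
    · by_contra hne
      have h3 := fourier_compSubConst_ne_zero hne
      refine h3 ?_
      have h4 := h ξ η (fourier_compSubConst_ne_zero hξ) (fourier_compSubConst_ne_zero hη)
      rw [← h4, SchwartzMap.fourier_coe, SchwartzMap.fourier_coe]
      have := congrFun (Real.fourierInv_eq_fourier_comp_neg (⇑κ : Space N → ℂ)) (-(ξ + η))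
      rw [Real.fourierInv_eq_fourier_neg, neg_neg] at this
      rw [this]
      rfl
  have e4 : ∫ y, β (y - z) * (conv γ c y * κ (x - y)) = 0 := by
    have : ∀ y, β (y - z) * (conv γ c y * κ (x - y)) = conv γ c y * (β (y - z) * κ (x - y)) :=
      fun y => by ring
    simp only [this, e2, e3, mul_zero, integral_zero]
  simp [e4]

end spectrum

/-! ### Dyadic dilations of kernels -/

section dyadic

variable {N : ℕ}

/-- The symbol `ξ ↦ σ(2^{-j} ξ)`. -/
def dilSymbol (j : ℤ) (σ : 𝓢(Space N, ℂ)) : 𝓢(Space N, ℂ) :=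
  SchwartzMap.compCLMOfContinuousLinearEquiv ℂ
    (ContinuousLinearEquiv.smulLeft (Units.mk0 ((2 : ℝ) ^ (-j)) (by positivity))) σ

theorem dilSymbol_apply (j : ℤ) (σ : 𝓢(Space N, ℂ)) (ξ : Space N) :
    dilSymbol j σ ξ = σ ((2 : ℝ) ^ (-j) • ξ) := rfl

/-- The kernel of the Fourier multiplier `σ(2^{-j} D)`. -/
def dyadicKernel (j : ℤ) (σ : 𝓢(Space N, ℂ)) : 𝓢(Space N, ℂ) := 𝓕⁻ (dilSymbol j σ)

theorem fourier_dyadicKernel (j : ℤ) (σ : 𝓢(Space N, ℂ)) :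
    𝓕 (dyadicKernel j σ) = dilSymbol j σ := by
  simp [dyadicKernel]

theorem dyadicKernel_apply (j : ℤ) (σ : 𝓢(Space N, ℂ)) (x : Space N) :
    dyadicKernel j σ x = ((2 : ℝ) ^ j) ^ N • (𝓕⁻ σ : 𝓢(Space N, ℂ)) ((2 : ℝ) ^ j • x) := by
  have hpos : (0 : ℝ) < 2 ^ (-j) := by positivity
  rw [dyadicKernel, SchwartzMap.fourierInv_coe, SchwartzMap.fourierInv_coe, Real.fourierInv_eq,
    Real.fourierInv_eq]
  have h := Measure.integral_comp_smul (volume : Measure (Space N))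
    (fun v => Real.fourierChar (inner ℝ v ((2 : ℝ) ^ j • x)) • σ v) ((2 : ℝ) ^ (-j))
  have e : ((2 : ℝ) ^ j) ^ N = |(((2 : ℝ) ^ (-j)) ^ Module.finrank ℝ (Space N))⁻¹| := by
    rw [finrank_euclideanSpace_fin, abs_of_pos (by positivity), zpow_neg, inv_pow, inv_inv]
  rw [e, ← h]
  refine integral_congr_ae (Filter.Eventually.of_forall fun v => ?_)
  simp only [dilSymbol_apply]
  congr 2
  rw [inner_smul_left, inner_smul_right, ← mul_assoc]
  simp only [zpow_neg, conj_trivial]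
  rw [inv_mul_cancel₀ (by positivity), one_mul]

/-- Effect of a dilation on `L^r` norms. -/
theorem eLpNorm_comp_smul {E : Type*} [NormedAddCommGroup E] {f : Space N → E}
    (hf : Continuous f) (j : ℤ) (r : ℝ≥0∞) :
    eLpNorm (fun x => f ((2 : ℝ) ^ j • x)) r volume
      = (2 : ℝ≥0∞) ^ (-((j : ℝ) * N * (1 / r).toReal)) * eLpNorm f r volume := by
  have hpos : (0 : ℝ) < 2 ^ j := by positivity
  have h1 := Measure.map_addHaar_smul (volume : Measure (Space N)) hpos.ne'
  have h2 := eLpNorm_map_measure (μ := (volume : Measure (Space N))) (p := r) (g := f)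
    (f := fun x => (2 : ℝ) ^ j • x) hf.aestronglyMeasurable (by fun_prop)
  rw [h1] at h2
  have e : ENNReal.ofReal |(((2 : ℝ) ^ j) ^ Module.finrank ℝ (Space N))⁻¹|
      = (2 : ℝ≥0∞) ^ (-((j : ℝ) * N)) := by
    rw [finrank_euclideanSpace_fin, abs_of_pos (by positivity), ← ENNReal.ofReal_ofNat,
      ENNReal.ofReal_rpow_of_pos (by norm_num), Real.rpow_neg (by norm_num),
      Real.rpow_mul (by norm_num), Real.rpow_intCast, Real.rpow_natCast]
  rw [e, eLpNorm_smul_measure_of_ne_zero (by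
    refine (ENNReal.rpow_pos (by norm_num) (by norm_num)).ne')] at h2
  rw [show (fun x => f ((2 : ℝ) ^ j • x)) = f ∘ (fun x => (2 : ℝ) ^ j • x) from rfl, ← h2,
    smul_eq_mul, ← ENNReal.rpow_mul]
  congr 2; ring

theorem ENNReal_ofReal_two_zpow (j : ℤ) : ENNReal.ofReal ((2 : ℝ) ^ j) = (2 : ℝ≥0∞) ^ (j : ℝ) := by
  rw [← ENNReal.ofReal_ofNat, ENNReal.ofReal_rpow_of_pos (by norm_num), Real.rpow_intCast]

theorem two_rpow_add (x y : ℝ) : (2 : ℝ≥0∞) ^ (x + y) = 2 ^ x * 2 ^ y :=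
  ENNReal.rpow_add _ _ (by norm_num) (by norm_num)

theorem two_rpow_ne_top (x : ℝ) : (2 : ℝ≥0∞) ^ x ≠ ∞ :=
  ENNReal.rpow_ne_top_of_ne_zero (by norm_num) (by norm_num)

theorem two_rpow_ne_zero (x : ℝ) : (2 : ℝ≥0∞) ^ x ≠ 0 :=
  (ENNReal.rpow_pos (by norm_num) (by norm_num)).ne'

theorem two_rpow_le {x y : ℝ} (h : x ≤ y) : (2 : ℝ≥0∞) ^ x ≤ 2 ^ y :=
  ENNReal.rpow_le_rpow_of_exponent_le (by norm_num) h

theorem eLpNorm_dyadicKernel (j : ℤ) (σ : 𝓢(Space N, ℂ)) (r : ℝ≥0∞) :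
    eLpNorm (dyadicKernel j σ) r volume
      = (2 : ℝ≥0∞) ^ ((j : ℝ) * N * (1 - (1 / r).toReal)) *
        eLpNorm (𝓕⁻ σ : 𝓢(Space N, ℂ)) r volume := by
  have h : (⇑(dyadicKernel j σ) : Space N → ℂ) = ((2 : ℝ) ^ j) ^ N •
      fun x => (𝓕⁻ σ : 𝓢(Space N, ℂ)) ((2 : ℝ) ^ j • x) := by
    ext x; rw [dyadicKernel_apply]; rfl
  rw [h, eLpNorm_const_smul, eLpNorm_comp_smul (SchwartzMap.continuous _), ← mul_assoc]
  congr 1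
  rw [Real.enorm_eq_ofReal (by positivity), ENNReal.ofReal_pow (by positivity),
    ENNReal_ofReal_two_zpow, ← ENNReal.rpow_natCast, ← ENNReal.rpow_mul, ← two_rpow_add]
  congr 1; ring

/-- The first moment of a dyadic kernel. -/
theorem eLpNorm_norm_mul_dyadicKernel (j : ℤ) (σ : 𝓢(Space N, ℂ)) :
    eLpNorm (fun x => ‖x‖ * ‖dyadicKernel j σ x‖) 1 volume
      = (2 : ℝ≥0∞) ^ (-(j : ℝ)) *
        eLpNorm (fun x => ‖x‖ * ‖(𝓕⁻ σ : 𝓢(Space N, ℂ)) x‖) 1 volume := by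
  have h : (fun x : Space N => ‖x‖ * ‖dyadicKernel j σ x‖) = (((2 : ℝ) ^ j) ^ N * (2 : ℝ) ^ (-j)) •
      fun x : Space N => (fun x : Space N => ‖x‖ * ‖(𝓕⁻ σ : 𝓢(Space N, ℂ)) x‖) ((2 : ℝ) ^ j • x) := by
    ext x
    simp only [dyadicKernel_apply, norm_smul, Pi.smul_apply, smul_eq_mul, norm_pow, norm_zpow,
      Real.norm_ofNat, zpow_neg]
    field_simp
  have hc : Continuous fun x : Space N => ‖x‖ * ‖(𝓕⁻ σ : 𝓢(Space N, ℂ)) x‖ := by fun_prop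
  rw [h, eLpNorm_const_smul, eLpNorm_comp_smul hc j 1, ← mul_assoc]
  congr 1
  rw [Real.enorm_eq_ofReal (by positivity), ENNReal.ofReal_mul (by positivity),
    ENNReal.ofReal_pow (by positivity), ENNReal_ofReal_two_zpow, ENNReal_ofReal_two_zpow,
    ← ENNReal.rpow_natCast, ← ENNReal.rpow_mul, ← two_rpow_add, ← two_rpow_add]
  congr 1; push_cast; simp

/-- The symbol `2 i π ⟨ξ, m⟩ σ(ξ)` of the derivative in direction `m`. -/
def derivSymbol (m : Space N) (σ : 𝓢(Space N, ℂ)) : 𝓢(Space N, ℂ) :=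
  (2 * Real.pi * Complex.I) • SchwartzMap.smulLeftCLM ℂ (inner ℝ · m) σ

theorem derivSymbol_apply (m : Space N) (σ : 𝓢(Space N, ℂ)) (ξ : Space N) :
    derivSymbol m σ ξ = 2 * Real.pi * Complex.I * (inner ℝ ξ m : ℝ) * σ ξ := by
  have : (inner ℝ · m : Space N → ℝ).HasTemperateGrowth := by fun_prop
  simp [derivSymbol, this, mul_assoc]

theorem lineDeriv_dyadicKernel (j : ℤ) (m : Space N) (σ : 𝓢(Space N, ℂ)) :
    (∂_{m} (dyadicKernel j σ) : 𝓢(Space N, ℂ))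
      = (((2 : ℝ) ^ j : ℝ) : ℂ) • dyadicKernel j (derivSymbol m σ) := by
  rw [dyadicKernel, SchwartzMap.lineDerivOp_fourierInv_eq, dyadicKernel,
    ← FourierTransform.fourierInv_smul]
  congr 1
  ext ξ
  have : (inner ℝ · m : Space N → ℝ).HasTemperateGrowth := by fun_prop
  simp only [smul_apply, SchwartzMap.smulLeftCLM_apply_apply this, dilSymbol_apply,
    derivSymbol_apply, inner_smul_left, smul_eq_mul, conj_trivial, Complex.real_smul]
  push_cast
  simp only [zpow_neg]
  field_simp

/-- Convolution of dyadic kernels. -/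
theorem conv_dyadicKernel {i j k : ℤ} {σ ρ τ : 𝓢(Space N, ℂ)}
    (h : ∀ ξ, dilSymbol k τ ξ = dilSymbol i σ ξ * dilSymbol j ρ ξ) (x : Space N) :
    conv (dyadicKernel i σ) (dyadicKernel j ρ) x = dyadicKernel k τ x :=
  conv_eq_of_fourier_eq_mul (by simpa only [fourier_dyadicKernel] using h) x

end dyadic

/-! ### Functionals on `𝒵` commute with convolution -/

section functional

variable {N : ℕ}

/-- Differentiation under the integral sign for `∫ ρ(y) ψ(z - y) dy`. -/
theorem hasFDerivAt_integral_smul_comp_sub {F : Type} [NormedAddCommGroup F] [NormedSpace ℝ F]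
    [NormedSpace ℂ F] [SMulCommClass ℝ ℂ F] (ψ : 𝓢(Space N, F)) {ρ : Space N → ℂ}
    (hρ : Integrable ρ volume) (z : Space N) :
    HasFDerivAt (fun z => ∫ y, ρ y • ψ (z - y)) (∫ y, ρ y • fderiv ℝ ψ (z - y)) z := by
  have hc0 : Continuous (fderiv ℝ ψ) := (SchwartzMap.fderivCLM ℝ (Space N) F ψ).continuous
  have hb : ∀ x, ‖fderiv ℝ ψ x‖ ≤
      SchwartzMap.seminorm ℝ 0 0 (SchwartzMap.fderivCLM ℝ (Space N) F ψ) := fun x =>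
    SchwartzMap.norm_le_seminorm ℝ (SchwartzMap.fderivCLM ℝ (Space N) F ψ) x
  have hmeas : ∀ x : Space N, AEStronglyMeasurable (fun y => ψ (x - y)) volume := fun x =>
    (ψ.continuous.comp (continuous_const.sub continuous_id)).aestronglyMeasurable
  refine hasFDerivAt_integral_of_dominated_of_fderiv_le
    (F' := fun z y => ρ y • fderiv ℝ ψ (z - y)) (s := Metric.ball z 1)
    (bound := fun y => ‖ρ y‖ * SchwartzMap.seminorm ℝ 0 0 (SchwartzMap.fderivCLM ℝ (Space N) F ψ))
    (Metric.ball_mem_nhds z one_pos) ?_ ?_ ?_ ?_ ?_ ?_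
  · exact Filter.Eventually.of_forall fun x => hρ.1.smul (hmeas x)
  · exact hρ.smul_bdd (SchwartzMap.seminorm ℝ 0 0 ψ) (hmeas z)
      (Filter.Eventually.of_forall fun y => SchwartzMap.norm_le_seminorm ℝ ψ _)
  · exact hρ.1.smul (hc0.comp (continuous_const.sub continuous_id)).aestronglyMeasurable
  · refine Filter.Eventually.of_forall fun y x _ => ?_
    rw [norm_smul]
    exact mul_le_mul_of_nonneg_left (hb _) (norm_nonneg _)
  · exact hρ.norm.mul_const _
  · refine Filter.Eventually.of_forall fun y x' _ => ?_
    have h1 : HasFDerivAt (fun x => ψ (x - y)) (fderiv ℝ ψ (x' - y)) x' := by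
      have := (ψ.hasFDerivAt (x' - y)).comp x' ((hasFDerivAt_id x').sub_const y)
      rwa [ContinuousLinearMap.comp_id] at this
    exact h1.const_smul (ρ y)

theorem iteratedFDeriv_integral_smul_comp_sub (n : ℕ) : ∀ {F : Type} [NormedAddCommGroup F]
    [NormedSpace ℝ F] [NormedSpace ℂ F] [SMulCommClass ℝ ℂ F] [CompleteSpace F] (ψ : 𝓢(Space N, F))
    {ρ : Space N → ℂ}, Integrable ρ volume → ∀ z : Space N,
    iteratedFDeriv ℝ n (fun z => ∫ y, ρ y • ψ (z - y)) z
      = ∫ y, ρ y • iteratedFDeriv ℝ n ψ (z - y) := by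
  induction n with
  | zero =>
    intro F _ _ _ _ _ ψ ρ hρ z
    simp only [iteratedFDeriv_zero_eq_comp, Function.comp_apply]
    exact ((continuousMultilinearCurryFin0 ℝ (Space N) F).symm.toContinuousLinearEquiv
      |>.integral_comp_comm _).symm
  | succ n ih =>
    intro F _ _ _ _ _ ψ ρ hρ z
    have h1 : fderiv ℝ (fun z => ∫ y, ρ y • ψ (z - y))
        = fun z => ∫ y, ρ y • (SchwartzMap.fderivCLM ℝ (Space N) F ψ) (z - y) := by
      ext1 z
      exact (hasFDerivAt_integral_smul_comp_sub ψ hρ z).fderiv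
    rw [iteratedFDeriv_succ_eq_comp_right, Function.comp_apply, h1,
      ih (SchwartzMap.fderivCLM ℝ (Space N) F ψ) hρ z]
    let E : (Space N [×n]→L[ℝ] (Space N →L[ℝ] F)) →L[ℝ] (Space N [×(n + 1)]→L[ℝ] F) :=
      (continuousMultilinearCurryRightEquiv' ℝ n (Space N) F).symm.toContinuousLinearEquiv
    have hE := E.integral_comp_comm
      (φ := fun y => ρ y • iteratedFDeriv ℝ n (SchwartzMap.fderivCLM ℝ (Space N) F ψ) (z - y))
      (hρ.smul_bdd (SchwartzMap.seminorm ℝ 0 n (SchwartzMap.fderivCLM ℝ (Space N) F ψ))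
        ((((SchwartzMap.fderivCLM ℝ (Space N) F ψ).smooth n).continuous_iteratedFDeriv le_rfl).comp
          (continuous_const.sub continuous_id)).aestronglyMeasurable
        (Filter.Eventually.of_forall fun y => by
          simpa using SchwartzMap.le_seminorm ℝ 0 n
            (SchwartzMap.fderivCLM ℝ (Space N) F ψ) (z - y)))
    refine hE.symm.trans ?_
    refine integral_congr_ae (Filter.Eventually.of_forall fun y => ?_)
    simp only [iteratedFDeriv_succ_eq_comp_right, Function.comp_apply]
    rfl

/-- Bounded continuous functions with values in the `i.2`-linear maps. The function `‖x‖^a D^b ψ`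
belongs to it if `i = (a, b)`, and its norm there is the Schwartz seminorm of index `i`. A
definition, not an abbreviation, so that it carries a complex Banach space structure of its own. -/
def JetSpace (N : ℕ) (i : ℕ × ℕ) : Type := Space N →ᵇ (Space N [×i.2]→L[ℝ] ℂ)

namespace JetSpace

variable (i : ℕ × ℕ)

instance : NormedAddCommGroup (JetSpace N i) :=
  inferInstanceAs (NormedAddCommGroup (Space N →ᵇ (Space N [×i.2]→L[ℝ] ℂ)))

instance : NormedSpace ℂ (JetSpace N i) :=
  inferInstanceAs (NormedSpace ℂ (Space N →ᵇ (Space N [×i.2]→L[ℝ] ℂ)))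

instance : CompleteSpace (JetSpace N i) :=
  inferInstanceAs (CompleteSpace (Space N →ᵇ (Space N [×i.2]→L[ℝ] ℂ)))

/-- Evaluation at a point. -/
def eval (z : Space N) : JetSpace N i →L[ℂ] (Space N [×i.2]→L[ℝ] ℂ) :=
  BoundedContinuousFunction.evalCLM ℂ z

variable {i}

theorem ext' {u v : JetSpace N i} (h : ∀ z, eval i z u = eval i z v) : u = v :=
  BoundedContinuousFunction.ext h

theorem norm_le' {u : JetSpace N i} {C : ℝ} (hC : 0 ≤ C) (h : ∀ z, ‖eval i z u‖ ≤ C) : ‖u‖ ≤ C :=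
  (BoundedContinuousFunction.norm_le hC).2 h

theorem norm_eval_le (u : JetSpace N i) (z : Space N) : ‖eval i z u‖ ≤ ‖u‖ :=
  BoundedContinuousFunction.norm_coe_le_norm u z

end JetSpace

/-- The map `ψ ↦ ‖x‖^a D^b ψ` from Schwartz functions to bounded continuous functions. -/
def schwartzJet (N : ℕ) (i : ℕ × ℕ) : 𝓢(Space N, ℂ) →ₗ[ℂ] JetSpace N i where
  toFun ψ := BoundedContinuousFunction.ofNormedAddCommGroup
    (fun x => (‖x‖ ^ i.1 : ℝ) • iteratedFDeriv ℝ i.2 ψ x)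
    ((continuous_norm.pow i.1).smul ((ψ.smooth i.2).continuous_iteratedFDeriv le_rfl))
    (SchwartzMap.seminorm ℂ i.1 i.2 ψ) (fun x => by
      rw [norm_smul, norm_pow, norm_norm]; exact SchwartzMap.le_seminorm ℂ i.1 i.2 ψ x)
  map_add' ψ χ := by
    refine JetSpace.ext' fun x => ?_
    change (‖x‖ ^ i.1 : ℝ) • iteratedFDeriv ℝ i.2 (⇑ψ + ⇑χ) x
      = (‖x‖ ^ i.1 : ℝ) • iteratedFDeriv ℝ i.2 ψ x + (‖x‖ ^ i.1 : ℝ) • iteratedFDeriv ℝ i.2 χ x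
    rw [iteratedFDeriv_add_apply (ψ.smooth i.2).contDiffAt (χ.smooth i.2).contDiffAt, smul_add]
  map_smul' c ψ := by
    refine JetSpace.ext' fun x => ?_
    change (‖x‖ ^ i.1 : ℝ) • iteratedFDeriv ℝ i.2 (c • ⇑ψ) x
      = c • ((‖x‖ ^ i.1 : ℝ) • iteratedFDeriv ℝ i.2 ψ x)
    rw [iteratedFDeriv_const_smul_apply (ψ.smooth i.2).contDiffAt, smul_comm]

theorem eval_schwartzJet (i : ℕ × ℕ) (ψ : 𝓢(Space N, ℂ)) (x : Space N) :
    JetSpace.eval i x (schwartzJet N i ψ) = (‖x‖ ^ i.1 : ℝ) • iteratedFDeriv ℝ i.2 ψ x := rfl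

/-- Finitely many of the maps `ψ ↦ ‖x‖^a D^b ψ`. The index `(0, 0)`, which is the map `ψ ↦ ψ`, is
always included, so that `schwartzJets` is injective and a functional on `𝒵` factors through it. -/
def schwartzJets (N : ℕ) (s : Finset (ℕ × ℕ)) :
    𝓢(Space N, ℂ) →ₗ[ℂ] (∀ i : ↥(insert (0, 0) s), JetSpace N i) :=
  LinearMap.pi fun i => schwartzJet N i

theorem schwartzJets_apply (s : Finset (ℕ × ℕ)) (ψ : 𝓢(Space N, ℂ)) (i : ↥(insert (0, 0) s)) :
    schwartzJets N s ψ i = schwartzJet N i ψ := rfl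

theorem schwartzJets_injective (s : Finset (ℕ × ℕ)) : Function.Injective (schwartzJets N s) := by
  intro ψ χ h
  ext x
  have h1 := congrFun h ⟨(0, 0), Finset.mem_insert_self _ _⟩
  have h2 : (‖x‖ ^ 0 : ℝ) • iteratedFDeriv ℝ 0 ψ x = (‖x‖ ^ 0 : ℝ) • iteratedFDeriv ℝ 0 χ x :=
    congrArg (fun u => JetSpace.eval (0, 0) x u) h1
  have h3 := congrArg (fun u : Space N [×0]→L[ℝ] ℂ => u 0) h2
  simpa using h3

/-- By the Hahn-Banach theorem, a functional on `𝒵` factors through finitely many of the maps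
`ψ ↦ ‖x‖^a D^b ψ`. -/
theorem ZDual.exists_eq_comp_schwartzJets (f : ZDual N) :
    ∃ s : Finset (ℕ × ℕ), ∃ F : (∀ i : ↥(insert (0, 0) s), JetSpace N i) →L[ℂ] ℂ,
      ∀ ψ : ZSpace N, f ψ = F (schwartzJets N s ψ) := by
  have hws := (ZSpace N).subtype.withSeminorms_induced (schwartz_withSeminorms ℂ (Space N) ℂ)
  have hq : Continuous ((normSeminorm ℂ ℂ).comp f.toLinearMap) := by
    change Continuous fun ψ => ‖f ψ‖
    fun_prop
  obtain ⟨s, C, -, hC⟩ := Seminorm.bound_of_continuous hws _ hq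
  have hbd : ∀ ψ : ZSpace N, ‖f ψ‖ ≤ C * ‖schwartzJets N s ψ‖ := by
    intro ψ
    have h1 : ‖f ψ‖ ≤ C * (s.sup ((schwartzSeminormFamily ℂ (Space N) ℂ).comp
        (ZSpace N).subtype)) ψ := hC ψ
    refine h1.trans (mul_le_mul_of_nonneg_left ?_ C.2)
    refine Seminorm.finset_sup_apply_le (norm_nonneg _) fun i hi => ?_
    change SchwartzMap.seminorm ℂ i.1 i.2 (ψ : 𝓢(Space N, ℂ)) ≤ _
    refine SchwartzMap.seminorm_le_bound ℂ _ _ _ (norm_nonneg _) fun x => ?_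
    have h2 := (norm_le_pi_norm (schwartzJets N s ψ) ⟨i, Finset.mem_insert_of_mem hi⟩)
    refine le_trans ?_ ((JetSpace.norm_eval_le (schwartzJet N i ψ) x).trans h2)
    rw [eval_schwartzJet, norm_smul, norm_pow, norm_norm]
  refine ⟨s, ?_⟩
  set ι := (schwartzJets N s).comp (ZSpace N).subtype with hι
  have hinj : Function.Injective ι :=
    (schwartzJets_injective s).comp Subtype.val_injective
  set e := LinearEquiv.ofInjective ι hinj with he
  set g : (LinearMap.range ι) →L[ℂ] ℂ := (f.toLinearMap.comp e.symm.toLinearMap).mkContinuous C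
    (fun w => by
      obtain ⟨ψ, rfl⟩ := e.surjective w
      simp only [LinearMap.comp_apply, LinearEquiv.coe_coe, e.symm_apply_apply]
      exact hbd ψ) with hg
  obtain ⟨F, hF, -⟩ := exists_extension_norm_eq (𝕜 := ℂ) (LinearMap.range ι) g
  refine ⟨F, fun ψ => ?_⟩
  have h1 := hF (e ψ)
  have h2 : g (e ψ) = f ψ := by
    simp [hg]
  rw [← h2, ← h1]
  rfl

theorem one_add_norm_add_le (x y : Space N) : 1 + ‖x + y‖ ≤ (1 + ‖x‖) * (1 + ‖y‖) := by
  nlinarith [norm_add_le x y, norm_nonneg x, norm_nonneg y, mul_nonneg (norm_nonneg x) (norm_nonneg y)]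

theorem SchwartzMap.exists_norm_pow_mul_iteratedFDeriv_le (ψ : 𝓢(Space N, ℂ)) (a b : ℕ) :
    ∃ C, 0 ≤ C ∧ ∀ z y, ‖z‖ ^ a * ‖iteratedFDeriv ℝ b ψ (z - y)‖ ≤ C * (1 + ‖y‖) ^ a := by
  refine ⟨2 ^ a * (Finset.Iic (a, b)).sup (fun m => SchwartzMap.seminorm ℝ m.1 m.2) ψ,
    by positivity, fun z y => ?_⟩
  have h := SchwartzMap.one_add_le_sup_seminorm_apply (𝕜 := ℝ) (m := (a, b)) (k := a) (n := b)
    le_rfl le_rfl ψ (z - y)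
  have h1 : ‖z‖ ≤ (1 + ‖z - y‖) * (1 + ‖y‖) := by
    have := one_add_norm_add_le (z - y) y
    rw [sub_add_cancel] at this
    linarith
  calc ‖z‖ ^ a * ‖iteratedFDeriv ℝ b ψ (z - y)‖
      ≤ ((1 + ‖z - y‖) * (1 + ‖y‖)) ^ a * ‖iteratedFDeriv ℝ b ψ (z - y)‖ := by gcongr
    _ = ((1 + ‖z - y‖) ^ a * ‖iteratedFDeriv ℝ b ψ (z - y)‖) * (1 + ‖y‖) ^ a := by
        rw [mul_pow]; ring
    _ ≤ _ := by gcongr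

/-- Translation is continuous in the topology of `𝓢`. -/
theorem continuous_schwartzJet_comp_sub (ψ : 𝓢(Space N, ℂ)) {G : Space N → 𝓢(Space N, ℂ)}
    (hG : ∀ y z, G y z = ψ (z - y)) (i : ℕ × ℕ) :
    Continuous fun y => schwartzJet N i (G y) := by
  have hD : ∀ y z, iteratedFDeriv ℝ i.2 (G y) z = iteratedFDeriv ℝ i.2 ψ (z - y) := by
    intro y z
    have : (⇑(G y) : Space N → ℂ) = fun z => ψ (z - y) := funext (hG y)
    rw [this, iteratedFDeriv_comp_sub]
  obtain ⟨C, hC, hCb⟩ := ψ.exists_norm_pow_mul_iteratedFDeriv_le i.1 (i.2 + 1)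
  rw [continuous_iff_continuousAt]
  intro y₀
  have key : ∀ y, ‖y - y₀‖ ≤ 1 → ‖schwartzJet N i (G y) - schwartzJet N i (G y₀)‖
      ≤ C * (2 + ‖y₀‖) ^ i.1 * ‖y - y₀‖ := by
    intro y hy
    refine JetSpace.norm_le' (by positivity) fun z => ?_
    have he : JetSpace.eval i z (schwartzJet N i (G y) - schwartzJet N i (G y₀))
        = (‖z‖ ^ i.1 : ℝ) • (iteratedFDeriv ℝ i.2 ψ (z - y) - iteratedFDeriv ℝ i.2 ψ (z - y₀)) := by
      rw [map_sub, eval_schwartzJet, eval_schwartzJet, hD, hD]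
      exact (smul_sub _ _ _).symm
    rw [he, norm_smul, norm_pow, norm_norm]
    rcases eq_or_ne (‖z‖ ^ i.1) 0 with h0 | h0
    · rw [h0, zero_mul]; positivity
    have hpos : 0 < ‖z‖ ^ i.1 := lt_of_le_of_ne (by positivity) (Ne.symm h0)
    have hd : ∀ u ∈ segment ℝ y₀ y, ‖fderiv ℝ (iteratedFDeriv ℝ i.2 ψ) (z - u)‖
        ≤ C * (2 + ‖y₀‖) ^ i.1 / ‖z‖ ^ i.1 := by
      intro u hu
      rw [norm_fderiv_iteratedFDeriv, le_div_iff₀ hpos, mul_comm]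
      refine (hCb z u).trans (mul_le_mul_of_nonneg_left
        (pow_le_pow_left₀ (by positivity) ?_ _) hC)
      have h1 : ‖u - y₀‖ ≤ ‖y - y₀‖ := norm_sub_le_of_mem_segment hu
      have := norm_add_le (u - y₀) y₀
      rw [sub_add_cancel] at this
      linarith
    have hdiff : Differentiable ℝ (iteratedFDeriv ℝ i.2 ψ) :=
      (ψ.smooth (i.2 + 1)).differentiable_iteratedFDeriv (by exact_mod_cast Nat.lt_succ_self i.2)
    have hmv := Convex.norm_image_sub_le_of_norm_hasFDerivWithin_le (𝕜 := ℝ)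
      (f := fun u => iteratedFDeriv ℝ i.2 ψ (z - u))
      (f' := fun u => (fderiv ℝ (iteratedFDeriv ℝ i.2 ψ) (z - u)).comp
        (-ContinuousLinearMap.id ℝ (Space N)))
      (s := segment ℝ y₀ y) (C := C * (2 + ‖y₀‖) ^ i.1 / ‖z‖ ^ i.1)
      (fun u _ => ((hdiff (z - u)).hasFDerivAt.comp u
        ((hasFDerivAt_id u).const_sub z)).hasFDerivWithinAt)
      (fun u hu => by
        refine le_trans (ContinuousLinearMap.opNorm_comp_le _ _) ?_
        rw [norm_neg]
        refine (mul_le_of_le_one_right (norm_nonneg _) ContinuousLinearMap.norm_id_le).trans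
          (hd u hu))
      (convex_segment _ _) (left_mem_segment ℝ y₀ y) (right_mem_segment ℝ y₀ y)
    calc ‖z‖ ^ i.1 * _ ≤ ‖z‖ ^ i.1 * (C * (2 + ‖y₀‖) ^ i.1 / ‖z‖ ^ i.1 * ‖y - y₀‖) := by gcongr
      _ = _ := by field_simp
  refine tendsto_iff_norm_sub_tendsto_zero.2 ?_
  have hlim : Filter.Tendsto (fun y => C * (2 + ‖y₀‖) ^ i.1 * ‖y - y₀‖) (nhds y₀) (nhds 0) := by
    have : Continuous fun y => C * (2 + ‖y₀‖) ^ i.1 * ‖y - y₀‖ := by fun_prop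
    simpa using this.tendsto y₀
  refine squeeze_zero' (Filter.Eventually.of_forall fun _ => norm_nonneg _) ?_ hlim
  filter_upwards [Metric.closedBall_mem_nhds y₀ one_pos] with y hy
  exact key y (by rwa [← dist_eq_norm])

/-- A functional on `𝒵` may be exchanged with an integral of translates: if `K = ∫ θ(x - y) ψ(· -
y) dy` then `⟨f, K⟩ = ∫ θ(x - y) ⟨f, ψ(· - y)⟩ dy`. The integral of translates converges as a
Bochner integral in a finite product of Banach spaces to which `f` extends, whereas `𝒵` itself is
not normed. -/
theorem ZDual.continuous_and_apply_eq_integral (f : ZDual N) (ψ : 𝓢(Space N, ℂ))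
    {G : Space N → ZSpace N} (hG : ∀ y z, (G y : 𝓢(Space N, ℂ)) z = ψ (z - y)) :
    Continuous (fun y => f (G y)) ∧ ∀ (θ : 𝓢(Space N, ℂ)) (x : Space N) (K : ZSpace N),
      (∀ z, (K : 𝓢(Space N, ℂ)) z = ∫ y, θ (x - y) * ψ (z - y)) →
      f K = ∫ y, θ (x - y) * f (G y) := by
  obtain ⟨s, F, hF⟩ := f.exists_eq_comp_schwartzJets
  set Γ := fun y => schwartzJets N s (G y) with hΓ
  have hΓc : Continuous Γ := continuous_pi fun i =>
    continuous_schwartzJet_comp_sub ψ (G := fun y => (G y : 𝓢(Space N, ℂ))) hG i.1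
  refine ⟨(F.continuous.comp hΓc).congr fun y => (hF (G y)).symm, fun θ x K hK => ?_⟩
  have hD : ∀ b y z, iteratedFDeriv ℝ b (G y : 𝓢(Space N, ℂ)) z
      = iteratedFDeriv ℝ b ψ (z - y) := by
    intro b y z
    have : (⇑(G y : 𝓢(Space N, ℂ)) : Space N → ℂ) = fun z => ψ (z - y) := funext (hG y)
    rw [this, iteratedFDeriv_comp_sub]
  -- the integrand of the vector-valued integral is integrable
  have hint : Integrable (fun y => θ (x - y) • Γ y) volume := by
    have hi : ∀ i, Integrable (fun y => θ (x - y) • Γ y i) volume := by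
      intro i
      obtain ⟨C, hC, hCb⟩ := ψ.exists_norm_pow_mul_iteratedFDeriv_le i.1.1 i.1.2
      have hΓn : ∀ y, ‖Γ y i‖ ≤ C * (1 + ‖y‖) ^ i.1.1 := by
        intro y
        refine JetSpace.norm_le' (by positivity) fun z => ?_
        change ‖(‖z‖ ^ i.1.1 : ℝ) • iteratedFDeriv ℝ i.1.2 (G y : 𝓢(Space N, ℂ)) z‖ ≤ _
        rw [norm_smul, norm_pow, norm_norm, hD]
        exact hCb z y
      obtain ⟨D, hD0, hDb⟩ := θ.exists_norm_le_one_add_rpow (i.1.1 + (N + 1))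
      have h1 : Integrable (fun y : Space N => (1 + ‖y‖) ^ (-((N + 1 : ℕ) : ℝ))) volume := by
        apply integrable_one_add_norm
        simp
      have h2 := ((integrable_comp_sub_left (μ := volume)
        (fun y => (1 + ‖y‖) ^ (-((N + 1 : ℕ) : ℝ))) x).2 h1).const_mul
          (D * (C * (1 + ‖x‖) ^ i.1.1))
      refine h2.mono' ?_ (Filter.Eventually.of_forall fun y => ?_)
      · exact (Continuous.smul (θ.continuous.comp (continuous_const.sub continuous_id))
          ((continuous_apply i).comp hΓc)).aestronglyMeasurable
      · rw [norm_smul]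
        have h3 : 1 + ‖y‖ ≤ (1 + ‖x‖) * (1 + ‖x - y‖) := by
          have := one_add_norm_add_le x (-(x - y))
          rw [norm_neg] at this
          rwa [show x + -(x - y) = y by abel] at this
        have h4 : (1 + ‖x - y‖) ^ (-((i.1.1 + (N + 1) : ℕ) : ℝ)) * (1 + ‖x - y‖) ^ i.1.1
            = (1 + ‖x - y‖) ^ (-((N + 1 : ℕ) : ℝ)) := by
          rw [← Real.rpow_natCast, ← Real.rpow_add (by positivity)]
          congr 1; push_cast; ring
        calc ‖θ (x - y)‖ * ‖Γ y i‖
            ≤ (D * (1 + ‖x - y‖) ^ (-((i.1.1 + (N + 1) : ℕ) : ℝ))) *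
                (C * ((1 + ‖x‖) * (1 + ‖x - y‖)) ^ i.1.1) := by
              refine mul_le_mul (hDb _) ((hΓn y).trans ?_) (norm_nonneg _) (by positivity)
              gcongr
          _ = D * (C * (1 + ‖x‖) ^ i.1.1) *
                ((1 + ‖x - y‖) ^ (-((i.1.1 + (N + 1) : ℕ) : ℝ)) * (1 + ‖x - y‖) ^ i.1.1) := by
              rw [mul_pow]; ring
          _ = _ := by rw [h4]
    exact Integrable.of_eval hi
  have hρ : Integrable (fun y => θ (x - y)) volume := θ.integrable_sub_left x
  have hKi : schwartzJets N s K = ∫ y, θ (x - y) • Γ y := by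
    ext1 i
    refine JetSpace.ext' fun z => ?_
    have e1 := (((JetSpace.eval i.1 z).comp (ContinuousLinearMap.proj (R := ℂ)
      (φ := fun i : ↥(insert (0, 0) s) => JetSpace N i) i)).integral_comp_comm hint).symm
    refine Eq.trans ?_ e1.symm
    have hKf : (⇑(K : 𝓢(Space N, ℂ)) : Space N → ℂ) = fun z => ∫ y, θ (x - y) • ψ (z - y) :=
      funext hK
    rw [schwartzJets_apply, eval_schwartzJet, hKf, iteratedFDeriv_integral_smul_comp_sub _ ψ hρ z,
      ← integral_smul]
    refine integral_congr_ae (Filter.Eventually.of_forall fun y => ?_)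
    change (‖z‖ ^ i.1.1 : ℝ) • θ (x - y) • _ = JetSpace.eval i.1 z (θ (x - y) • Γ y i)
    rw [map_smul]
    change _ = θ (x - y) • (‖z‖ ^ i.1.1 : ℝ) • iteratedFDeriv ℝ i.1.2 (G y : 𝓢(Space N, ℂ)) z
    rw [hD, smul_comm]
  rw [hF, hKi, ← F.integral_comp_comm hint]
  refine integral_congr_ae (Filter.Eventually.of_forall fun y => ?_)
  simp only [map_smul, smul_eq_mul, hF, hΓ]

end functional

/-! ### Dyadic blocks -/

section blocks

variable {N : ℕ}

/-- The function `z ↦ P(x - z)`. -/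
def reflectAt (P : 𝓢(Space N, ℂ)) (x : Space N) : 𝓢(Space N, ℂ) :=
  SchwartzMap.compSubConstCLM ℂ x
    (SchwartzMap.compCLMOfContinuousLinearEquiv ℂ (ContinuousLinearEquiv.neg ℝ) P)

theorem reflectAt_apply (P : 𝓢(Space N, ℂ)) (x z : Space N) : reflectAt P x z = P (x - z) := by
  simp [reflectAt, SchwartzMap.compSubConstCLM_apply]

theorem fourier_reflectAt_ne_zero {P : 𝓢(Space N, ℂ)} {x ξ : Space N}
    (h : 𝓕 (reflectAt P x) ξ ≠ 0) : 𝓕 P (-ξ) ≠ 0 := by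
  have h1 := fourier_compSubConst_ne_zero h
  intro h0
  refine h1 ?_
  rw [← h0, SchwartzMap.fourier_coe, SchwartzMap.fourier_coe]
  have := congrFun (Real.fourierInv_eq_fourier_comp_neg (⇑P : Space N → ℂ)) ξ
  rw [Real.fourierInv_eq_fourier_neg] at this
  rw [this]
  rfl

/-- The function `P(x - ·)` belongs to `𝒵` if `P` has no frequencies near zero. -/
theorem reflectAt_mem {P : 𝓢(Space N, ℂ)} {ε : ℝ} (hε : 0 < ε) (hP : ∀ ξ, ‖ξ‖ < ε → 𝓕 P ξ = 0)
    (x : Space N) : reflectAt P x ∈ ZSpace N := by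
  intro n
  have h : (⇑(𝓕 (reflectAt P x) : 𝓢(Space N, ℂ)) : Space N → ℂ) =ᶠ[nhds 0] fun _ => 0 := by
    filter_upwards [Metric.ball_mem_nhds (0 : Space N) hε] with ξ hξ
    by_contra hne
    refine fourier_reflectAt_ne_zero hne (hP _ ?_)
    rw [norm_neg]
    simpa using hξ
  rw [h.iteratedFDeriv ℝ n |>.eq_of_nhds, iteratedFDeriv_fun_zero]; rfl

namespace LittlewoodPaley

variable (L : LittlewoodPaley N)

/-- The kernel `h_j` of the dyadic block `Δ_j`. -/
def ker (j : ℤ) : 𝓢(Space N, ℂ) := dyadicKernel j L.φ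

theorem kernel_eq (j : ℤ) (x y : Space N) : L.kernel j x y = L.ker j (x - y) :=
  L.kernel_apply j x y

theorem fourier_ker (j : ℤ) (ξ : Space N) : 𝓕 (L.ker j) ξ = L.φ ((2 : ℝ) ^ (-j) • ξ) := by
  rw [ker, fourier_dyadicKernel, dilSymbol_apply]

theorem norm_bounds_of_ne_zero {ξ : Space N} (h : L.φ ξ ≠ 0) : 3 / 4 ≤ ‖ξ‖ ∧ ‖ξ‖ ≤ 8 / 3 :=
  L.support (subset_tsupport _ h)

/-- The symbol `φ(ξ/2) + φ(ξ) + φ(2ξ)`, equal to `1` on the support of `φ`. Its kernels reproduce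
the dyadic blocks. -/
def wide : 𝓢(Space N, ℂ) := dilSymbol (-1) L.φ + L.φ + dilSymbol 1 L.φ

theorem wide_apply (ξ : Space N) :
    L.wide ξ = L.φ ((2 : ℝ) • ξ) + L.φ ξ + L.φ ((2 : ℝ)⁻¹ • ξ) := by
  simp [wide, dilSymbol_apply]

theorem wide_eq_one {ξ : Space N} (h1 : 3 / 4 ≤ ‖ξ‖) (h2 : ‖ξ‖ ≤ 8 / 3) : L.wide ξ = 1 := by
  have hξ : ξ ≠ 0 := by rintro rfl; simp at h1; linarith
  have h := L.partition ξ hξ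
  have hz : ∀ j ∉ ({-1, 0, 1} : Finset ℤ), L.φ ((2 : ℝ) ^ (-j) • ξ) = 0 := by
    intro j hj
    by_contra hne
    obtain ⟨h3, h4⟩ := L.norm_bounds_of_ne_zero hne
    rw [norm_smul, norm_zpow, Real.norm_ofNat] at h3 h4
    simp only [Finset.mem_insert, Finset.mem_singleton, not_or] at hj
    rcases le_or_gt j (-2) with hj2 | hj2
    · have : (4 : ℝ) ≤ 2 ^ (-j) := (show (4 : ℝ) = 2 ^ (2 : ℤ) by norm_num).trans_le
        (zpow_le_zpow_right₀ (by norm_num) (by omega))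
      nlinarith
    · have : (2 : ℝ) ^ (-j) ≤ 1 / 4 := (zpow_le_zpow_right₀ (n := -2) (by norm_num)
        (by omega)).trans_eq (by norm_num)
      nlinarith
  have h5 := (hasSum_sum_of_ne_finset_zero hz).unique h
  rw [wide_apply, ← h5]
  simp
  ring

theorem wide_bounds {ξ : Space N} (h : L.wide ξ ≠ 0) : 3 / 8 ≤ ‖ξ‖ ∧ ‖ξ‖ ≤ 16 / 3 := by
  rw [wide_apply] at h
  by_contra hne
  refine h ?_
  have h1 : ∀ c : ℝ, 0 < c → c = 2 ∨ c = 1 ∨ c = 2⁻¹ → L.φ (c • ξ) = 0 := by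
    intro c hc hc'
    by_contra h2
    obtain ⟨h3, h4⟩ := L.norm_bounds_of_ne_zero h2
    rw [norm_smul, Real.norm_of_nonneg hc.le] at h3 h4
    refine hne ?_
    rcases hc' with rfl | rfl | rfl <;> constructor <;> linarith
  have := h1 1 one_pos (by simp)
  rw [one_smul] at this
  rw [h1 2 (by norm_num) (by simp), h1 2⁻¹ (by norm_num) (by simp), this]
  simp

/-- The kernel `h_{j-1} + h_j + h_{j+1}`. -/
def wker (j : ℤ) : 𝓢(Space N, ℂ) := dyadicKernel j L.wide

theorem fourier_wker (j : ℤ) (ξ : Space N) : 𝓕 (L.wker j) ξ = L.wide ((2 : ℝ) ^ (-j) • ξ) := by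
  rw [wker, fourier_dyadicKernel, dilSymbol_apply]

theorem wker_eq (j : ℤ) : L.wker j = L.ker (j - 1) + L.ker j + L.ker (j + 1) := by
  have h : dilSymbol j L.wide = dilSymbol (j - 1) L.φ + dilSymbol j L.φ + dilSymbol (j + 1) L.φ := by
    ext ξ
    have e1 : (2 : ℝ) • (2 : ℝ) ^ (-j) • ξ = (2 : ℝ) ^ (-(j - 1)) • ξ := by
      rw [smul_smul, ← zpow_one_add₀ (by norm_num)]; congr 2; ring
    have e2 : (2 : ℝ)⁻¹ • (2 : ℝ) ^ (-j) • ξ = (2 : ℝ) ^ (-(j + 1)) • ξ := by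
      rw [smul_smul, neg_add, zpow_add₀ (by norm_num), zpow_neg_one, mul_comm]
    simp only [dilSymbol_apply, wide_apply, e1, e2, add_apply]
  simp only [wker, ker, dyadicKernel, h, FourierInvAdd.fourierInv_add]

/-- A symbol supported like `φ` is not changed by multiplication with the wider cutoff. -/
theorem mul_wide_eq {σ : 𝓢(Space N, ℂ)} (hσ : ∀ ξ, σ ξ ≠ 0 → 3 / 4 ≤ ‖ξ‖ ∧ ‖ξ‖ ≤ 8 / 3)
    (ξ : Space N) : σ ξ * L.wide ξ = σ ξ := by
  by_cases h : σ ξ = 0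
  · simp [h]
  · rw [L.wide_eq_one (hσ ξ h).1 (hσ ξ h).2, mul_one]

/-- The convolution of `θ` with `Δ_j f` at `x` is the value of `f` at `P(x - ·)`, where `P` has the
product of the symbols of `θ` and of `Δ_j`. -/
theorem conv_block (f : ZDual N) (j : ℤ) {θ P : 𝓢(Space N, ℂ)}
    (hP : ∀ ξ, 𝓕 P ξ = 𝓕 θ ξ * 𝓕 (L.ker j) ξ) :
    ∃ hmem : ∀ x, reflectAt P x ∈ ZSpace N, ∀ x, conv θ (L.block j f) x = f ⟨_, hmem x⟩ := by
  have hε : (0 : ℝ) < 2 ^ j * (3 / 4) := by positivity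
  have h0 : ∀ ξ, ‖ξ‖ < 2 ^ j * (3 / 4) → 𝓕 P ξ = 0 := by
    intro ξ hξ
    rw [hP, fourier_ker]
    by_contra hne
    have h1 := (L.norm_bounds_of_ne_zero (right_ne_zero_of_mul hne)).1
    rw [norm_smul, norm_zpow, Real.norm_ofNat, zpow_neg, inv_mul_eq_div,
      le_div_iff₀ (by positivity)] at h1
    linarith
  refine ⟨reflectAt_mem hε h0, fun x => ?_⟩
  have h1 := (f.continuous_and_apply_eq_integral (𝓕 (L.symbol j))
    (G := fun y => ⟨L.kernel j y, L.kernel_mem j y⟩) (fun y z => by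
      simp [kernel, SchwartzMap.compSubConstCLM_apply])).2 θ x
    ⟨_, reflectAt_mem hε h0 x⟩ (fun z => ?_)
  · exact h1.symm
  · rw [reflectAt_apply, ← conv_eq_of_fourier_eq_mul hP, conv,
      ← integral_sub_right_eq_self (μ := volume) _ z]
    refine integral_congr_ae (Filter.Eventually.of_forall fun y => ?_)
    have e : L.ker j (y - z) = 𝓕 (L.symbol j) (z - y) := by
      rw [← kernel_eq, kernel, SchwartzMap.compSubConstCLM_apply]
    simp only [sub_sub_sub_cancel_right, e]

theorem continuous_block (f : ZDual N) (j : ℤ) : Continuous (L.block j f) :=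
  (f.continuous_and_apply_eq_integral (𝓕 (L.symbol j))
    (G := fun y => ⟨L.kernel j y, L.kernel_mem j y⟩) (fun y z => by
      simp [kernel, SchwartzMap.compSubConstCLM_apply])).1

theorem conv_block_comm (f : ZDual N) (j k : ℤ) (x : Space N) :
    conv (L.ker k) (L.block j f) x = conv (L.ker j) (L.block k f) x := by
  obtain ⟨P, hP⟩ : ∃ P : 𝓢(Space N, ℂ), ∀ ξ, 𝓕 P ξ = 𝓕 (L.ker k) ξ * 𝓕 (L.ker j) ξ := by
    refine ⟨SchwartzMap.convolution (ContinuousLinearMap.mul ℂ ℂ) (L.ker k) (L.ker j), fun ξ => ?_⟩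
    rw [SchwartzMap.fourier_convolution, SchwartzMap.pairing_apply_apply]
    simp
  obtain ⟨h1, h2⟩ := L.conv_block f j hP
  obtain ⟨h3, h4⟩ := L.conv_block f k (θ := L.ker j) (P := P) (fun ξ => by rw [hP, mul_comm])
  rw [h2, h4]

/-- The blocks are reproduced by the wider kernels. -/
theorem conv_wker_block (f : ZDual N) (j : ℤ) (x : Space N) :
    conv (L.wker j) (L.block j f) x = L.block j f x := by
  obtain ⟨h1, h2⟩ := L.conv_block f j (θ := L.wker j) (P := L.ker j) (fun ξ => by
    rw [fourier_wker, fourier_ker, mul_comm, L.mul_wide_eq fun ξ => L.norm_bounds_of_ne_zero])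
  rw [h2, block]
  congr 2
  ext z
  rw [reflectAt_apply, kernel_eq]

end LittlewoodPaley

end blocks

/-! ### Bernstein inequalities -/

section bernstein

variable {N : ℕ}

theorem SchwartzMap.eLpNorm_ne_top (H : 𝓢(Space N, ℂ)) (p : ℝ≥0∞) : eLpNorm H p volume ≠ ∞ :=
  (H.memLp p volume).2.ne

theorem enorm_conv_dyadicKernel_le (j : ℤ) (σ : 𝓢(Space N, ℂ)) {p p' : ℝ≥0∞}
    [hq : p'.HolderConjugate p] {c : Space N → ℂ} (hc : AEStronglyMeasurable c volume)
    (x : Space N) : ‖conv (dyadicKernel j σ) c x‖ₑ ≤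
      2 ^ ((j : ℝ) * N * (1 / p).toReal) *
        (eLpNorm (𝓕⁻ σ : 𝓢(Space N, ℂ)) p' volume * eLpNorm c p volume) := by
  refine (enorm_conv_le _ _ _).trans ((lintegral_enorm_mul_enorm_le (p' := p') (p := p)
    (SchwartzMap.continuous _) hc x).trans_eq ?_)
  have h1 : (1 / p').toReal + (1 / p).toReal = 1 := by
    have := ENNReal.HolderConjugate.inv_add_inv_eq_one p' p
    rw [one_div, one_div, ← ENNReal.toReal_add, this, ENNReal.toReal_one]
    · exact ENNReal.inv_ne_top.2 (ENNReal.HolderConjugate.ne_zero p' p)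
    · exact ENNReal.inv_ne_top.2 (ENNReal.HolderConjugate.ne_zero p p')
  rw [eLpNorm_dyadicKernel, mul_assoc, show 1 - (1 / p').toReal = (1 / p).toReal by linarith]

theorem eLpNorm_conv_dyadicKernel_le (j : ℤ) (σ : 𝓢(Space N, ℂ)) {p : ℝ≥0∞} (hp : 1 ≤ p)
    {c : Space N → ℂ} (hc : Continuous c) : eLpNorm (conv (dyadicKernel j σ) c) p volume ≤
      eLpNorm (𝓕⁻ σ : 𝓢(Space N, ℂ)) 1 volume * eLpNorm c p volume := by
  refine (eLpNorm_le_of_enorm_le_lintegral (SchwartzMap.continuous _) hc hp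
    (enorm_conv_le _ _)).trans_eq ?_
  rw [eLpNorm_dyadicKernel]
  simp

theorem exists_forall_norm_le_of_enorm_le {α E : Type*} [NormedAddCommGroup E] {a : α → E}
    {B : ℝ≥0∞} (hB : B ≠ ∞) (h : ∀ x, ‖a x‖ₑ ≤ B) (x : α) : ‖a x‖ ≤ B.toReal := by
  rw [← toReal_enorm]
  exact ENNReal.toReal_mono hB (h x)

namespace LittlewoodPaley

variable (L : LittlewoodPaley N)

/-- A constant in the Bernstein inequalities: the sum of `1` and of the `L^{p'}` norms of the
kernel with symbol `wide` and of its partial derivatives. -/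
def bernsteinConst (p' : ℝ≥0∞) : ℝ≥0∞ :=
  1 + eLpNorm (𝓕⁻ L.wide : 𝓢(Space N, ℂ)) p' volume +
    ∑ l : Fin N, eLpNorm (𝓕⁻ (derivSymbol (EuclideanSpace.single l 1) L.wide) : 𝓢(Space N, ℂ))
      p' volume

theorem bernsteinConst_ne_top (p' : ℝ≥0∞) : L.bernsteinConst p' ≠ ∞ := by
  refine ENNReal.add_ne_top.2 ⟨ENNReal.add_ne_top.2 ⟨ENNReal.one_ne_top,
    SchwartzMap.eLpNorm_ne_top _ _⟩, ENNReal.sum_ne_top.2 fun l _ => SchwartzMap.eLpNorm_ne_top _ _⟩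

theorem one_le_bernsteinConst (p' : ℝ≥0∞) : 1 ≤ L.bernsteinConst p' := by
  rw [bernsteinConst, add_assoc]; exact le_self_add

theorem wide_le_bernsteinConst (p' : ℝ≥0∞) :
    eLpNorm (𝓕⁻ L.wide : 𝓢(Space N, ℂ)) p' volume ≤ L.bernsteinConst p' :=
  le_add_self.trans le_self_add

theorem deriv_le_bernsteinConst (p' : ℝ≥0∞) (l : Fin N) :
    eLpNorm (𝓕⁻ (derivSymbol (EuclideanSpace.single l 1) L.wide) : 𝓢(Space N, ℂ)) p' volume ≤
      L.bernsteinConst p' :=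
  (Finset.single_le_sum (f := fun l : Fin N => eLpNorm (𝓕⁻ (derivSymbol (EuclideanSpace.single l 1)
    L.wide) : 𝓢(Space N, ℂ)) p' volume) (fun _ _ => zero_le) (Finset.mem_univ l)).trans le_add_self

variable {p p' : ℝ≥0∞}

/-- Bernstein's inequality from `L^p` to `L^∞`. -/
theorem enorm_block_le [p'.HolderConjugate p] (f : ZDual N) (j : ℤ) (x : Space N) :
    ‖L.block j f x‖ₑ ≤ 2 ^ ((j : ℝ) * N * (1 / p).toReal) *
      (L.bernsteinConst p' * eLpNorm (L.block j f) p volume) := by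
  rw [← L.conv_wker_block f j x]
  refine (enorm_conv_dyadicKernel_le (p := p) (p' := p') j L.wide
    (L.continuous_block f j).aestronglyMeasurable x).trans ?_
  gcongr
  exact L.wide_le_bernsteinConst p'

/-- Bernstein's inequality from `L^p` to `L^q`, by interpolation between `L^p` and `L^∞`. -/
theorem eLpNorm_block_le [p'.HolderConjugate p] (hp : 1 ≤ p) (hp' : p ≠ ∞) {q : ℝ≥0∞} (hpq : p ≤ q)
    (f : ZDual N) (j : ℤ) (hf : eLpNorm (L.block j f) p volume ≠ ∞) :
    eLpNorm (L.block j f) q volume ≤ 2 ^ ((j : ℝ) * N * ((1 / p).toReal - (1 / q).toReal)) *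
      (L.bernsteinConst p' * eLpNorm (L.block j f) p volume) := by
  have hp0 : p.toReal ≠ 0 := (ENNReal.toReal_pos (zero_lt_one.trans_le hp).ne' hp').ne'
  have h1 := eLpNorm_le_rpow_mul_of_enorm_le (K := 2 ^ ((j : ℝ) * N * (1 / p).toReal) *
    L.bernsteinConst p') hp hp' hpq (ENNReal.mul_ne_top (two_rpow_ne_top _)
    (L.bernsteinConst_ne_top p')) (fun x => by
      rw [mul_assoc]; exact L.enorm_block_le f j x) hf
  refine h1.trans ?_
  have h2 : (1 / p).toReal = 1 / p.toReal := by simp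
  have h3 : (1 / q).toReal ≤ (1 / p).toReal := by
    refine ENNReal.toReal_mono ?_ ?_
    · rw [one_div]; exact ENNReal.inv_ne_top.2 (zero_lt_one.trans_le hp).ne'
    · rw [one_div, one_div]; exact ENNReal.inv_le_inv.2 hpq
  have h0 : 0 ≤ (1 / q).toReal := ENNReal.toReal_nonneg
  rw [← h2, ENNReal.mul_rpow_of_nonneg _ _ (mul_nonneg ENNReal.toReal_nonneg (by linarith)),
    ← ENNReal.rpow_mul, mul_assoc]
  have h4 : p.toReal * ((1 / p).toReal - (1 / q).toReal) ≤ 1 := by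
    rw [mul_sub, h2, mul_one_div_cancel hp0]
    have := mul_nonneg (ENNReal.toReal_nonneg (a := p)) h0
    linarith
  have h5 : (j : ℝ) * N * (1 / p).toReal * (p.toReal * ((1 / p).toReal - (1 / q).toReal))
      = (j : ℝ) * N * ((1 / p).toReal - (1 / q).toReal) := by
    rw [h2]; field_simp
  rw [h5]
  gcongr
  exact (ENNReal.rpow_le_rpow_of_exponent_le (L.one_le_bernsteinConst p') h4).trans_eq
    (ENNReal.rpow_one _)

theorem exists_norm_block_le [p'.HolderConjugate p] (f : ZDual N) (j : ℤ)
    (hf : eLpNorm (L.block j f) p volume ≠ ∞) : ∃ B : ℝ, ∀ x, ‖L.block j f x‖ ≤ B :=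
  ⟨_, exists_forall_norm_le_of_enorm_le (ENNReal.mul_ne_top (two_rpow_ne_top _)
    (ENNReal.mul_ne_top (L.bernsteinConst_ne_top p') hf)) (L.enorm_block_le (p := p) (p' := p') f j)⟩

section derivative

variable {f : ZDual N} {j : ℤ} {B : ℝ}

/-- A bounded block is differentiable, as it is its own convolution with the kernel `wker`. -/
theorem hasFDerivAt_block (hB : ∀ x, ‖L.block j f x‖ ≤ B)
    (x : Space N) :
    HasFDerivAt (L.block j f) (∫ y, L.block j f y • fderiv ℝ (L.wker j) (x - y)) x := by
  have h := hasFDerivAt_conv (L.wker j) (L.continuous_block f j).aestronglyMeasurable hB x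
  exact h.congr_of_eventuallyEq (Filter.Eventually.of_forall fun y => (L.conv_wker_block f j y).symm)

theorem fderiv_block_apply (hB : ∀ x, ‖L.block j f x‖ ≤ B)
    (x m : Space N) :
    fderiv ℝ (L.block j f) x m = conv (∂_{m} (L.wker j) : 𝓢(Space N, ℂ)) (L.block j f) x := by
  rw [← fderiv_conv_apply (L.wker j) (L.continuous_block f j).aestronglyMeasurable hB]
  congr 2
  ext x
  exact (L.conv_wker_block f j x).symm

theorem fderiv_block_eq (hB : ∀ x, ‖L.block j f x‖ ≤ B)
    (x m : Space N) :
    fderiv ℝ (L.block j f) x m = (((2 : ℝ) ^ j : ℝ) : ℂ) *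
      conv (dyadicKernel j (derivSymbol m L.wide)) (L.block j f) x := by
  rw [L.fderiv_block_apply hB, wker, lineDeriv_dyadicKernel, ← conv_const_mul_left]
  rfl

theorem continuous_fderiv_block (hB : ∀ x, ‖L.block j f x‖ ≤ B)
    (m : Space N) : Continuous fun x => fderiv ℝ (L.block j f) x m := by
  simp only [L.fderiv_block_apply hB]
  exact continuous_conv _ (L.continuous_block f j).aestronglyMeasurable hB

theorem enorm_fderiv_block_le [p'.HolderConjugate p]
    (hB : ∀ x, ‖L.block j f x‖ ≤ B) (x : Space N) (l : Fin N) :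
    ‖fderiv ℝ (L.block j f) x (EuclideanSpace.single l 1)‖ₑ ≤
      2 ^ (j : ℝ) * 2 ^ ((j : ℝ) * N * (1 / p).toReal) *
      (L.bernsteinConst p' * eLpNorm (L.block j f) p volume) := by
  rw [L.fderiv_block_eq hB, enorm_mul, mul_assoc]
  have e : ‖(((2 : ℝ) ^ j : ℝ) : ℂ)‖ₑ = 2 ^ (j : ℝ) := by
    rw [← ENNReal_ofReal_two_zpow, ← Real.enorm_eq_ofReal (by positivity), ← ofReal_norm,
      ← ofReal_norm, Complex.norm_real]
  rw [e]
  gcongr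
  refine (enorm_conv_dyadicKernel_le (p := p) (p' := p') j _
    (L.continuous_block f j).aestronglyMeasurable x).trans ?_
  gcongr
  exact L.deriv_le_bernsteinConst p' l

theorem eLpNorm_fderiv_block_le (hB : ∀ x, ‖L.block j f x‖ ≤ B)
    (hp : 1 ≤ p) (l : Fin N) :
    eLpNorm (fun x => fderiv ℝ (L.block j f) x (EuclideanSpace.single l 1)) p volume ≤
      2 ^ (j : ℝ) * (L.bernsteinConst 1 * eLpNorm (L.block j f) p volume) := by
  have e : ‖(((2 : ℝ) ^ j : ℝ) : ℂ)‖ₑ = 2 ^ (j : ℝ) := by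
    rw [← ENNReal_ofReal_two_zpow, ← Real.enorm_eq_ofReal (by positivity), ← ofReal_norm,
      ← ofReal_norm, Complex.norm_real]
  have h : (fun x => fderiv ℝ (L.block j f) x (EuclideanSpace.single l 1))
      = (((2 : ℝ) ^ j : ℝ) : ℂ) • conv (dyadicKernel j
        (derivSymbol (EuclideanSpace.single l 1) L.wide)) (L.block j f) := by
    ext x; rw [L.fderiv_block_eq hB]; rfl
  rw [h, eLpNorm_const_smul, e]
  gcongr
  refine (eLpNorm_conv_dyadicKernel_le j _ hp (L.continuous_block f j)).trans ?_
  gcongr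
  exact L.deriv_le_bernsteinConst 1 l

theorem exists_norm_fderiv_block_le (hB : ∀ x, ‖L.block j f x‖ ≤ B) :
    ∃ M : ℝ, ∀ x, ‖fderiv ℝ (L.block j f) x‖ ≤ M := by
  refine ⟨B * ∫ y, ‖fderiv ℝ (L.wker j) y‖, fun x => ?_⟩
  have hi := (SchwartzMap.fderivCLM ℝ (Space N) ℂ (L.wker j)).integrable_sub_left x
  simp only [SchwartzMap.fderivCLM_apply] at hi
  rw [(L.hasFDerivAt_block hB x).fderiv,
    ← integral_sub_left_eq_self (μ := volume) (fun y => ‖fderiv ℝ (L.wker j) y‖) x,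
    ← integral_const_mul]
  refine norm_integral_le_of_norm_le (hi.norm.const_mul B)
    (Filter.Eventually.of_forall fun y => ?_)
  rw [norm_smul]
  exact mul_le_mul_of_nonneg_right (hB y) (norm_nonneg _)

/-- `Δ_k ∂_m Δ_j f = ∂_m Δ_j Δ_k f`, which vanishes unless `|j - k| ≤ 1`. -/
theorem conv_ker_fderiv_block (hB : ∀ x, ‖L.block j f x‖ ≤ B)
    (k : ℤ) (x m : Space N) :
    conv (L.ker k) (fun y => fderiv ℝ (L.block j f) y m) x
      = fderiv ℝ (conv (L.ker j) (L.block k f)) x m := by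
  obtain ⟨M, hM⟩ := L.exists_norm_fderiv_block_le hB
  rw [← conv_lineDeriv_eq (L.ker k) (fun x => (L.hasFDerivAt_block hB x).differentiableAt) hM,
    ← fderiv_conv_apply (L.ker k) (L.continuous_block f j).aestronglyMeasurable hB]
  congr 2
  ext x
  exact L.conv_block_comm f j k x

end derivative

/-- Distant dyadic blocks are orthogonal. -/
theorem conv_ker_block_eq_zero (f : ZDual N) {j k : ℤ} (h : j + 2 ≤ k ∨ k + 2 ≤ j) (x : Space N) :
    conv (L.ker k) (L.block j f) x = 0 := by
  have key : ∀ i n : ℤ, i + 2 ≤ n → ∀ ξ : Space N, 𝓕 (L.ker i) ξ * 𝓕 (L.ker n) ξ = 0 := by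
    intro i n hin ξ
    by_contra hne
    have h1 := (L.norm_bounds_of_ne_zero (by
      rw [← fourier_ker]; exact left_ne_zero_of_mul hne)).2
    have h2 := (L.norm_bounds_of_ne_zero (by
      rw [← fourier_ker]; exact right_ne_zero_of_mul hne)).1
    rw [norm_smul, norm_zpow, Real.norm_ofNat] at h1 h2
    have h3 : (2 : ℝ) ^ (-n) * 4 ≤ 2 ^ (-i) := by
      rw [show (4 : ℝ) = 2 ^ (2 : ℤ) by norm_num, ← zpow_add₀ (by norm_num)]
      exact zpow_le_zpow_right₀ (by norm_num) (by omega)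
    have := mul_le_mul_of_nonneg_right h3 (norm_nonneg ξ)
    nlinarith
  obtain ⟨h1, h2⟩ := L.conv_block f j (θ := L.ker k) (P := 0) (fun ξ => by
    rcases h with h | h
    · rw [mul_comm, key j k h]; simp
    · rw [key k j h]; simp)
  rw [h2]
  convert map_zero f
  ext z
  rw [reflectAt_apply]; rfl

theorem sum_conv_ker_block (f : ZDual N) (k : ℤ) {B : ℝ} (hB : ∀ x, ‖L.block k f x‖ ≤ B)
    (x : Space N) : conv (L.ker (k - 1)) (L.block k f) x + conv (L.ker k) (L.block k f) x
      + conv (L.ker (k + 1)) (L.block k f) x = L.block k f x := by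
  have hm := (L.continuous_block f k).aestronglyMeasurable (μ := volume)
  have hi := fun i => integrable_conv (L.ker i) hm hB x
  refine Eq.trans ?_ (L.conv_wker_block f k x)
  simp only [conv]
  have h3 : Integrable (fun y => L.ker (k - 1) (x - y) * L.block k f y
      + L.ker k (x - y) * L.block k f y) volume := (hi _).add (hi _)
  rw [← integral_add (hi _) (hi _), ← integral_add h3 (hi _)]
  refine integral_congr_ae (Filter.Eventually.of_forall fun y => ?_)
  simp only [wker_eq, add_apply]
  ring

theorem block_ofFun {u : Space N → ℂ} (hu : MemLp u ∞ volume) (k : ℤ) (x : Space N) :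
    L.block k (ZDual.ofFun u) x = conv (L.ker k) u x := by
  rw [block, ZDual.ofFun, dif_pos hu]
  change Lp.toTemperedDistribution (hu.toLp u) (L.kernel k x) = _
  rw [Lp.toTemperedDistribution_apply]
  refine integral_congr_ae ?_
  filter_upwards [hu.coeFn_toLp] with y hy
  rw [hy, kernel_eq, smul_eq_mul]

end LittlewoodPaley

end bernstein

/-! ### Functions with a realized gradient -/

section realized

variable {N : ℕ}

/-- The partial derivative `∂_i w`. -/
def pderiv (w : Space N → ℂ) (i : Fin N) (x : Space N) : ℂ :=
  fderiv ℝ w x (EuclideanSpace.single i 1)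

theorem norm_le_sum_single (A : Space N →L[ℝ] ℂ) : ‖A‖ ≤ ∑ i, ‖A (EuclideanSpace.single i 1)‖ := by
  refine A.opNorm_le_bound (Finset.sum_nonneg fun _ _ => norm_nonneg _) fun v => ?_
  have hv : v = ∑ i, v i • EuclideanSpace.single i (1 : ℝ) := by
    ext j; simp [Pi.single_apply]
  conv_lhs => rw [hv, map_sum]
  rw [Finset.sum_mul]
  refine (norm_sum_le _ _).trans (Finset.sum_le_sum fun i _ => ?_)
  rw [map_smul, norm_smul, mul_comm]
  exact mul_le_mul_of_nonneg_left (PiLp.norm_apply_le v i) (norm_nonneg _)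

theorem clm_ext_single {A B : Space N →L[ℝ] ℂ}
    (h : ∀ i, A (EuclideanSpace.single i 1) = B (EuclideanSpace.single i 1)) : A = B := by
  have := norm_le_sum_single (A - B)
  simp only [sub_apply, h, sub_self, norm_zero, Finset.sum_const_zero] at this
  exact sub_eq_zero.1 (norm_le_zero_iff.1 this)

theorem lineDeriv_lineDeriv_dyadicKernel (j : ℤ) (m n : Space N) (σ : 𝓢(Space N, ℂ)) :
    (∂_{m} (∂_{n} (dyadicKernel j σ) : 𝓢(Space N, ℂ)) : 𝓢(Space N, ℂ))
      = ∂_{n} (∂_{m} (dyadicKernel j σ) : 𝓢(Space N, ℂ)) := by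
  simp only [lineDeriv_dyadicKernel, LineDeriv.lineDerivOp_smul]
  congr 3
  ext ξ
  simp only [derivSymbol_apply]
  ring

namespace LittlewoodPaley

variable (L : LittlewoodPaley N)

/-- The symbol `ξ ↦ φ(ξ) ξ_i / (2 π i |ξ|²)`. These symbols invert the gradient on the frequencies
of a block: the sum over `i` of their products with `2 π i ξ_i` is `φ`. -/
def potentialSymbol (i : Fin N) : 𝓢(Space N, ℂ) :=
  HasCompactSupport.toSchwartzMap
    (f := fun ξ : Space N => L.φ ξ * (((ξ i / ‖ξ‖ ^ 2 : ℝ) : ℂ) / (2 * Real.pi * Complex.I)))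
    (by
      refine HasCompactSupport.mul_right ?_
      refine HasCompactSupport.of_support_subset_isCompact
        (isCompact_closedBall (0 : Space N) (8 / 3)) fun ξ hξ => ?_
      simpa using (L.norm_bounds_of_ne_zero hξ).2)
    (by
      rw [contDiff_iff_contDiffAt]
      intro ξ
      rcases eq_or_ne ξ 0 with rfl | hξ
      · have h : (fun ξ : Space N => L.φ ξ * (((ξ i / ‖ξ‖ ^ 2 : ℝ) : ℂ) / (2 * Real.pi * Complex.I)))
            =ᶠ[nhds 0] fun _ => 0 := by
          filter_upwards [Metric.ball_mem_nhds (0 : Space N) (by norm_num : (0 : ℝ) < 3 / 4)] with ξ hξ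
          have : L.φ ξ = 0 := by
            by_contra hne
            have := (L.norm_bounds_of_ne_zero hne).1
            simp at hξ
            linarith
          rw [this, zero_mul]
        exact contDiffAt_const.congr_of_eventuallyEq h
      · have h1 : ContDiffAt ℝ ((⊤ : ℕ∞) : WithTop ℕ∞) (fun ξ : Space N => ξ i / ‖ξ‖ ^ 2) ξ :=
          ContDiffAt.div (by fun_prop) (contDiff_norm_sq ℝ).contDiffAt (by simpa using hξ)
        exact ((L.φ.smooth _).contDiffAt).mul
          ((Complex.ofRealCLM.contDiff.contDiffAt.comp ξ h1).div_const _))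

theorem potentialSymbol_apply (i : Fin N) (ξ : Space N) :
    L.potentialSymbol i ξ = L.φ ξ * (((ξ i / ‖ξ‖ ^ 2 : ℝ) : ℂ) / (2 * Real.pi * Complex.I)) := rfl

theorem potentialSymbol_bounds {i : Fin N} {ξ : Space N} (h : L.potentialSymbol i ξ ≠ 0) :
    3 / 4 ≤ ‖ξ‖ ∧ ‖ξ‖ ≤ 8 / 3 :=
  L.norm_bounds_of_ne_zero (left_ne_zero_of_mul h)

theorem sum_derivSymbol_potentialSymbol (ξ : Space N) :
    ∑ i, derivSymbol (EuclideanSpace.single i 1) (L.potentialSymbol i) ξ = L.φ ξ := by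
  by_cases h0 : L.φ ξ = 0
  · simp [derivSymbol_apply, potentialSymbol_apply, h0]
  have hξ : ‖ξ‖ ≠ 0 := by
    have := (L.norm_bounds_of_ne_zero h0).1
    intro h; linarith
  have hπ : (Real.pi : ℂ) ≠ 0 := by exact_mod_cast Real.pi_ne_zero
  have h1 : ∀ i, derivSymbol (EuclideanSpace.single i 1) (L.potentialSymbol i) ξ
      = L.φ ξ * ((ξ i ^ 2 / ‖ξ‖ ^ 2 : ℝ) : ℂ) := by
    intro i
    rw [derivSymbol_apply, potentialSymbol_apply, EuclideanSpace.inner_single_right]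
    have hI := Complex.I_ne_zero
    push_cast
    simp only [conj_trivial, one_mul]
    field_simp
  simp only [h1]
  rw [← Finset.mul_sum, ← Complex.ofReal_sum, ← Finset.sum_div, ← EuclideanSpace.real_norm_sq_eq,
    div_self (by positivity)]
  simp

/-- The dyadic piece `Δ_m w`, recovered from the gradient of `w`. The function `w` itself need not
be bounded, and is never regarded as an element of `𝒵'`. -/
def gradPiece (w : Space N → ℂ) (m : ℤ) (x : Space N) : ℂ :=
  ∑ i, (((2 : ℝ) ^ (-m) : ℝ) : ℂ) * conv (dyadicKernel m (L.potentialSymbol i)) (pderiv w i) x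

/-- The norm `2^{nN/p} ‖Δ_n ∇w‖_{L^p}`, where the norm of the gradient is the sum of the norms of
the partial derivatives. -/
def gradBlock (p : ℝ≥0∞) (w : Space N → ℂ) (n : ℤ) : ℝ≥0∞ :=
  ∑ i, 2 ^ ((n : ℝ) * N * (1 / p).toReal) *
    eLpNorm (L.block n (ZDual.ofFun (pderiv w i))) p volume

/-- The gradient of `w` is bounded and is the sum of its dyadic blocks, with a finite
`Ḃ^{N/p}_{p,1}` norm. -/
structure IsRealized (p : ℝ≥0∞) (w : Space N → ℂ) : Prop where
  differentiable : Differentiable ℝ w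
  memLp : ∀ i, MemLp (pderiv w i) ∞ volume
  hasSum : ∀ i x, HasSum (fun k : ℤ => L.block k (ZDual.ofFun (pderiv w i)) x) (pderiv w i x)
  finite : ∑' n, L.gradBlock p w n ≠ ∞

variable {L} {p : ℝ≥0∞} {w : Space N → ℂ}

theorem enorm_block_pderiv_le {p' : ℝ≥0∞} [p'.HolderConjugate p] (w : Space N → ℂ) (i : Fin N) (n : ℤ) (x : Space N) :
    ‖L.block n (ZDual.ofFun (pderiv w i)) x‖ₑ ≤ L.bernsteinConst p' * L.gradBlock p w n := by
  refine (L.enorm_block_le (p := p) (p' := p') _ n x).trans ?_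
  rw [mul_left_comm]
  gcongr
  exact Finset.single_le_sum (f := fun i => 2 ^ ((n : ℝ) * N * (1 / p).toReal) *
    eLpNorm (L.block n (ZDual.ofFun (pderiv w i))) p volume) (fun _ _ => zero_le) (Finset.mem_univ i)

namespace IsRealized

/-- `Ḃ^{N/p}_{p,1}` is embedded in `L^∞`. -/
theorem enorm_pderiv_le (hw : L.IsRealized p w)
    {p' : ℝ≥0∞} [p'.HolderConjugate p] (i : Fin N) (x : Space N) :
    ‖pderiv w i x‖ₑ ≤ L.bernsteinConst p' * ∑' n, L.gradBlock p w n := by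
  rw [← (hw.hasSum i x).tsum_eq, ← ENNReal.tsum_mul_left]
  exact enorm_tsum_le_tsum_enorm.trans (ENNReal.tsum_le_tsum fun n => enorm_block_pderiv_le w i n x)

theorem exists_norm_pderiv_le (hw : L.IsRealized p w)
    {p' : ℝ≥0∞} [p'.HolderConjugate p] : ∃ B : ℝ, ∀ i x, ‖pderiv w i x‖ ≤ B :=
  ⟨_, fun i => exists_forall_norm_le_of_enorm_le (ENNReal.mul_ne_top (L.bernsteinConst_ne_top p')
    hw.finite) (hw.enorm_pderiv_le i)⟩

theorem norm_fderiv_le (hw : L.IsRealized p w)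
    {p' : ℝ≥0∞} [p'.HolderConjugate p] (x : Space N) :
    ‖fderiv ℝ w x‖ ≤ N * (L.bernsteinConst p' * ∑' n, L.gradBlock p w n).toReal := by
  refine (norm_le_sum_single _).trans ?_
  refine (Finset.sum_le_card_nsmul _ _ _ fun i _ => exists_forall_norm_le_of_enorm_le
    (ENNReal.mul_ne_top (L.bernsteinConst_ne_top p') hw.finite) (hw.enorm_pderiv_le i) x).trans_eq ?_
  simp

theorem aestronglyMeasurable_pderiv (hw : L.IsRealized p w) (i : Fin N) :
    AEStronglyMeasurable (pderiv w i) volume := (hw.memLp i).1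

theorem sum_conv_lineDeriv_potential {a : Space N → ℂ} (ha : AEStronglyMeasurable a volume)
    {B : ℝ} (hB : ∀ x, ‖a x‖ ≤ B) (m : ℤ) (x : Space N) :
    ∑ i, (((2 : ℝ) ^ (-m) : ℝ) : ℂ) * conv (∂_{EuclideanSpace.single i (1 : ℝ)}
      (dyadicKernel m (L.potentialSymbol i)) : 𝓢(Space N, ℂ)) a x = conv (L.ker m) a x := by
  have h : ∑ i, (((2 : ℝ) ^ (-m) : ℝ) : ℂ) • (∂_{EuclideanSpace.single i (1 : ℝ)}
      (dyadicKernel m (L.potentialSymbol i)) : 𝓢(Space N, ℂ)) = L.ker m := by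
    simp only [lineDeriv_dyadicKernel, smul_smul]
    have h2 : (((2 : ℝ) ^ (-m) : ℝ) : ℂ) * (((2 : ℝ) ^ m : ℝ) : ℂ) = 1 := by
      rw [← Complex.ofReal_mul, ← zpow_add₀ (by norm_num)]; simp
    simp only [h2, one_smul, ker, dyadicKernel]
    rw [← FourierTransform.fourierInv_sum]
    congr 1
    ext ξ
    rw [sum_apply, dilSymbol_apply, ← L.sum_derivSymbol_potentialSymbol]
    rfl
  rw [← h]
  simp only [← conv_const_mul_left]
  simp only [conv]
  rw [← integral_finsetSum]
  · refine integral_congr_ae (Filter.Eventually.of_forall fun y => ?_)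
    simp only [sum_apply, Finset.sum_mul]
    rfl
  · intro i _
    simp only [mul_assoc]
    exact (integrable_conv _ ha hB x).const_mul _

/-- The gradient of `Δ_m w` is `Δ_m ∇w`. The kernels are differentiated by `∂_l` and act on `∂_i
w`; an integration by parts on both sides exchanges the two indices, although `w` has no second
derivatives. -/
theorem hasFDerivAt_gradPiece (hw : L.IsRealized p w)
    {p' : ℝ≥0∞} [p'.HolderConjugate p] (m : ℤ) (x : Space N) :
    ∃ A : Space N →L[ℝ] ℂ, HasFDerivAt (L.gradPiece w m) A x ∧
      ∀ l, A (EuclideanSpace.single l 1) = L.block m (ZDual.ofFun (pderiv w l)) x := by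
  obtain ⟨B, hB⟩ := hw.exists_norm_pderiv_le (p' := p')
  have h1 := fun i => hasFDerivAt_conv (dyadicKernel m (L.potentialSymbol i))
    (hw.aestronglyMeasurable_pderiv i) (hB i) x
  refine ⟨_, HasFDerivAt.fun_sum fun i _ => (h1 i).const_mul (((2 : ℝ) ^ (-m) : ℝ) : ℂ), fun l => ?_⟩
  have h2 : ∀ i, (∫ y, pderiv w i y • fderiv ℝ (dyadicKernel m (L.potentialSymbol i)) (x - y))
      (EuclideanSpace.single l 1) = conv (∂_{EuclideanSpace.single i (1 : ℝ)}
      (dyadicKernel m (L.potentialSymbol i)) : 𝓢(Space N, ℂ)) (pderiv w l) x := by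
    intro i
    rw [← (h1 i).fderiv, fderiv_conv_apply _ (hw.aestronglyMeasurable_pderiv i) (hB i)]
    change conv _ (fun y => fderiv ℝ w y _) x = conv _ (fun y => fderiv ℝ w y _) x
    rw [← conv_lineDeriv_eq _ hw.differentiable (hw.norm_fderiv_le (p' := p')),
      ← conv_lineDeriv_eq _ hw.differentiable (hw.norm_fderiv_le (p' := p')),
      lineDeriv_lineDeriv_dyadicKernel]
  rw [block_ofFun L (hw.memLp l), ← sum_conv_lineDeriv_potential (hw.aestronglyMeasurable_pderiv l)
    (hB l)]
  simp only [sum_apply, smul_apply, smul_eq_mul, h2]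

theorem continuous_gradPiece (hw : L.IsRealized p w)
    {p' : ℝ≥0∞} [p'.HolderConjugate p] (m : ℤ) : Continuous (L.gradPiece w m) :=
  continuous_iff_continuousAt.2 fun x =>
    (hw.hasFDerivAt_gradPiece (p' := p') m x).choose_spec.1.continuousAt

theorem exists_norm_gradPiece_le (hw : L.IsRealized p w)
    {p' : ℝ≥0∞} [p'.HolderConjugate p] (m : ℤ) :
    ∃ B : ℝ, ∀ x, ‖L.gradPiece w m x‖ ≤ B := by
  obtain ⟨B, hB⟩ := hw.exists_norm_pderiv_le (p' := p')
  refine ⟨∑ i, ‖(((2 : ℝ) ^ (-m) : ℝ) : ℂ)‖ *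
    ((∫ y, ‖dyadicKernel m (L.potentialSymbol i) y‖) * B), fun x => (norm_sum_le _ _).trans
      (Finset.sum_le_sum fun i _ => ?_)⟩
  · rw [norm_mul]
    exact mul_le_mul_of_nonneg_left (norm_conv_le _ (hB i) x) (norm_nonneg _)

/-- Decomposition of the increments of `w`. Both sides have the same gradient. The pieces
themselves need not be summable, in contrast to their increments, which are controlled by their
gradients. -/
theorem exists_hasSum_gradPiece_sub (hw : L.IsRealized p w)
    {p' : ℝ≥0∞} [p'.HolderConjugate p] :
    ∃ M : ℤ → ℝ, Summable M ∧ (∀ m x y, ‖L.gradPiece w m x - L.gradPiece w m y‖ ≤ M m * ‖x - y‖) ∧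
      ∀ x y, HasSum (fun m => L.gradPiece w m x - L.gradPiece w m y) (w x - w y) := by
  choose A hA hAl using fun m x => hw.hasFDerivAt_gradPiece (p' := p') m x
  set M : ℤ → ℝ := fun m => N * (L.bernsteinConst p' * L.gradBlock p w m).toReal with hM
  have hfin : ∑' m, L.bernsteinConst p' * L.gradBlock p w m ≠ ∞ := by
    rw [ENNReal.tsum_mul_left]
    exact ENNReal.mul_ne_top (L.bernsteinConst_ne_top p') hw.finite
  have hMs : Summable M := (ENNReal.summable_toReal hfin).mul_left _
  have hAM : ∀ m x, ‖A m x‖ ≤ M m := by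
    intro m x
    refine (norm_le_sum_single _).trans ?_
    refine (Finset.sum_le_card_nsmul _ _ (L.bernsteinConst p' * L.gradBlock p w m).toReal
      fun i _ => ?_).trans_eq (by simp [hM])
    rw [hAl]
    exact exists_forall_norm_le_of_enorm_le (ENNReal.ne_top_of_tsum_ne_top hfin m)
      (enorm_block_pderiv_le w i m) x
  have hlip : ∀ m x y, ‖L.gradPiece w m x - L.gradPiece w m y‖ ≤ M m * ‖x - y‖ := fun m x y =>
    Convex.norm_image_sub_le_of_norm_hasFDerivWithin_le (𝕜 := ℝ) (s := univ)
      (fun z _ => (hA m z).hasFDerivWithinAt) (fun z _ => hAM m z) convex_univ (mem_univ y)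
      (mem_univ x)
  refine ⟨M, hMs, hlip, ?_⟩
  have hsum : ∀ x y, Summable fun m => L.gradPiece w m x - L.gradPiece w m y := fun x y =>
    Summable.of_norm_bounded (hMs.mul_right _) (fun m => hlip m x y)
  have hd : ∀ x, HasFDerivAt (fun x => ∑' m, (L.gradPiece w m x - L.gradPiece w m 0))
      (∑' m, A m x) x := fun x =>
    hasFDerivAt_tsum (x₀ := 0) hMs (fun m x => (hA m x).sub_const _) hAM (hsum 0 0) x
  have hAs : ∀ x, ∑' m, A m x = fderiv ℝ w x := by
    intro x
    refine clm_ext_single fun i => ?_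
    have h1 : Summable fun m => A m x := Summable.of_norm_bounded hMs (fun m => hAM m x)
    have h2 : HasSum (fun m => A m x (EuclideanSpace.single i 1))
        ((∑' m, A m x) (EuclideanSpace.single i 1)) :=
      ((ContinuousLinearMap.apply ℝ ℂ (EuclideanSpace.single i (1 : ℝ))).hasSum h1.hasSum)
    simp only [hAl] at h2
    exact h2.unique (hw.hasSum i x)
  have hconst : ∀ x y, w x - ∑' m, (L.gradPiece w m x - L.gradPiece w m 0)
      = w y - ∑' m, (L.gradPiece w m y - L.gradPiece w m 0) := by
    refine is_const_of_fderiv_eq_zero (𝕜 := ℝ)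
      (f := fun x => w x - ∑' m, (L.gradPiece w m x - L.gradPiece w m 0)) ?_ ?_
    · exact fun x => (hw.differentiable x).sub (hd x).differentiableAt
    · intro x
      rw [((hw.differentiable x).hasFDerivAt.fun_sub (hd x)).fderiv, hAs, sub_self]
  intro x y
  refine (hsum x y).hasSum_iff.2 ?_
  have h3 : ∑' m, (L.gradPiece w m x - L.gradPiece w m y)
      = ∑' m, (L.gradPiece w m x - L.gradPiece w m 0)
        - ∑' m, (L.gradPiece w m y - L.gradPiece w m 0) := by
    rw [← (hsum x 0).tsum_sub (hsum y 0)]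
    congr 1; ext m; ring
  rw [h3]
  linear_combination (-1 : ℂ) * hconst x y

theorem gradBlock_ne_top (hw : L.IsRealized p w) (n : ℤ) : L.gradBlock p w n ≠ ∞ :=
  ENNReal.ne_top_of_tsum_ne_top hw.finite n

theorem eLpNorm_block_pderiv_ne_top (hw : L.IsRealized p w) (i : Fin N) (n : ℤ) :
    eLpNorm (L.block n (ZDual.ofFun (pderiv w i))) p volume ≠ ∞ := by
  intro h
  refine hw.gradBlock_ne_top n (ENNReal.sum_eq_top.2 ⟨i, Finset.mem_univ i, ?_⟩)
  rw [h]
  exact ENNReal.mul_top (two_rpow_ne_zero _)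

theorem eLpNorm_block_pderiv_le (hw : L.IsRealized p w) {p' : ℝ≥0∞} [p'.HolderConjugate p]
    (hp : 1 ≤ p) (hp' : p ≠ ∞) {q : ℝ≥0∞} (hpq : p ≤ q) (i : Fin N) (n : ℤ) :
    eLpNorm (L.block n (ZDual.ofFun (pderiv w i))) q volume ≤
      2 ^ (-((n : ℝ) * N * (1 / q).toReal)) * (L.bernsteinConst p' * L.gradBlock p w n) := by
  refine (L.eLpNorm_block_le (p' := p') hp hp' hpq _ n (hw.eLpNorm_block_pderiv_ne_top i n)).trans ?_
  rw [mul_sub, sub_eq_add_neg, add_comm, two_rpow_add, mul_assoc]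
  refine mul_le_mul_right ?_ _
  rw [mul_left_comm]
  refine mul_le_mul_right ?_ _
  exact Finset.single_le_sum (f := fun i => 2 ^ ((n : ℝ) * N * (1 / p).toReal) *
    eLpNorm (L.block n (ZDual.ofFun (pderiv w i))) p volume) (fun _ _ => zero_le) (Finset.mem_univ i)

theorem conv_wker_pderiv (hw : L.IsRealized p w) {p' : ℝ≥0∞} [p'.HolderConjugate p] (i : Fin N)
    (m : ℤ) (x : Space N) : conv (L.wker m) (pderiv w i) x =
      L.block (m - 1) (ZDual.ofFun (pderiv w i)) x + L.block m (ZDual.ofFun (pderiv w i)) x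
        + L.block (m + 1) (ZDual.ofFun (pderiv w i)) x := by
  obtain ⟨B, hB⟩ := hw.exists_norm_pderiv_le (p' := p')
  have hi := fun n => integrable_conv (L.ker n) (hw.aestronglyMeasurable_pderiv i) (hB i) x
  simp only [block_ofFun L (hw.memLp i), conv]
  have h3 : Integrable (fun y => L.ker (m - 1) (x - y) * pderiv w i y
      + L.ker m (x - y) * pderiv w i y) volume := (hi _).add (hi _)
  rw [← integral_add (hi _) (hi _), ← integral_add h3 (hi _)]
  refine integral_congr_ae (Filter.Eventually.of_forall fun y => ?_)
  simp only [wker_eq, add_apply]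
  ring

end IsRealized

variable (L) in
/-- A constant in the estimate of the pieces of `w` by the blocks of its gradient. -/
def pieceConst (p' : ℝ≥0∞) : ℝ≥0∞ :=
  (∑ i, eLpNorm (𝓕⁻ (L.potentialSymbol i) : 𝓢(Space N, ℂ)) 1 volume) *
    (2 ^ (N : ℝ) * L.bernsteinConst p')

variable (L) in
theorem pieceConst_ne_top (p' : ℝ≥0∞) : L.pieceConst p' ≠ ∞ :=
  ENNReal.mul_ne_top (ENNReal.sum_ne_top.2 fun _ _ => SchwartzMap.eLpNorm_ne_top _ _)
    (ENNReal.mul_ne_top (two_rpow_ne_top _) (L.bernsteinConst_ne_top p'))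

/-- The pieces of `w` gain one derivative over the blocks of its gradient. -/
theorem IsRealized.eLpNorm_gradPiece_le (hw : L.IsRealized p w) {p' : ℝ≥0∞}
    [p'.HolderConjugate p] (hp : 1 ≤ p) (hp' : p ≠ ∞) {q : ℝ≥0∞} (hpq : p ≤ q) (m : ℤ) :
    eLpNorm (L.gradPiece w m) q volume ≤ L.pieceConst p' * (2 ^ (-(m : ℝ)) *
      2 ^ (-((m : ℝ) * N * (1 / q).toReal)) *
      (L.gradBlock p w (m - 1) + L.gradBlock p w m + L.gradBlock p w (m + 1))) := by
  have hq : 1 ≤ q := hp.trans hpq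
  obtain ⟨B, hB⟩ := hw.exists_norm_pderiv_le (p' := p')
  have hcb := fun n i => L.continuous_block (ZDual.ofFun (pderiv w i)) n
  have hq1 : (1 / q).toReal ≤ 1 := by
    have : 1 / q ≤ 1 := by rw [one_div]; exact ENNReal.inv_le_one.2 hq
    simpa using ENNReal.toReal_mono ENNReal.one_ne_top this
  have hq0 : 0 ≤ (1 / q).toReal := ENNReal.toReal_nonneg
  have hblock : ∀ i (n : ℤ), m - 1 ≤ n →
      eLpNorm (L.block n (ZDual.ofFun (pderiv w i))) q volume ≤
      2 ^ (N : ℝ) * L.bernsteinConst p' * 2 ^ (-((m : ℝ) * N * (1 / q).toReal)) *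
        L.gradBlock p w n := by
    intro i n hn
    refine (hw.eLpNorm_block_pderiv_le (p' := p') hp hp' hpq i n).trans ?_
    have h1 : (2 : ℝ≥0∞) ^ (-((n : ℝ) * N * (1 / q).toReal))
        ≤ 2 ^ (N : ℝ) * 2 ^ (-((m : ℝ) * N * (1 / q).toReal)) := by
      rw [← two_rpow_add]
      refine two_rpow_le ?_
      have h2 : (m : ℝ) - 1 ≤ n := by exact_mod_cast hn
      have h3 : 0 ≤ (N : ℝ) * (1 / q).toReal := by positivity
      nlinarith [Nat.cast_nonneg (α := ℝ) N]
    calc _ ≤ 2 ^ (N : ℝ) * 2 ^ (-((m : ℝ) * N * (1 / q).toReal)) *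
          (L.bernsteinConst p' * L.gradBlock p w n) := by gcongr
      _ = _ := by ring
  have hconv : ∀ i, eLpNorm (conv (dyadicKernel m (L.potentialSymbol i)) (pderiv w i)) q volume ≤
      eLpNorm (𝓕⁻ (L.potentialSymbol i) : 𝓢(Space N, ℂ)) 1 volume *
      (2 ^ (N : ℝ) * L.bernsteinConst p' * (2 ^ (-((m : ℝ) * N * (1 / q).toReal)) *
      (L.gradBlock p w (m - 1) + L.gradBlock p w m + L.gradBlock p w (m + 1)))) := by
    intro i
    have e1 : conv (dyadicKernel m (L.potentialSymbol i)) (pderiv w i)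
        = conv (dyadicKernel m (L.potentialSymbol i)) (fun x =>
          L.block (m - 1) (ZDual.ofFun (pderiv w i)) x + L.block m (ZDual.ofFun (pderiv w i)) x
          + L.block (m + 1) (ZDual.ofFun (pderiv w i)) x) := by
      ext x
      simp only [← hw.conv_wker_pderiv (p' := p')]
      rw [show (fun x => conv (L.wker m) (pderiv w i) x) = conv (L.wker m) (pderiv w i) from rfl,
        conv_conv _ _ (hw.aestronglyMeasurable_pderiv i) (hB i)]
      refine conv_congr_left (fun z => ?_) _ _
      refine (conv_dyadicKernel (fun ξ => ?_) z).symm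
      simp only [dilSymbol_apply]
      exact (L.mul_wide_eq (fun ξ => L.potentialSymbol_bounds) _).symm
    rw [e1]
    refine (eLpNorm_conv_dyadicKernel_le m _ hq (by fun_prop)).trans ?_
    gcongr
    refine (eLpNorm_add_le (by fun_prop) (by fun_prop) hq).trans ?_
    refine (add_le_add_left (eLpNorm_add_le (by fun_prop) (by fun_prop) hq) _).trans ?_
    refine (add_le_add (add_le_add (hblock i (m - 1) le_rfl) (hblock i m (by omega)))
      (hblock i (m + 1) (by omega))).trans_eq ?_
    ring
  have e2 : L.gradPiece w m = ∑ i, (((2 : ℝ) ^ (-m) : ℝ) : ℂ) •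
      conv (dyadicKernel m (L.potentialSymbol i)) (pderiv w i) := by
    ext x; simp [gradPiece]
  have e : ‖(((2 : ℝ) ^ (-m) : ℝ) : ℂ)‖ₑ = 2 ^ (-(m : ℝ)) := by
    rw [← Int.cast_neg, ← ENNReal_ofReal_two_zpow, ← Real.enorm_eq_ofReal (by positivity),
      ← ofReal_norm, ← ofReal_norm, Complex.norm_real]
  rw [e2]
  refine (eLpNorm_sum_le (fun i _ => ((continuous_conv _ (hw.aestronglyMeasurable_pderiv i)
    (hB i)).const_smul _).aestronglyMeasurable) hq).trans ?_
  rw [pieceConst, Finset.sum_mul, Finset.sum_mul]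
  refine Finset.sum_le_sum fun i _ => ?_
  rw [eLpNorm_const_smul, e]
  refine (mul_le_mul_right (hconv i) _).trans_eq ?_
  ring

end LittlewoodPaley

end realized

/-! ### The commutator of a vector field with a dyadic block -/

section commutator

variable {N : ℕ}

/-- The commutator `w (H * c) - H * (w c)` at `x`. -/
def commConv (w c H : Space N → ℂ) (x : Space N) : ℂ := ∫ y, (w x - w y) * c y * H (x - y)

/-- A Lipschitz function commutes with a kernel up to the first moment of the kernel. -/
theorem eLpNorm_commConv_le {w c : Space N → ℂ} (H : 𝓢(Space N, ℂ)) {M : ℝ}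
    (hM0 : 0 ≤ M) (hw : ∀ x y, ‖w x - w y‖ ≤ M * ‖x - y‖) (hc : Continuous c) {p : ℝ≥0∞} (hp : 1 ≤ p) :
    eLpNorm (commConv w c H) p volume ≤
      ENNReal.ofReal M * eLpNorm (fun x => ‖x‖ * ‖H x‖) 1 volume * eLpNorm c p volume := by
  have h := eLpNorm_le_of_enorm_le_lintegral (H := fun x => ‖x‖ * ‖H x‖) (c := fun y => M • c y)
    (R := commConv w c H) (by fun_prop) (by fun_prop) hp (fun x => by
      refine (enorm_integral_le_lintegral_enorm _).trans (lintegral_mono fun y => ?_)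
      simp only [← ofReal_norm, norm_mul, norm_norm, norm_smul]
      rw [← ENNReal.ofReal_mul (by positivity)]
      refine ENNReal.ofReal_le_ofReal ?_
      rw [Real.norm_of_nonneg hM0]
      have := mul_le_mul_of_nonneg_right (hw x y) (mul_nonneg (norm_nonneg (c y))
        (norm_nonneg (H (x - y))))
      nlinarith)
  refine h.trans_eq ?_
  rw [show (fun y => M • c y) = M • c from rfl, eLpNorm_const_smul, Real.enorm_eq_ofReal hM0]
  ring

namespace LittlewoodPaley

variable {L : LittlewoodPaley N} {p : ℝ≥0∞} {w : Space N → ℂ}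

theorem IsRealized.norm_sub_le (hw : L.IsRealized p w) {p' : ℝ≥0∞} [p'.HolderConjugate p]
    (x y : Space N) : ‖w x - w y‖ ≤
      N * (L.bernsteinConst p' * ∑' n, L.gradBlock p w n).toReal * ‖x - y‖ :=
  Convex.norm_image_sub_le_of_norm_fderiv_le (𝕜 := ℝ) (s := univ)
    (fun z _ => hw.differentiable z) (fun z _ => hw.norm_fderiv_le (p' := p') z) convex_univ
    (mem_univ y) (mem_univ x)

/-- If `c` has no frequencies seen by `h_k`, and no frequencies which the pieces `Δ_m w`, for `m`
outside of `S`, move to frequencies seen by `h_k`, then only the pieces with `m ∈ S` contribute to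
the commutator. -/
theorem IsRealized.commConv_eq_sum (hw : L.IsRealized p w) {p' : ℝ≥0∞} [p'.HolderConjugate p]
    (H : 𝓢(Space N, ℂ)) {c : Space N → ℂ} (hc : Continuous c) {B : ℝ} (hB : ∀ x, ‖c x‖ ≤ B)
    (S : Finset ℤ) (x : Space N) (h0 : conv H c x = 0)
    (hS : ∀ m ∉ S, ∫ y, L.gradPiece w m y * c y * H (x - y) = 0) :
    commConv w c H x = -∑ m ∈ S, ∫ y, L.gradPiece w m y * c y * H (x - y) := by
  obtain ⟨M, hMs, hlip, hsum⟩ := hw.exists_hasSum_gradPiece_sub (p' := p')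
  have hB0 : 0 ≤ B := (norm_nonneg _).trans (hB x)
  have hcont := fun m => hw.continuous_gradPiece (p' := p') m
  have hHx := H.integrable_sub_left x
  have hHc : Integrable (fun y => c y * H (x - y)) volume :=
    hHx.bdd_mul hc.aestronglyMeasurable (Filter.Eventually.of_forall hB)
  have hWi : ∀ m, Integrable (fun y => L.gradPiece w m y * c y * H (x - y)) volume := by
    intro m
    obtain ⟨B', hB'⟩ := hw.exists_norm_gradPiece_le (p' := p') m
    simp only [mul_assoc]
    exact hHc.bdd_mul (hcont m).aestronglyMeasurable (Filter.Eventually.of_forall hB')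
  have hFi : ∀ m, Integrable (fun y => (L.gradPiece w m x - L.gradPiece w m y) * c y * H (x - y))
      volume := by
    intro m
    have := (hHc.const_mul (L.gradPiece w m x)).sub (hWi m)
    refine this.congr (Filter.Eventually.of_forall fun y => ?_)
    simp only [Pi.sub_apply]; ring
  have hFe : ∀ m, ∫ y, (L.gradPiece w m x - L.gradPiece w m y) * c y * H (x - y)
      = -∫ y, L.gradPiece w m y * c y * H (x - y) := by
    intro m
    have h1 : ∫ y, c y * H (x - y) = 0 := by
      rw [← h0, conv]; congr 1; ext y; ring
    have h2 : ∀ y, (L.gradPiece w m x - L.gradPiece w m y) * c y * H (x - y)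
        = L.gradPiece w m x * (c y * H (x - y)) - L.gradPiece w m y * c y * H (x - y) :=
      fun y => by ring
    simp only [h2]
    rw [integral_sub (hHc.const_mul _) (hWi m), integral_const_mul, h1, mul_zero, zero_sub]
  have hmom : Integrable (fun y => ‖x - y‖ * ‖H (x - y)‖) volume := by
    have := (integrable_comp_sub_left (μ := volume) (fun z => ‖z‖ ^ 1 * ‖H z‖) x).2
      (H.integrable_pow_mul volume 1)
    simpa using this
  have hnorm : Summable fun m => ∫ y, ‖(L.gradPiece w m x - L.gradPiece w m y) * c y * H (x - y)‖ := by
    refine Summable.of_nonneg_of_le (fun m => integral_nonneg fun y => norm_nonneg _)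
      (fun m => ?_) (hMs.mul_right (B * ∫ y, ‖x - y‖ * ‖H (x - y)‖))
    rw [← integral_const_mul, ← integral_const_mul]
    refine integral_mono (hFi m).norm ((hmom.const_mul B).const_mul (M m)) fun y => ?_
    simp only [norm_mul]
    calc _ ≤ M m * ‖x - y‖ * B * ‖H (x - y)‖ := by
          refine mul_le_mul_of_nonneg_right ?_ (norm_nonneg _)
          exact mul_le_mul (hlip m x y) (hB y) (norm_nonneg _)
            ((norm_nonneg _).trans (hlip m x y))
      _ = _ := by ring
  have h1 := hasSum_integral_of_summable_integral_norm hFi hnorm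
  have h2 : ∀ y, ∑' m, (L.gradPiece w m x - L.gradPiece w m y) * c y * H (x - y)
      = (w x - w y) * c y * H (x - y) := fun y =>
    (((hsum x y).mul_right (c y)).mul_right (H (x - y))).tsum_eq
  simp only [h2, hFe] at h1
  have h3 : HasSum (fun m => -∫ y, L.gradPiece w m y * c y * H (x - y))
      (∑ m ∈ S, -∫ y, L.gradPiece w m y * c y * H (x - y)) :=
    hasSum_sum_of_ne_finset_zero fun m hm => by rw [hS m hm, neg_zero]
  rw [Finset.sum_neg_distrib] at h3
  exact h1.unique h3

/-- Frequency localization of the product of a piece of `w` with a derivative of a block. -/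
theorem IsRealized.integral_gradPiece_mul_eq_zero (hw : L.IsRealized p w) {p' : ℝ≥0∞}
    [p'.HolderConjugate p] {f : ZDual N} {j : ℤ} {B : ℝ} (hB : ∀ x, ‖L.block j f x‖ ≤ B)
    (l : Fin N) {m k : ℤ}
    (h : ∀ ξ η : Space N, 2 ^ m * (3 / 4) ≤ ‖ξ‖ → ‖ξ‖ ≤ 2 ^ m * (8 / 3) →
      2 ^ j * (3 / 8) ≤ ‖η‖ → ‖η‖ ≤ 2 ^ j * (16 / 3) →
      2 ^ k * (3 / 4) ≤ ‖ξ + η‖ → ‖ξ + η‖ ≤ 2 ^ k * (8 / 3) → False) (x : Space N) :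
    ∫ y, L.gradPiece w m y * pderiv (L.block j f) l y * L.ker k (x - y) = 0 := by
  obtain ⟨D, hD⟩ := hw.exists_norm_pderiv_le (p' := p')
  have hsc : ∀ (n : ℤ) (ξ : Space N) (a b : ℝ), a ≤ ‖(2 : ℝ) ^ (-n) • ξ‖ ∧ ‖(2 : ℝ) ^ (-n) • ξ‖ ≤ b →
      2 ^ n * a ≤ ‖ξ‖ ∧ ‖ξ‖ ≤ 2 ^ n * b := by
    intro n ξ a b hab
    rw [norm_smul, norm_zpow, Real.norm_ofNat, zpow_neg, inv_mul_eq_div,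
      le_div_iff₀ (by positivity), div_le_iff₀ (by positivity)] at hab
    exact ⟨by linarith [hab.1], by linarith [hab.2]⟩
  have hfour : ∀ η, 𝓕 (∂_{EuclideanSpace.single l (1 : ℝ)} (L.wker j) : 𝓢(Space N, ℂ)) η ≠ 0 →
      L.wide ((2 : ℝ) ^ (-j) • η) ≠ 0 := by
    intro η hη h0
    refine hη ?_
    rw [wker, lineDeriv_dyadicKernel, FourierTransform.fourier_smul, smul_apply,
      fourier_dyadicKernel, dilSymbol_apply, derivSymbol_apply, h0]
    simp
  have hi : ∀ i, ∫ y, conv (dyadicKernel m (L.potentialSymbol i)) (pderiv w i) y *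
      conv (∂_{EuclideanSpace.single l (1 : ℝ)} (L.wker j) : 𝓢(Space N, ℂ)) (L.block j f) y *
      L.ker k (x - y) = 0 := by
    intro i
    refine integral_conv_mul_conv_mul_eq_zero (fun ξ η hξ hη => ?_)
      (hw.aestronglyMeasurable_pderiv i) (L.continuous_block f j).aestronglyMeasurable (hD i) hB x
    rw [fourier_dyadicKernel, dilSymbol_apply] at hξ
    by_contra hne
    rw [fourier_ker] at hne
    obtain ⟨a1, a2⟩ := hsc _ _ _ _ (L.potentialSymbol_bounds hξ)
    obtain ⟨b1, b2⟩ := hsc _ _ _ _ (L.wide_bounds (hfour η hη))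
    obtain ⟨c1, c2⟩ := hsc _ _ _ _ (L.norm_bounds_of_ne_zero hne)
    exact h ξ η a1 a2 b1 b2 c1 c2
  have he : ∀ y, L.gradPiece w m y * pderiv (L.block j f) l y * L.ker k (x - y)
      = ∑ i, (((2 : ℝ) ^ (-m) : ℝ) : ℂ) *
        (conv (dyadicKernel m (L.potentialSymbol i)) (pderiv w i) y *
      conv (∂_{EuclideanSpace.single l (1 : ℝ)} (L.wker j) : 𝓢(Space N, ℂ)) (L.block j f) y *
      L.ker k (x - y)) := by
    intro y
    rw [gradPiece, pderiv, L.fderiv_block_apply hB, Finset.sum_mul, Finset.sum_mul]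
    refine Finset.sum_congr rfl fun i _ => by ring
  simp only [he]
  rw [integral_finsetSum]
  · simp only [integral_const_mul, hi, mul_zero, Finset.sum_const_zero]
  · intro i _
    refine Integrable.const_mul ?_ _
    simp only [mul_assoc]
    refine Integrable.bdd_mul ?_ (continuous_conv _ (hw.aestronglyMeasurable_pderiv i)
      (hD i)).aestronglyMeasurable (Filter.Eventually.of_forall (norm_conv_le _ (hD i)))
    exact ((L.ker k).integrable_sub_left x).bdd_mul
      (continuous_conv _ (L.continuous_block f j).aestronglyMeasurable hB).aestronglyMeasurable
      (Filter.Eventually.of_forall (norm_conv_le _ hB))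

/-- The sum of the seven numbers `2^{nN/p} ‖Δ_n ∇w‖_{L^p}` with `|n - k| ≤ 3`. -/
def gradWindow (L : LittlewoodPaley N) (p : ℝ≥0∞) (w : Space N → ℂ) (k : ℤ) : ℝ≥0∞ :=
  ∑ n ∈ Finset.Icc (k - 3) (k + 3), L.gradBlock p w n

theorem gradBlock_add_le {m k : ℤ} (h1 : k - 2 ≤ m) (h2 : m ≤ k + 2) :
    L.gradBlock p w (m - 1) + L.gradBlock p w m + L.gradBlock p w (m + 1) ≤ L.gradWindow p w k := by
  have h : ∑ n ∈ ({m - 1, m, m + 1} : Finset ℤ), L.gradBlock p w n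
      = L.gradBlock p w (m - 1) + L.gradBlock p w m + L.gradBlock p w (m + 1) := by
    rw [Finset.sum_insert (by simp; omega), Finset.sum_pair (by omega), add_assoc]
  rw [← h]
  refine Finset.sum_le_sum_of_subset fun n hn => ?_
  simp only [Finset.mem_insert, Finset.mem_singleton, Finset.mem_Icc] at hn ⊢
  omega

theorem gradBlock_add_le_tsum (m : ℤ) :
    L.gradBlock p w (m - 1) + L.gradBlock p w m + L.gradBlock p w (m + 1) ≤
      ∑' n, L.gradBlock p w n :=
  (gradBlock_add_le (k := m) (by omega) (by omega)).trans (ENNReal.sum_le_tsum _)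

theorem tsum_gradWindow : ∑' k, L.gradWindow p w k = 7 * ∑' n, L.gradBlock p w n := by
  have h : ∀ k, L.gradWindow p w k = ∑ i ∈ Finset.Icc (-3 : ℤ) 3, L.gradBlock p w (k + i) := by
    intro k
    rw [gradWindow]
    have : Finset.Icc (k - 3) (k + 3) = (Finset.Icc (-3 : ℤ) 3).map (addLeftEmbedding k) := by
      rw [Finset.map_add_left_Icc]; congr 1
    rw [this, Finset.sum_map]; rfl
  simp only [h]
  rw [Summable.tsum_finsetSum fun _ _ => ENNReal.summable]
  have h2 : ∀ i : ℤ, ∑' k, L.gradBlock p w (k + i) = ∑' n, L.gradBlock p w n := fun i =>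
    (Equiv.addRight i).tsum_eq (L.gradBlock p w)
  simp only [h2, Finset.sum_const, Int.card_Icc, nsmul_eq_mul]
  change ((7 : ℕ) : ℝ≥0∞) * _ = _
  norm_num

end LittlewoodPaley

end commutator

/-! ### Frequency interactions in the commutator -/

section commutatorBounds

variable {N : ℕ}

theorem ENNReal.HolderConjugate.toReal_add {q q' : ℝ≥0∞} [q.HolderConjugate q'] :
    (1 / q).toReal + (1 / q').toReal = 1 := by
  have := ENNReal.HolderConjugate.inv_add_inv_eq_one q q'
  rw [one_div, one_div, ← ENNReal.toReal_add, this, ENNReal.toReal_one]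
  · exact ENNReal.inv_ne_top.2 (ENNReal.HolderConjugate.ne_zero q q')
  · exact ENNReal.inv_ne_top.2 (ENNReal.HolderConjugate.ne_zero q' q)

namespace LittlewoodPaley

variable {L : LittlewoodPaley N} {p : ℝ≥0∞} {w : Space N → ℂ} {f : ZDual N} {j k : ℤ}

/-- Blocks with distant indices have disjoint frequencies. -/
theorem conv_ker_pderiv_block_eq_zero {B : ℝ} (hB : ∀ x, ‖L.block j f x‖ ≤ B)
    (h : j + 2 ≤ k ∨ k + 2 ≤ j) (l : Fin N) (x : Space N) :
    conv (L.ker k) (pderiv (L.block j f) l) x = 0 := by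
  rw [show pderiv (L.block j f) l = fun y => fderiv ℝ (L.block j f) y (EuclideanSpace.single l 1)
    from rfl, L.conv_ker_fderiv_block hB]
  have : conv (L.ker j) (L.block k f) = fun _ => 0 := by
    ext y
    exact L.conv_ker_block_eq_zero f (by omega) y
  rw [this]
  simp

/-- The part of the commutator outside of the diagonal is a finite sum of trilinear terms. -/
theorem IsRealized.eLpNorm_commConv_le_sum (hw : L.IsRealized p w) {p' : ℝ≥0∞}
    [p'.HolderConjugate p] (hp : 1 ≤ p) (hf : eLpNorm (L.block j f) p volume ≠ ∞)
    (h : j + 2 ≤ k ∨ k + 2 ≤ j) (l : Fin N) (S : Finset ℤ)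
    (hS : ∀ m ∉ S, ∀ ξ η : Space N, 2 ^ m * (3 / 4) ≤ ‖ξ‖ → ‖ξ‖ ≤ 2 ^ m * (8 / 3) →
      2 ^ j * (3 / 8) ≤ ‖η‖ → ‖η‖ ≤ 2 ^ j * (16 / 3) →
      2 ^ k * (3 / 4) ≤ ‖ξ + η‖ → ‖ξ + η‖ ≤ 2 ^ k * (8 / 3) → False) :
    eLpNorm (commConv w (pderiv (L.block j f) l) (L.ker k)) p volume ≤
      ∑ m ∈ S, eLpNorm (conv (L.ker k) fun y => L.gradPiece w m y * pderiv (L.block j f) l y)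
        p volume := by
  obtain ⟨B, hB⟩ := L.exists_norm_block_le (p' := p') f j hf
  obtain ⟨M, hM⟩ := L.exists_norm_fderiv_block_le hB
  have hc : Continuous (pderiv (L.block j f) l) := L.continuous_fderiv_block hB _
  have hcM : ∀ x, ‖pderiv (L.block j f) l x‖ ≤ M := fun x =>
    ((fderiv ℝ (L.block j f) x).le_opNorm _).trans (by simpa using hM x)
  have e : commConv w (pderiv (L.block j f) l) (L.ker k)
      = -∑ m ∈ S, conv (L.ker k) fun y => L.gradPiece w m y * pderiv (L.block j f) l y := by
    ext x
    rw [hw.commConv_eq_sum (p' := p') (L.ker k) hc hcM S x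
      (conv_ker_pderiv_block_eq_zero hB h l x)
      fun m hm => hw.integral_gradPiece_mul_eq_zero (p' := p') hB l (hS m hm) x]
    simp only [Pi.neg_apply, Finset.sum_apply, conv]
    congr 1
    refine Finset.sum_congr rfl fun m _ => ?_
    congr 1; ext y; ring
  rw [e, eLpNorm_neg]
  refine eLpNorm_sum_le (fun m _ => ?_) hp
  obtain ⟨B', hB'⟩ := hw.exists_norm_gradPiece_le (p' := p') m
  refine (continuous_conv (L.ker k) (((hw.continuous_gradPiece (p' := p') m).mul
    hc).aestronglyMeasurable) (B := B' * M) fun x => ?_).aestronglyMeasurable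
  rw [Pi.mul_apply, norm_mul]
  exact mul_le_mul (hB' x) (hcM x) (norm_nonneg _) ((norm_nonneg _).trans (hB' x))

theorem two_zpow_mul_le {j k : ℤ} (n : ℕ) (h : j + n ≤ k) : (2 : ℝ) ^ j * 2 ^ n ≤ 2 ^ k := by
  rw [← zpow_natCast, ← zpow_add₀ (by norm_num)]
  exact zpow_le_zpow_right₀ (by norm_num) h

/-- Frequencies of size `2^j` do not move those of size `2^m` to `2^k` if `j ≤ k - 5`, unless `m`
is close to `k`. -/
theorem frequencies_low {j k m : ℤ} {ξ η : Space N} (hjk : j + 5 ≤ k) (hm : m + 3 ≤ k ∨ k + 2 ≤ m)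
    (h1 : 2 ^ m * (3 / 4) ≤ ‖ξ‖) (h2 : ‖ξ‖ ≤ 2 ^ m * (8 / 3)) (h4 : ‖η‖ ≤ 2 ^ j * (16 / 3))
    (h5 : 2 ^ k * (3 / 4) ≤ ‖ξ + η‖) (h6 : ‖ξ + η‖ ≤ 2 ^ k * (8 / 3)) : False := by
  have e1 : (2 : ℝ) ^ j * 32 ≤ 2 ^ k := by
    have := two_zpow_mul_le 5 hjk; norm_num at this; exact this
  have hX : (0 : ℝ) < 2 ^ k := by positivity
  have t1 := norm_add_le ξ η
  have t2 : ‖ξ‖ ≤ ‖ξ + η‖ + ‖η‖ := by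
    have := norm_sub_le (ξ + η) η
    rwa [add_sub_cancel_right] at this
  rcases hm with hm | hm
  · have e2 : (2 : ℝ) ^ m * 8 ≤ 2 ^ k := by
      have := two_zpow_mul_le 3 hm; norm_num at this; exact this
    linarith
  · have e2 : (2 : ℝ) ^ k * 4 ≤ 2 ^ m := by
      have := two_zpow_mul_le 2 hm; norm_num at this; exact this
    linarith

/-- Frequencies of size `2^j` and `2^m` do not add up to `2^k` if `k ≤ j - 5`, unless `m` is close
to `j`. -/
theorem frequencies_high {j k m : ℤ} {ξ η : Space N} (hjk : k + 5 ≤ j) (hm : m + 4 ≤ j ∨ j + 3 ≤ m)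
    (h1 : 2 ^ m * (3 / 4) ≤ ‖ξ‖) (h2 : ‖ξ‖ ≤ 2 ^ m * (8 / 3)) (h3 : 2 ^ j * (3 / 8) ≤ ‖η‖)
    (h4 : ‖η‖ ≤ 2 ^ j * (16 / 3)) (h6 : ‖ξ + η‖ ≤ 2 ^ k * (8 / 3)) : False := by
  have e1 : (2 : ℝ) ^ k * 32 ≤ 2 ^ j := by
    have := two_zpow_mul_le 5 hjk; norm_num at this; exact this
  have hX : (0 : ℝ) < 2 ^ j := by positivity
  have t1 : ‖η‖ ≤ ‖ξ + η‖ + ‖ξ‖ := by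
    have := norm_sub_le (ξ + η) ξ
    rwa [add_sub_cancel_left] at this
  have t2 : ‖ξ‖ ≤ ‖ξ + η‖ + ‖η‖ := by
    have := norm_sub_le (ξ + η) η
    rwa [add_sub_cancel_right] at this
  rcases hm with hm | hm
  · have e2 : (2 : ℝ) ^ m * 16 ≤ 2 ^ j := by
      have := two_zpow_mul_le 4 hm; norm_num at this; exact this
    linarith
  · have e2 : (2 : ℝ) ^ j * 8 ≤ 2 ^ m := by
      have := two_zpow_mul_le 3 hm; norm_num at this; exact this
    linarith

variable (L) in
/-- Low frequencies of the function, high frequencies of the vector field. The pieces `Δ_m w` with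
`k - 2 ≤ m ≤ k + 1` contribute; they are estimated in `L^p`, with a factor `2^{-k(1 + N/p)}`, and
the derivative of `Δ_j f` in `L^∞`, with a factor `2^{j(1 + N/p)}`. -/
theorem exists_eLpNorm_commConv_le_low {p' : ℝ≥0∞} [p'.HolderConjugate p] (hp : 1 ≤ p) (hp' : p ≠ ∞) :
    ∃ C : ℝ≥0∞, C ≠ ∞ ∧ ∀ (w : Space N → ℂ) (f : ZDual N) (j k : ℤ) (l : Fin N),
      L.IsRealized p w → eLpNorm (L.block j f) p volume ≠ ∞ → j + 5 ≤ k →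
      eLpNorm (commConv w (pderiv (L.block j f) l) (L.ker k)) p volume ≤
        C * (L.gradWindow p w k * 2 ^ (((j : ℝ) - k) * (1 + N * (1 / p).toReal))) *
          eLpNorm (L.block j f) p volume := by
  set P := (1 / p).toReal with hP
  have hP0 : 0 ≤ P := ENNReal.toReal_nonneg
  set κ := eLpNorm (𝓕⁻ L.φ : 𝓢(Space N, ℂ)) 1 volume with hκ
  refine ⟨4 * (κ * (L.pieceConst p' * 2 ^ (2 + 2 * N * P) * L.bernsteinConst p')), ?_, ?_⟩
  · refine ENNReal.mul_ne_top (by norm_num) (ENNReal.mul_ne_top (SchwartzMap.eLpNorm_ne_top _ _)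
      (ENNReal.mul_ne_top (ENNReal.mul_ne_top (L.pieceConst_ne_top p') (two_rpow_ne_top _))
      (L.bernsteinConst_ne_top p')))
  intro w f j k l hw hf hjk
  obtain ⟨B, hB⟩ := L.exists_norm_block_le (p' := p') f j hf
  have hc : Continuous (pderiv (L.block j f) l) := L.continuous_fderiv_block hB _
  refine (hw.eLpNorm_commConv_le_sum (p' := p') hp hf (by omega) l (Finset.Icc (k - 2) (k + 1))
    ?_).trans ?_
  · intro m hm ξ η h1 h2 h3 h4 h5 h6
    rw [Finset.mem_Icc, not_and_or, not_le, not_le] at hm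
    exact frequencies_low hjk (by omega) h1 h2 h4 h5 h6
  have hterm : ∀ m ∈ Finset.Icc (k - 2) (k + 1),
      eLpNorm (conv (L.ker k) fun y => L.gradPiece w m y * pderiv (L.block j f) l y) p volume ≤
      κ * (L.pieceConst p' * 2 ^ (2 + 2 * N * P) * L.bernsteinConst p') *
      (L.gradWindow p w k * 2 ^ (((j : ℝ) - k) * (1 + N * P))) *
          eLpNorm (L.block j f) p volume := by
    intro m hm
    obtain ⟨hm1, hm2⟩ := Finset.mem_Icc.1 hm
    have hm1' : (k : ℝ) - 2 ≤ m := by exact_mod_cast hm1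
    refine (eLpNorm_conv_dyadicKernel_le k L.φ hp ((hw.continuous_gradPiece (p' := p') m).mul
      hc)).trans ?_
    have h1 : eLpNorm (fun y => L.gradPiece w m y * pderiv (L.block j f) l y) p volume ≤
        eLpNorm (L.gradPiece w m) p volume * eLpNorm (pderiv (L.block j f) l) ∞ volume := by
      have := eLpNorm_smul_le_eLpNorm_mul_eLpNorm_top (μ := (volume : Measure (Space N))) p
        (pderiv (L.block j f) l) (φ := L.gradPiece w m)
        (hw.continuous_gradPiece (p' := p') m).aestronglyMeasurable
      exact this
    have h2 : eLpNorm (pderiv (L.block j f) l) ∞ volume ≤ 2 ^ (j : ℝ) * 2 ^ ((j : ℝ) * N * P) *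
        (L.bernsteinConst p' * eLpNorm (L.block j f) p volume) := by
      rw [eLpNorm_exponent_top]
      exact essSup_le_of_ae_le _ (Filter.Eventually.of_forall fun x =>
        L.enorm_fderiv_block_le (p := p) (p' := p') hB x l)
    have h3 := hw.eLpNorm_gradPiece_le (p' := p') hp hp' le_rfl m
    have h4 := gradBlock_add_le (L := L) (p := p) (w := w) (k := k) (m := m) (by omega) (by omega)
    have h5 : (2 : ℝ≥0∞) ^ (-(m : ℝ)) * 2 ^ (-((m : ℝ) * N * P)) * (2 ^ (j : ℝ) *
        2 ^ ((j : ℝ) * N * P)) ≤ 2 ^ (2 + 2 * N * P) * 2 ^ (((j : ℝ) - k) * (1 + N * P)) := by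
      simp only [← two_rpow_add]
      refine two_rpow_le ?_
      have : 0 ≤ (N : ℝ) * P := by positivity
      nlinarith
    calc κ * eLpNorm (fun y => L.gradPiece w m y * pderiv (L.block j f) l y) p volume
        ≤ κ * ((L.pieceConst p' * (2 ^ (-(m : ℝ)) * 2 ^ (-((m : ℝ) * N * P)) *
          L.gradWindow p w k)) * (2 ^ (j : ℝ) * 2 ^ ((j : ℝ) * N * P) *
        (L.bernsteinConst p' * eLpNorm (L.block j f) p volume))) := by
          refine mul_le_mul_right (h1.trans (mul_le_mul' (h3.trans ?_) h2)) _
          exact mul_le_mul_right (mul_le_mul_right h4 _) _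
      _ = κ * (L.pieceConst p' * L.bernsteinConst p' * L.gradWindow p w k *
          eLpNorm (L.block j f) p volume * ((2 : ℝ≥0∞) ^ (-(m : ℝ)) * 2 ^ (-((m : ℝ) * N * P)) *
          (2 ^ (j : ℝ) * 2 ^ ((j : ℝ) * N * P)))) := by ring
      _ ≤ κ * (L.pieceConst p' * L.bernsteinConst p' * L.gradWindow p w k *
          eLpNorm (L.block j f) p volume *
          (2 ^ (2 + 2 * N * P) * 2 ^ (((j : ℝ) - k) * (1 + N * P)))) := by gcongr
      _ = _ := by ring
  refine (Finset.sum_le_card_nsmul _ _ _ hterm).trans_eq ?_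
  rw [Int.card_Icc, show (k + 1 + 1 - (k - 2)).toNat = 4 by omega, nsmul_eq_mul]
  push_cast
  ring

variable (L) in
/-- High frequencies of the function and of the vector field. The pieces `Δ_m w` with `j - 3 ≤ m ≤
j + 2` contribute; they are estimated in `L^q`, with a factor `2^{-j(1 + N/q)}`, the derivative of
`Δ_j f` in `L^p`, with a factor `2^j`, and the kernel of `Δ_k` in `L^{q'}`, with a factor
`2^{kN/q}`. -/
theorem exists_eLpNorm_commConv_le_high {p' : ℝ≥0∞} [p'.HolderConjugate p] (hp : 1 ≤ p)
    (hp' : p ≠ ∞) {q q' : ℝ≥0∞} [q.HolderConjugate q'] (hpq : p ≤ q) (hqp : q' ≤ p) :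
    ∃ C : ℝ≥0∞, C ≠ ∞ ∧ ∀ (w : Space N → ℂ) (f : ZDual N) (j k : ℤ) (l : Fin N),
      L.IsRealized p w → eLpNorm (L.block j f) p volume ≠ ∞ → k + 5 ≤ j →
      eLpNorm (commConv w (pderiv (L.block j f) l) (L.ker k)) p volume ≤
        C * ((∑' n, L.gradBlock p w n) * 2 ^ (((k : ℝ) - j) * (N * (1 / q).toReal))) *
          eLpNorm (L.block j f) p volume := by
  set Q := (1 / q).toReal with hQ
  have hQ0 : 0 ≤ Q := ENNReal.toReal_nonneg
  set κ := eLpNorm (𝓕⁻ L.φ : 𝓢(Space N, ℂ)) q' volume with hκ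
  refine ⟨6 * (κ * (L.pieceConst p' * 2 ^ (3 + 3 * N * Q) * L.bernsteinConst 1)), ?_, ?_⟩
  · refine ENNReal.mul_ne_top (by norm_num) (ENNReal.mul_ne_top (SchwartzMap.eLpNorm_ne_top _ _)
      (ENNReal.mul_ne_top (ENNReal.mul_ne_top (L.pieceConst_ne_top p') (two_rpow_ne_top _))
      (L.bernsteinConst_ne_top 1)))
  intro w f j k l hw hf hjk
  obtain ⟨B, hB⟩ := L.exists_norm_block_le (p' := p') f j hf
  have hc : Continuous (pderiv (L.block j f) l) := L.continuous_fderiv_block hB _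
  refine (hw.eLpNorm_commConv_le_sum (p' := p') hp hf (by omega) l (Finset.Icc (j - 3) (j + 2))
    ?_).trans ?_
  · intro m hm ξ η h1 h2 h3 h4 h5 h6
    rw [Finset.mem_Icc, not_and_or, not_le, not_le] at hm
    exact frequencies_high hjk (by omega) h1 h2 h3 h4 h6
  have hterm : ∀ m ∈ Finset.Icc (j - 3) (j + 2),
      eLpNorm (conv (L.ker k) fun y => L.gradPiece w m y * pderiv (L.block j f) l y) p volume ≤
      κ * (L.pieceConst p' * 2 ^ (3 + 3 * N * Q) * L.bernsteinConst 1) *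
      ((∑' n, L.gradBlock p w n) * 2 ^ (((k : ℝ) - j) * (N * Q))) *
          eLpNorm (L.block j f) p volume := by
    intro m hm
    obtain ⟨hm1, hm2⟩ := Finset.mem_Icc.1 hm
    have hm1' : (j : ℝ) - 3 ≤ m := by exact_mod_cast hm1
    have h1 := eLpNorm_le_of_enorm_le_lintegral_mul (q := q) (q' := q') (p := p)
      (R := conv (L.ker k) fun y => L.gradPiece w m y * pderiv (L.block j f) l y)
      (L.ker k).continuous (hw.continuous_gradPiece (p' := p') m) hc hp hp' hqp (fun x => by
        simpa only [enorm_mul] using enorm_conv_le (L.ker k)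
          (fun y => L.gradPiece w m y * pderiv (L.block j f) l y) x)
    have h2 : eLpNorm (L.ker k) q' volume = 2 ^ ((k : ℝ) * N * Q) * κ := by
      rw [ker, eLpNorm_dyadicKernel, hQ,
        show 1 - (1 / q').toReal = (1 / q).toReal by
          have := ENNReal.HolderConjugate.toReal_add (q := q) (q' := q'); linarith]
    have h3 := hw.eLpNorm_gradPiece_le (p' := p') hp hp' hpq m
    have h4 : eLpNorm (pderiv (L.block j f) l) p volume ≤ 2 ^ (j : ℝ) *
        (L.bernsteinConst 1 * eLpNorm (L.block j f) p volume) := L.eLpNorm_fderiv_block_le hB hp l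
    have h6 := gradBlock_add_le_tsum (L := L) (p := p) (w := w) m
    have h5 : (2 : ℝ≥0∞) ^ ((k : ℝ) * N * Q) * (2 ^ (-(m : ℝ)) * 2 ^ (-((m : ℝ) * N * Q)) *
        2 ^ (j : ℝ)) ≤ 2 ^ (3 + 3 * N * Q) * 2 ^ (((k : ℝ) - j) * (N * Q)) := by
      simp only [← two_rpow_add]
      refine two_rpow_le ?_
      have : 0 ≤ (N : ℝ) * Q := by positivity
      nlinarith
    calc eLpNorm (conv (L.ker k) fun y => L.gradPiece w m y * pderiv (L.block j f) l y) p volume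
        ≤ (2 ^ ((k : ℝ) * N * Q) * κ) * (L.pieceConst p' * (2 ^ (-(m : ℝ)) *
          2 ^ (-((m : ℝ) * N * Q)) * ∑' n, L.gradBlock p w n)) * (2 ^ (j : ℝ) *
        (L.bernsteinConst 1 * eLpNorm (L.block j f) p volume)) := by
          refine h1.trans (mul_le_mul' (mul_le_mul' h2.le (h3.trans ?_)) h4)
          exact mul_le_mul_right (mul_le_mul_right h6 _) _
      _ = κ * (L.pieceConst p' * L.bernsteinConst 1 * (∑' n, L.gradBlock p w n) *
          eLpNorm (L.block j f) p volume * ((2 : ℝ≥0∞) ^ ((k : ℝ) * N * Q) *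
          (2 ^ (-(m : ℝ)) * 2 ^ (-((m : ℝ) * N * Q)) * 2 ^ (j : ℝ)))) := by ring
      _ ≤ κ * (L.pieceConst p' * L.bernsteinConst 1 * (∑' n, L.gradBlock p w n) *
          eLpNorm (L.block j f) p volume *
          (2 ^ (3 + 3 * N * Q) * 2 ^ (((k : ℝ) - j) * (N * Q)))) := by gcongr
      _ = _ := by ring
  refine (Finset.sum_le_card_nsmul _ _ _ hterm).trans_eq ?_
  rw [Int.card_Icc, show (j + 2 + 1 - (j - 3)).toNat = 6 by omega, nsmul_eq_mul]
  push_cast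
  ring

variable (L) in
/-- Comparable frequencies. The Lipschitz bound for `w` and the first moment of the kernel of `Δ_k`
give a factor `2^{-k}`, and the derivative of `Δ_j f` a factor `2^j`. -/
theorem exists_eLpNorm_commConv_le_near {p' : ℝ≥0∞} [p'.HolderConjugate p] (hp : 1 ≤ p) :
    ∃ C : ℝ≥0∞, C ≠ ∞ ∧ ∀ (w : Space N → ℂ) (f : ZDual N) (j k : ℤ) (l : Fin N),
      L.IsRealized p w → eLpNorm (L.block j f) p volume ≠ ∞ → j ≤ k + 4 →
      eLpNorm (commConv w (pderiv (L.block j f) l) (L.ker k)) p volume ≤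
        C * (∑' n, L.gradBlock p w n) * eLpNorm (L.block j f) p volume := by
  set κ := eLpNorm (fun x => ‖x‖ * ‖(𝓕⁻ L.φ : 𝓢(Space N, ℂ)) x‖) 1 volume with hκ
  have hκt : κ ≠ ∞ := by
    have := ((𝓕⁻ L.φ : 𝓢(Space N, ℂ)).integrable_pow_mul volume 1)
    simp only [pow_one] at this
    exact (memLp_one_iff_integrable.2 this).2.ne
  refine ⟨N * L.bernsteinConst p' * (2 ^ (4 : ℝ) * κ) * L.bernsteinConst 1, ?_, ?_⟩
  · exact ENNReal.mul_ne_top (ENNReal.mul_ne_top (ENNReal.mul_ne_top (ENNReal.natCast_ne_top N)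
      (L.bernsteinConst_ne_top p')) (ENNReal.mul_ne_top (two_rpow_ne_top _) hκt))
      (L.bernsteinConst_ne_top 1)
  intro w f j k l hw hf hjk
  obtain ⟨B, hB⟩ := L.exists_norm_block_le (p' := p') f j hf
  have hc : Continuous (pderiv (L.block j f) l) := L.continuous_fderiv_block hB _
  refine (eLpNorm_commConv_le (L.ker k) (by positivity) (hw.norm_sub_le (p' := p')) hc hp).trans ?_
  have h4 : eLpNorm (pderiv (L.block j f) l) p volume ≤ 2 ^ (j : ℝ) *
      (L.bernsteinConst 1 * eLpNorm (L.block j f) p volume) := L.eLpNorm_fderiv_block_le hB hp l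
  rw [ENNReal.ofReal_mul (by positivity), ENNReal.ofReal_natCast, ENNReal.ofReal_toReal
    (ENNReal.mul_ne_top (L.bernsteinConst_ne_top p') hw.finite), ker,
    eLpNorm_norm_mul_dyadicKernel]
  have h5 : (2 : ℝ≥0∞) ^ (-(k : ℝ)) * 2 ^ (j : ℝ) ≤ 2 ^ (4 : ℝ) := by
    rw [← two_rpow_add]
    refine two_rpow_le ?_
    have : (j : ℝ) ≤ k + 4 := by exact_mod_cast hjk
    linarith
  calc _ ≤ N * (L.bernsteinConst p' * ∑' n, L.gradBlock p w n) * (2 ^ (-(k : ℝ)) * κ) *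
        (2 ^ (j : ℝ) * (L.bernsteinConst 1 * eLpNorm (L.block j f) p volume)) := by gcongr
    _ = N * L.bernsteinConst p' * ((2 ^ (-(k : ℝ)) * 2 ^ (j : ℝ)) * κ) * L.bernsteinConst 1 *
        (∑' n, L.gradBlock p w n) * eLpNorm (L.block j f) p volume := by ring
    _ ≤ _ := by gcongr

end LittlewoodPaley

end commutatorBounds

/-! ### The weighted commutator estimate -/

section commutatorSum

variable {N : ℕ}

/-- Weights on the dyadic frequencies which increase, but not faster than the frequency. -/
structure IsSlowWeight (Ω : ℤ → ℝ≥0∞) : Prop where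
  mono : ∀ k k', k ≤ k' → Ω k ≤ Ω k'
  slow : ∀ k k', k ≤ k' → Ω k' ≤ 2 ^ ((k' : ℝ) - k) * Ω k

theorem IsSlowWeight.le_mul {Ω : ℤ → ℝ≥0∞} (hΩ : IsSlowWeight Ω) (s : ℝ) (j k : ℤ) :
    2 ^ ((k : ℝ) * s) * Ω k ≤
      2 ^ (((k : ℝ) - j) * s + max ((k : ℝ) - j) 0) * (2 ^ ((j : ℝ) * s) * Ω j) := by
  have h : Ω k ≤ 2 ^ (max ((k : ℝ) - j) 0) * Ω j := by
    rcases le_total k j with h | h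
    · have h' : (k : ℝ) ≤ j := by exact_mod_cast h
      rw [max_eq_right (by linarith), ENNReal.rpow_zero, one_mul]
      exact hΩ.mono _ _ h
    · have h' : (j : ℝ) ≤ k := by exact_mod_cast h
      rw [max_eq_left (by linarith)]
      exact hΩ.slow _ _ h
  calc 2 ^ ((k : ℝ) * s) * Ω k ≤ 2 ^ ((k : ℝ) * s) * (2 ^ (max ((k : ℝ) - j) 0) * Ω j) := by gcongr
    _ = 2 ^ ((k : ℝ) * s) * 2 ^ (max ((k : ℝ) - j) 0) * Ω j := by ring
    _ = 2 ^ (((k : ℝ) - j) * s + max ((k : ℝ) - j) 0) * 2 ^ ((j : ℝ) * s) * Ω j := by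
        rw [← two_rpow_add, ← two_rpow_add]
        congr 2; ring
    _ = _ := by ring

theorem tsum_two_rpow_neg_abs_ne_top {ε : ℝ} (hε : 0 < ε) :
    ∑' n : ℤ, (2 : ℝ≥0∞) ^ (-(ε * |(n : ℝ)|)) ≠ ∞ := by
  have hr : (2 : ℝ) ^ (-ε) < 1 := Real.rpow_lt_one_of_one_lt_of_neg (by norm_num) (by linarith)
  have h1 : Summable fun n : ℕ => ((2 : ℝ) ^ (-ε)) ^ n :=
    summable_geometric_of_lt_one (by positivity) hr
  have h2 : Summable fun n : ℤ => (2 : ℝ) ^ (-(ε * |(n : ℝ)|)) := by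
    refine Summable.of_nat_of_neg (h1.congr fun n => ?_) (h1.congr fun n => ?_)
    · rw [← Real.rpow_natCast, ← Real.rpow_mul (by norm_num)]
      simp
    · rw [← Real.rpow_natCast, ← Real.rpow_mul (by norm_num)]
      simp
  have h3 := h2.tsum_ofReal_ne_top
  refine fun h => h3 ?_
  rw [← h]
  congr 1; ext n
  rw [← ENNReal.ofReal_rpow_of_pos (by norm_num)]
  simp

namespace LittlewoodPaley

variable {L : LittlewoodPaley N} {p : ℝ≥0∞}

variable (L) in
/-- The frequency interactions in the commutator, with weights. At low frequencies `j` there is no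
decay in `k - j` if `s = N/p`, since the slow growth of `Ω` uses up one power, and the sum over `k`
relies on the factor `gradWindow`. At high frequencies `j` the decay comes from `ε > 0`. -/
theorem exists_weighted_commConv_le {p' : ℝ≥0∞} [p'.HolderConjugate p] (hp : 1 ≤ p)
    (hp' : p ≠ ∞) {q q' : ℝ≥0∞} [q.HolderConjugate q'] (hpq : p ≤ q) (hqp : q' ≤ p) {s ε : ℝ}
    (hs : s ≤ N * (1 / p).toReal) (hε : 0 < ε) (hεs : ε ≤ s + N * (1 / q).toReal) :
    ∃ C : ℝ≥0∞, C ≠ ∞ ∧ ∀ (Ω : ℤ → ℝ≥0∞) (w : Space N → ℂ) (f : ZDual N) (j k : ℤ) (l : Fin N),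
      IsSlowWeight Ω → L.IsRealized p w → eLpNorm (L.block j f) p volume ≠ ∞ →
      2 ^ ((k : ℝ) * s) * Ω k *
        eLpNorm (commConv w (pderiv (L.block j f) l) (L.ker k)) p volume ≤
        C * ((∑' n, L.gradBlock p w n) * 2 ^ (-(ε * |((k - j : ℤ) : ℝ)|)) + L.gradWindow p w k) *
          (2 ^ ((j : ℝ) * s) * Ω j * eLpNorm (L.block j f) p volume) := by
  obtain ⟨C₁, hC₁, h₁⟩ := L.exists_eLpNorm_commConv_le_low (p' := p') hp hp'
  obtain ⟨C₂, hC₂, h₂⟩ := L.exists_eLpNorm_commConv_le_high (p' := p') hp hp' hpq hqp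
  obtain ⟨C₃, hC₃, h₃⟩ := L.exists_eLpNorm_commConv_le_near (p := p) (p' := p') hp
  refine ⟨C₁ + C₂ + C₃ * 2 ^ (4 * |s| + 4 + 4 * ε), ENNReal.add_ne_top.2
    ⟨ENNReal.add_ne_top.2 ⟨hC₁, hC₂⟩, ENNReal.mul_ne_top hC₃ (two_rpow_ne_top _)⟩, ?_⟩
  intro Ω w f j k l hΩ hw hf
  have hW := hΩ.le_mul s j k
  set A := eLpNorm (L.block j f) p volume
  set W := (2 : ℝ≥0∞) ^ ((j : ℝ) * s) * Ω j
  set G := ∑' n, L.gradBlock p w n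
  set E := eLpNorm (commConv w (pderiv (L.block j f) l) (L.ker k)) p volume
  set e := (2 : ℝ≥0∞) ^ (-(ε * |((k - j : ℤ) : ℝ)|)) with he
  rcases le_or_gt (j + 5) k with hlow | hlow
  · have hr : (j : ℝ) + 5 ≤ k := by exact_mod_cast hlow
    have h := h₁ w f j k l hw hf hlow
    have e1 : (2 : ℝ≥0∞) ^ (((k : ℝ) - j) * s + max ((k : ℝ) - j) 0) *
        2 ^ (((j : ℝ) - k) * (1 + N * (1 / p).toReal)) ≤ 1 := by
      rw [← two_rpow_add, max_eq_left (by linarith)]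
      refine (two_rpow_le (y := 0) ?_).trans_eq ENNReal.rpow_zero
      nlinarith
    calc _ ≤ (2 ^ (((k : ℝ) - j) * s + max ((k : ℝ) - j) 0) * W) * (C₁ * (L.gradWindow p w k *
          2 ^ (((j : ℝ) - k) * (1 + N * (1 / p).toReal))) * A) := mul_le_mul' hW h
      _ = (2 ^ (((k : ℝ) - j) * s + max ((k : ℝ) - j) 0) *
          2 ^ (((j : ℝ) - k) * (1 + N * (1 / p).toReal))) * (C₁ * L.gradWindow p w k * (W * A)) := by
          ring
      _ ≤ 1 * (C₁ * L.gradWindow p w k * (W * A)) := by gcongr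
      _ ≤ _ := by
          rw [one_mul]
          gcongr
          · exact le_add_right le_self_add
          · exact le_add_self
  rcases le_or_gt (k + 5) j with hhigh | hhigh
  · have hr : (k : ℝ) + 5 ≤ j := by exact_mod_cast hhigh
    have h := h₂ w f j k l hw hf hhigh
    have e1 : (2 : ℝ≥0∞) ^ (((k : ℝ) - j) * s + max ((k : ℝ) - j) 0) *
        2 ^ (((k : ℝ) - j) * (N * (1 / q).toReal)) ≤ e := by
      rw [← two_rpow_add, max_eq_right (by linarith)]
      refine two_rpow_le ?_
      push_cast
      rw [abs_of_nonpos (by linarith)]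
      nlinarith
    calc _ ≤ (2 ^ (((k : ℝ) - j) * s + max ((k : ℝ) - j) 0) * W) * (C₂ * (G *
          2 ^ (((k : ℝ) - j) * (N * (1 / q).toReal))) * A) := mul_le_mul' hW h
      _ = (2 ^ (((k : ℝ) - j) * s + max ((k : ℝ) - j) 0) *
          2 ^ (((k : ℝ) - j) * (N * (1 / q).toReal))) * (C₂ * G * (W * A)) := by ring
      _ ≤ e * (C₂ * G * (W * A)) := by gcongr
      _ = C₂ * (G * e) * (W * A) := by ring
      _ ≤ _ := by
          gcongr
          · exact le_add_right le_add_self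
          · exact le_self_add
  · have hr : (k : ℝ) - j ≤ 4 := by
      have : k - j ≤ 4 := by omega
      exact_mod_cast this
    have hr' : -4 ≤ (k : ℝ) - j := by
      have : -4 ≤ k - j := by omega
      exact_mod_cast this
    have h := h₃ w f j k l hw hf (by omega)
    have habs : |(k : ℝ) - j| ≤ 4 := abs_le.2 ⟨hr', hr⟩
    have e1 : (2 : ℝ≥0∞) ^ (((k : ℝ) - j) * s + max ((k : ℝ) - j) 0) ≤
        2 ^ (4 * |s| + 4 + 4 * ε) * e := by
      rw [he, ← two_rpow_add]
      refine two_rpow_le ?_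
      have a1 : ((k : ℝ) - j) * s ≤ 4 * |s| := by
        refine (le_abs_self _).trans ?_
        rw [abs_mul]
        exact mul_le_mul_of_nonneg_right habs (abs_nonneg _)
      have a2 : max ((k : ℝ) - j) 0 ≤ 4 := max_le hr (by norm_num)
      push_cast
      nlinarith
    calc _ ≤ (2 ^ (((k : ℝ) - j) * s + max ((k : ℝ) - j) 0) * W) * (C₃ * G * A) := mul_le_mul' hW h
      _ ≤ ((2 ^ (4 * |s| + 4 + 4 * ε) * e) * W) * (C₃ * G * A) := by gcongr
      _ = C₃ * 2 ^ (4 * |s| + 4 + 4 * ε) * (G * e) * (W * A) := by ring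
      _ ≤ _ := by
          gcongr
          · exact le_add_self
          · exact le_self_add

/-- The `l`-th component of a vector field. -/
def vcomp (u : Space N → Space N) (l : Fin N) (x : Space N) : ℂ := ((u x l : ℝ) : ℂ)

theorem pderiv_vcomp {u : Space N → Space N} (hu : Differentiable ℝ u) (i l : Fin N) :
    pderiv (vcomp u l) i = partialDeriv u i l := by
  ext x
  have h : HasFDerivAt (vcomp u l)
      ((Complex.ofRealCLM.comp (EuclideanSpace.proj l : Space N →L[ℝ] ℝ)).comp (fderiv ℝ u x)) x :=
    (Complex.ofRealCLM.comp (EuclideanSpace.proj l : Space N →L[ℝ] ℝ)).hasFDerivAt.comp x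
      (hu x).hasFDerivAt
  rw [pderiv, h.fderiv]
  rfl

theorem gradBesovNorm_eq {u : Space N → Space N} (hu : Differentiable ℝ u) :
    L.gradBesovNorm ((N : ℝ) * (1 / p).toReal) p u = ∑ l, ∑' n, L.gradBlock p (vcomp u l) n := by
  rw [gradBesovNorm, Finset.sum_comm]
  refine Finset.sum_congr rfl fun l _ => ?_
  simp only [gradBlock]
  rw [Summable.tsum_finsetSum fun _ _ => ENNReal.summable]
  refine Finset.sum_congr rfl fun i _ => ?_
  simp only [besovNorm, pderiv_vcomp hu]
  refine tsum_congr fun k => ?_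
  congr 1
  rw [mul_one, ← ENNReal.ofReal_rpow_of_pos (by norm_num), mul_assoc]
  simp

theorem isRealized_vcomp {u : Space N → Space N} (hu : L.HasRealizedGradient u)
    (hfin : L.gradBesovNorm ((N : ℝ) * (1 / p).toReal) p u ≠ ∞) (l : Fin N) :
    L.IsRealized p (vcomp u l) where
  differentiable := (Complex.ofRealCLM.comp
    (EuclideanSpace.proj l : Space N →L[ℝ] ℝ)).differentiable.comp hu.differentiable
  memLp i := by rw [pderiv_vcomp hu.differentiable]; exact hu.bounded i l
  hasSum i x := by rw [pderiv_vcomp hu.differentiable]; exact hu.hasSum i l x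
  finite := by
    rw [gradBesovNorm_eq hu.differentiable] at hfin
    exact (ENNReal.sum_ne_top.1 hfin) l (Finset.mem_univ l)

theorem clm_apply_eq_sum (A : Space N →L[ℝ] ℂ) (v : Space N) :
    A v = ∑ l, ((v l : ℝ) : ℂ) * A (EuclideanSpace.single l 1) := by
  have hv : v = ∑ i, v i • EuclideanSpace.single i (1 : ℝ) := by
    ext j; simp [Pi.single_apply]
  conv_lhs => rw [hv, map_sum]
  simp only [map_smul, Complex.real_smul]

variable (L) in
/-- The difference between `u · ∇(Δ_k f)` and `Δ_k (u · ∇f)`. -/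
def commutator (u : Space N → Space N) (f : ZDual N) (k : ℤ) (x : Space N) : ℂ :=
  fderiv ℝ (L.block k f) x (u x) - L.transport u f ⟨L.kernel k x, L.kernel_mem k x⟩

/-- The commutator is the sum of the commutators with the dyadic blocks of `f`. -/
theorem commutator_eq_tsum {p' : ℝ≥0∞} [p'.HolderConjugate p] {u : Space N → Space N}
    (hw : ∀ l, L.IsRealized p (vcomp u l)) {f : ZDual N}
    (hf : ∀ j, eLpNorm (L.block j f) p volume ≠ ∞) {k : ℤ} {x : Space N}
    (hs : Summable fun j => L.blockTransport u j f ⟨L.kernel k x, L.kernel_mem k x⟩) :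
    L.commutator u f k x =
      ∑' j, ∑ l, commConv (vcomp u l) (pderiv (L.block j f) l) (L.ker k) x := by
  choose B hB using fun j => L.exists_norm_block_le (p' := p') f j (hf j)
  have hc : ∀ j l, Continuous (pderiv (L.block j f) l) := fun j l =>
    L.continuous_fderiv_block (hB j) _
  have hint1 : ∀ j l, Integrable (fun y => pderiv (L.block j f) l y * L.ker k (x - y)) volume := by
    intro j l
    obtain ⟨M, hM⟩ := L.exists_norm_fderiv_block_le (hB j)
    refine ((L.ker k).integrable_sub_left x).bdd_mul (c := M) (hc j l).aestronglyMeasurable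
      (Filter.Eventually.of_forall fun y => ?_)
    exact ((fderiv ℝ (L.block j f) y).le_opNorm _).trans (by simpa using hM y)
  have hint2 : ∀ j l, Integrable (fun y => (vcomp u l x - vcomp u l y) *
      pderiv (L.block j f) l y * L.ker k (x - y)) volume := by
    intro j l
    obtain ⟨M, hM⟩ := L.exists_norm_fderiv_block_le (hB j)
    have hmom : Integrable (fun y => ‖x - y‖ * ‖L.ker k (x - y)‖) volume := by
      have := (integrable_comp_sub_left (μ := volume) (fun z => ‖z‖ ^ 1 * ‖L.ker k z‖) x).2
        ((L.ker k).integrable_pow_mul volume 1)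
      simpa using this
    set K := (N : ℝ) * (L.bernsteinConst p' * ∑' n, L.gradBlock p (vcomp u l) n).toReal
    refine (hmom.const_mul (K * M)).mono' ?_ (Filter.Eventually.of_forall fun y => ?_)
    · refine Continuous.aestronglyMeasurable ?_
      have := (hw l).differentiable.continuous
      have := hc j l
      fun_prop
    · have h1 := (hw l).norm_sub_le (p' := p') x y
      have h2 : ‖pderiv (L.block j f) l y‖ ≤ M :=
        ((fderiv ℝ (L.block j f) y).le_opNorm _).trans (by simpa using hM y)
      rw [norm_mul, norm_mul]
      calc _ ≤ (K * ‖x - y‖) * M * ‖L.ker k (x - y)‖ := by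
            refine mul_le_mul_of_nonneg_right ?_ (norm_nonneg _)
            exact mul_le_mul h1 h2 (norm_nonneg _) ((norm_nonneg _).trans h1)
        _ = _ := by ring
  -- the `j`-th commutator is the difference between `u(x) · Δ_k ∇Δ_j f(x)`, which is nonzero for
  -- finitely many `j` only, and the pairing of `u · ∇Δ_j f` with the kernel of `Δ_k`
  have hblock : ∀ j, ∑ l, commConv (vcomp u l) (pderiv (L.block j f) l) (L.ker k) x
      = (∑ l, vcomp u l x * conv (L.ker k) (pderiv (L.block j f) l) x)
        - L.blockTransport u j f ⟨L.kernel k x, L.kernel_mem k x⟩ := by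
    intro j
    have e1 : L.blockTransport u j f ⟨L.kernel k x, L.kernel_mem k x⟩
        = ∑ l, ∫ y, vcomp u l y * pderiv (L.block j f) l y * L.ker k (x - y) := by
      rw [blockTransport, ← integral_finsetSum]
      · refine integral_congr_ae (Filter.Eventually.of_forall fun y => ?_)
        simp only [clm_apply_eq_sum (fderiv ℝ (L.block j f) y) (u y), Finset.sum_mul, kernel_eq]
        rfl
      · intro l _
        have := ((hint1 j l).const_mul (vcomp u l x)).sub (hint2 j l)
        refine this.congr (Filter.Eventually.of_forall fun y => ?_)
        simp only [Pi.sub_apply]; ring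
    rw [e1, ← Finset.sum_sub_distrib]
    refine Finset.sum_congr rfl fun l _ => ?_
    have h3 : Integrable (fun y => vcomp u l y * pderiv (L.block j f) l y * L.ker k (x - y))
        volume := by
      have := ((hint1 j l).const_mul (vcomp u l x)).sub (hint2 j l)
      refine this.congr (Filter.Eventually.of_forall fun y => ?_)
      simp only [Pi.sub_apply]; ring
    rw [commConv, conv, ← integral_const_mul, ← integral_sub ?_ h3]
    · refine integral_congr_ae (Filter.Eventually.of_forall fun y => ?_)
      ring
    · refine ((hint1 j l).const_mul (vcomp u l x)).congr (Filter.Eventually.of_forall fun y => ?_)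
      ring
  have hfin : HasSum (fun j => ∑ l, vcomp u l x * conv (L.ker k) (pderiv (L.block j f) l) x)
      (fderiv ℝ (L.block k f) x (u x)) := by
    have h1 : ∑ j ∈ ({k - 1, k, k + 1} : Finset ℤ),
        ∑ l, vcomp u l x * conv (L.ker k) (pderiv (L.block j f) l) x
        = fderiv ℝ (L.block k f) x (u x) := by
      rw [Finset.sum_comm, clm_apply_eq_sum]
      refine Finset.sum_congr rfl fun l _ => ?_
      rw [← Finset.mul_sum]
      refine congrArg _ ?_
      have h2 : ∀ j, conv (L.ker k) (pderiv (L.block j f) l) x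
          = fderiv ℝ (conv (L.ker j) (L.block k f)) x (EuclideanSpace.single l 1) :=
        fun j => L.conv_ker_fderiv_block (hB j) k x _
      have hd : ∀ j, DifferentiableAt ℝ (conv (L.ker j) (L.block k f)) x := fun j =>
        (hasFDerivAt_conv (L.ker j) (L.continuous_block f k).aestronglyMeasurable
          (hB k) x).differentiableAt
      have h3 : L.block k f = fun x => conv (L.ker (k - 1)) (L.block k f) x
          + conv (L.ker k) (L.block k f) x + conv (L.ker (k + 1)) (L.block k f) x := by
        ext y; exact (L.sum_conv_ker_block f k (hB k) y).symm
      conv_rhs => rw [h3, fderiv_fun_add ((hd _).fun_add (hd _)) (hd _), fderiv_fun_add (hd _) (hd _)]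
      rw [Finset.sum_insert (by simp; omega), Finset.sum_pair (by omega)]
      simp only [h2, add_apply]
      ring
    rw [← h1]
    refine hasSum_sum_of_ne_finset_zero fun j hj => ?_
    simp only [Finset.mem_insert, Finset.mem_singleton, not_or] at hj
    refine Finset.sum_eq_zero fun l _ => ?_
    rw [conv_ker_pderiv_block_eq_zero (hB j) (by omega), mul_zero]
  simp only [hblock]
  rw [commutator, transport]
  exact (hfin.sub hs.hasSum).tsum_eq.symm

theorem measurable_commConv {w c : Space N → ℂ} (hw : Continuous w) (hc : Continuous c)
    (H : 𝓢(Space N, ℂ)) : Measurable (commConv w c H) := by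
  have h : Continuous (Function.uncurry fun x y => (w x - w y) * c y * H (x - y)) := by
    simp only [Function.uncurry_def]
    fun_prop
  exact (h.stronglyMeasurable.integral_prod_right (ν := volume)).measurable

variable (L) in
/-- The weighted commutator estimate. Summation over `k` turns the decay in `|k - j|` and the
factors `gradWindow` into constants times the norm of `∇u`. -/
theorem exists_tsum_commutator_le {p' : ℝ≥0∞} [p'.HolderConjugate p] (hp : 1 ≤ p)
    (hp' : p ≠ ∞) {q q' : ℝ≥0∞} [q.HolderConjugate q'] (hpq : p ≤ q) (hqp : q' ≤ p) {s : ℝ}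
    (hs : s ≤ N * (1 / p).toReal) (hε : 0 < s + N * (1 / q).toReal) :
    ∃ C : ℝ≥0∞, C ≠ ∞ ∧ ∀ (Ω : ℤ → ℝ≥0∞) (u : Space N → Space N) (f : ZDual N),
      IsSlowWeight Ω → L.HasRealizedGradient u →
      L.gradBesovNorm ((N : ℝ) * (1 / p).toReal) p u ≠ ∞ →
      (∀ j, eLpNorm (L.block j f) p volume ≠ ∞) →
      (∀ ψ, Summable fun j => L.blockTransport u j f ψ) →
      ∑' k : ℤ, 2 ^ ((k : ℝ) * s) * Ω k * eLpNorm (L.commutator u f k) p volume ≤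
        C * L.gradBesovNorm ((N : ℝ) * (1 / p).toReal) p u *
          ∑' j : ℤ, 2 ^ ((j : ℝ) * s) * Ω j * eLpNorm (L.block j f) p volume := by
  obtain ⟨C, hC, hCb⟩ := L.exists_weighted_commConv_le (p' := p') hp hp' hpq hqp hs hε le_rfl
  set ε := s + N * (1 / q).toReal
  set E := ∑' n : ℤ, (2 : ℝ≥0∞) ^ (-(ε * |(n : ℝ)|)) with hE
  refine ⟨C * (E + 7), ENNReal.mul_ne_top hC (ENNReal.add_ne_top.2
    ⟨tsum_two_rpow_neg_abs_ne_top hε, by norm_num⟩), ?_⟩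
  intro Ω u f hΩ hu hfin hf hs
  have hw := fun l => isRealized_vcomp hu hfin l
  have hnorm : ∀ k, eLpNorm (L.commutator u f k) p volume ≤
      ∑' j, ∑ l, eLpNorm (commConv (vcomp u l) (pderiv (L.block j f) l) (L.ker k)) p volume := by
    intro k
    have hm : ∀ j l, Measurable (commConv (vcomp u l) (pderiv (L.block j f) l) (L.ker k)) := by
      intro j l
      obtain ⟨B, hB⟩ := L.exists_norm_block_le (p' := p') f j (hf j)
      exact measurable_commConv (hw l).differentiable.continuous
        (L.continuous_fderiv_block hB _) _
    have h1 := eLpNorm_le_lintegral_eLpNorm (μ := (volume : Measure (Space N)))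
      (ν := (Measure.count : Measure ℤ)) (p := p) (R := L.commutator u f k)
      (F := fun j x => ∑ l, commConv (vcomp u l) (pderiv (L.block j f) l) (L.ker k) x)
      (by
        refine Measurable.aemeasurable ?_
        refine measurable_from_prod_countable_left fun j => ?_
        exact (Finset.measurable_fun_sum _ fun l _ => hm j l).enorm) hp hp'
      (Filter.Eventually.of_forall fun x => by
        rw [commutator_eq_tsum (p' := p') hw hf (hs _), lintegral_count]
        exact enorm_tsum_le_tsum_enorm)
    rw [lintegral_count] at h1
    refine h1.trans (ENNReal.tsum_le_tsum fun j => ?_)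
    have := eLpNorm_sum_le (μ := (volume : Measure (Space N))) (p := p) (s := Finset.univ)
      (f := fun l => commConv (vcomp u l) (pderiv (L.block j f) l) (L.ker k))
      (fun l _ => (hm j l).aestronglyMeasurable) hp
    refine le_trans (le_of_eq ?_) this
    congr 1
    ext x
    simp
  set A : ℤ → ℝ≥0∞ := fun j => 2 ^ ((j : ℝ) * s) * Ω j * eLpNorm (L.block j f) p volume with hA
  calc ∑' k : ℤ, 2 ^ ((k : ℝ) * s) * Ω k * eLpNorm (L.commutator u f k) p volume
      ≤ ∑' k : ℤ, ∑' j : ℤ, ∑ l, C * ((∑' n, L.gradBlock p (vcomp u l) n) *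
          2 ^ (-(ε * |((k - j : ℤ) : ℝ)|)) + L.gradWindow p (vcomp u l) k) * A j := by
        refine ENNReal.tsum_le_tsum fun k => ?_
        refine (mul_le_mul_right (hnorm k) _).trans ?_
        rw [← ENNReal.tsum_mul_left]
        refine ENNReal.tsum_le_tsum fun j => ?_
        rw [Finset.mul_sum]
        exact Finset.sum_le_sum fun l _ => hCb Ω (vcomp u l) f j k l hΩ (hw l) (hf j)
    _ = ∑' j : ℤ, ∑ l, C * ((∑' n, L.gradBlock p (vcomp u l) n) * E +
          7 * ∑' n, L.gradBlock p (vcomp u l) n) * A j := by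
        rw [ENNReal.tsum_comm]
        refine tsum_congr fun j => ?_
        rw [Summable.tsum_finsetSum fun _ _ => ENNReal.summable]
        refine Finset.sum_congr rfl fun l _ => ?_
        rw [ENNReal.tsum_mul_right, ENNReal.tsum_mul_left, ENNReal.tsum_add, tsum_gradWindow,
          ENNReal.tsum_mul_left, hE]
        congr 4
        exact (Equiv.subRight j).tsum_eq (fun n : ℤ => (2 : ℝ≥0∞) ^ (-(ε * |(n : ℝ)|)))
    _ = _ := by
        rw [← ENNReal.tsum_mul_left, gradBesovNorm_eq hu.differentiable]
        refine tsum_congr fun j => ?_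
        rw [Finset.mul_sum, Finset.sum_mul]
        refine Finset.sum_congr rfl fun l _ => ?_
        ring

end LittlewoodPaley

end commutatorSum

/-! ### The `L^p` estimate for transport equations -/

section transportEstimate

variable {N : ℕ}

/-- The volume is a multiple of the Hausdorff measure, for which the bound is that of a Lipschitz
image. -/
theorem AntilipschitzWith.volume_preimage_le {Φ : Space N → Space N} {K : NNReal}
    (hΦ : AntilipschitzWith K Φ) (s : Set (Space N)) :
    volume (Φ ⁻¹' s) ≤ (K : ℝ≥0∞) ^ (N : ℝ) * volume s := by
  have hH : (Measure.hausdorffMeasure (N : ℝ) : Measure (Space N)).IsAddHaarMeasure := by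
    have := isAddHaarMeasure_hausdorffMeasure (E := Space N)
    rwa [finrank_euclideanSpace_fin] at this
  have h1 := Measure.isAddLeftInvariant_eq_smul (volume : Measure (Space N))
    (Measure.hausdorffMeasure (N : ℝ))
  have h2 := hΦ.hausdorffMeasure_preimage_le (Nat.cast_nonneg N) s
  rw [h1]
  simp only [Measure.smul_apply]
  rw [ENNReal.smul_def, ENNReal.smul_def, smul_eq_mul, smul_eq_mul, mul_left_comm]
  gcongr

/-- Composition with an expanding map, up to a factor `K⁻¹`, in `L^p`. -/
theorem eLpNorm_comp_le_of_antilipschitz {Φ : Space N → Space N} (hc : Continuous Φ) {K : NNReal}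
    (hK : 1 ≤ K) (hΦ : AntilipschitzWith K Φ) {S S' : Set (Space N)}
    (hm : MapsTo Φ S S') {g : Space N → ℂ} (hg : Continuous g) {p : ℝ≥0∞}
    (hp : 1 ≤ p) :
    eLpNorm (fun x => g (Φ x)) p (volume.restrict S) ≤
      (K : ℝ≥0∞) ^ (N : ℝ) * eLpNorm g p (volume.restrict S') := by
  have h1 : (volume.restrict S).map Φ ≤ ((K : ℝ≥0∞) ^ (N : ℝ)) • volume.restrict S' := by
    refine Measure.le_iff.2 fun A hA => ?_
    rw [Measure.map_apply hc.measurable hA, Measure.smul_apply, Measure.restrict_apply hA,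
      Measure.restrict_apply (hc.measurable hA), smul_eq_mul]
    refine (measure_mono ?_).trans (hΦ.volume_preimage_le (A ∩ S'))
    exact fun x hx => ⟨hx.1, hm hx.2⟩
  have hK' : (1 : ℝ≥0∞) ≤ (K : ℝ≥0∞) ^ (N : ℝ) :=
    by
    rw [ENNReal.rpow_natCast]
    exact one_le_pow₀ (by exact_mod_cast hK)
  have h2 : eLpNorm (g ∘ Φ) p (volume.restrict S) = eLpNorm g p ((volume.restrict S).map Φ) :=
    (eLpNorm_map_measure hg.aestronglyMeasurable hc.aemeasurable).symm
  change eLpNorm (g ∘ Φ) p _ ≤ _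
  rw [h2]
  refine (eLpNorm_mono_measure g h1).trans ?_
  rw [eLpNorm_smul_measure_of_ne_zero (zero_lt_one.trans_le hK').ne', smul_eq_mul]
  gcongr
  refine (ENNReal.rpow_le_rpow_of_exponent_le hK' (z := 1) ?_).trans_eq (ENNReal.rpow_one _)
  have : 1 / p ≤ 1 := by rw [one_div]; exact ENNReal.inv_le_one.2 hp
  simpa using ENNReal.toReal_mono ENNReal.one_ne_top this

/-- A solution `a` of `∂_t a + v · ∇a = F` on `[0, T]`, for a vector field `v(τ)` with Lipschitz
constant `m(τ)`. The solution is of class `C¹` in space with a jointly continuous gradient, and the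
equation holds pointwise in space and integrated in time. -/
structure IsLipschitzTransport (T : ℝ) (v : ℝ → Space N → Space N) (m : ℝ → ℝ)
    (F a : ℝ → Space N → ℂ) : Prop where
  nonneg : ∀ τ, 0 ≤ m τ
  integrable_lip : IntervalIntegrable m volume 0 T
  lip : ∀ᵐ τ ∂volume.restrict (Ioc 0 T), ∀ x y, ‖v τ x - v τ y‖ ≤ m τ * ‖x - y‖
  integrable_field : ∀ x, IntervalIntegrable (fun τ => v τ x) volume 0 T
  integrable_source : ∀ x, IntervalIntegrable (fun τ => F τ x) volume 0 T
  measurable_source : AEStronglyMeasurable (fun z : ℝ × Space N => F z.1 z.2)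
    ((volume.restrict (Ioc 0 T)).prod volume)
  differentiable : ∀ τ ∈ Icc 0 T, Differentiable ℝ (a τ)
  continuousOn : ContinuousOn (fun z : ℝ × Space N => fderiv ℝ (a z.1) z.2) (Icc 0 T ×ˢ univ)
  equation : ∀ t ∈ Icc 0 T, ∀ x,
    a t x = a 0 x + ∫ τ in (0 : ℝ)..t, (F τ x - fderiv ℝ (a τ) x (v τ x))

/-- The ball `1 + |x| ≤ ρ`. A field which is bounded by a multiple of `1 + |x|` changes the radius
`ρ` by a factor. -/
def shiftedBall (N : ℕ) (ρ : ℝ) : Set (Space N) := {x | 1 + ‖x‖ ≤ ρ}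

theorem measurableSet_shiftedBall (ρ : ℝ) : MeasurableSet (shiftedBall N ρ) :=
  (isClosed_le (by fun_prop) continuous_const).measurableSet

theorem shiftedBall_subset (ρ : ℝ) : shiftedBall N ρ ⊆ Metric.closedBall 0 ρ := fun x hx => by
  simp only [shiftedBall, mem_ofPred_eq] at hx
  simp; linarith

namespace IsLipschitzTransport

variable {T : ℝ} {v : ℝ → Space N → Space N} {m : ℝ → ℝ} {F a : ℝ → Space N → ℂ}

/-- A bound for the growth of the vector field: `|v(τ, x)| ≤ growth(τ) (1 + |x|)`. -/
def growth (v : ℝ → Space N → Space N) (m : ℝ → ℝ) (τ : ℝ) : ℝ := m τ + ‖v τ 0‖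

theorem uIcc_subset_uIcc {s t : ℝ} (hs : 0 ≤ s) (hst : s ≤ t)
    (ht : t ≤ T) : uIcc s t ⊆ uIcc 0 T := by
  rw [uIcc_of_le hst, uIcc_of_le (by linarith)]
  exact Icc_subset_Icc hs ht

theorem integrable_growth (h : IsLipschitzTransport T v m F a) :
    IntervalIntegrable (growth v m) volume 0 T :=
  h.integrable_lip.add (h.integrable_field 0).norm

theorem growth_nonneg (h : IsLipschitzTransport T v m F a) (τ : ℝ) : 0 ≤ growth v m τ :=
  add_nonneg (h.nonneg τ) (norm_nonneg _)

theorem norm_field_le (h : IsLipschitzTransport T v m F a) :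
    ∀ᵐ τ ∂volume.restrict (Ioc 0 T), ∀ x, ‖v τ x‖ ≤ growth v m τ * (1 + ‖x‖) := by
  filter_upwards [h.lip] with τ hτ x
  have h1 := hτ x 0
  have h2 := norm_add_le (v τ x - v τ 0) (v τ 0)
  rw [sub_add_cancel] at h2
  rw [sub_zero] at h1
  rw [growth]
  nlinarith [h.nonneg τ, norm_nonneg (v τ 0), norm_nonneg x,
    mul_nonneg (norm_nonneg (v τ 0)) (norm_nonneg x)]

theorem ae_restrict_Ioc {P : ℝ → Prop}
    (hP : ∀ᵐ τ ∂volume.restrict (Ioc 0 T), P τ) {s t : ℝ} (hs : 0 ≤ s) (ht : t ≤ T) :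
    ∀ᵐ τ ∂volume.restrict (Ioc s t), P τ :=
  ae_restrict_of_ae_restrict_of_subset (Ioc_subset_Ioc hs ht) hP

theorem integrable_advection (h : IsLipschitzTransport T v m F a) (hT : 0 ≤ T) (x : Space N) :
    IntervalIntegrable (fun τ => fderiv ℝ (a τ) x (v τ x)) volume 0 T := by
  have hc : ContinuousOn (fun τ => fderiv ℝ (a τ) x) (Icc 0 T) :=
    h.continuousOn.comp (f := fun τ : ℝ => (τ, x)) (by fun_prop) fun τ hτ => ⟨hτ, mem_univ _⟩
  obtain ⟨M, hM⟩ := isCompact_Icc.exists_bound_of_continuousOn hc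
  have hv := (intervalIntegrable_iff_integrableOn_Ioc_of_le hT).1 (h.integrable_field x)
  rw [intervalIntegrable_iff_integrableOn_Ioc_of_le hT]
  refine Integrable.mono' (hv.norm.const_mul M) ?_ ?_
  · have h1 : AEStronglyMeasurable (fun τ => fderiv ℝ (a τ) x) (volume.restrict (Ioc 0 T)) :=
      (hc.mono Ioc_subset_Icc_self).aestronglyMeasurable measurableSet_Ioc
    exact ContinuousLinearMap.aestronglyMeasurable_comp₂ (ContinuousLinearMap.id ℝ _) h1 hv.1
  · filter_upwards [ae_restrict_mem measurableSet_Ioc] with τ hτ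
    exact ((fderiv ℝ (a τ) x).le_opNorm _).trans
      (mul_le_mul_of_nonneg_right (hM τ (Ioc_subset_Icc_self hτ)) (norm_nonneg _))

/-- The displacement over `[s, t]` along a straight characteristic: the position `x` is frozen in
the field. -/
def displacement (v : ℝ → Space N → Space N) (s t : ℝ) (x : Space N) : Space N :=
  ∫ τ in s..t, v τ x

section step

variable {s t : ℝ}

theorem norm_displacement_sub_le (h : IsLipschitzTransport T v m F a)
    (hs : 0 ≤ s) (hst : s ≤ t) (ht : t ≤ T) (x y : Space N) :
    ‖displacement v s t x - displacement v s t y‖ ≤ (∫ τ in s..t, m τ) * ‖x - y‖ := by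
  have hsub := uIcc_subset_uIcc hs hst ht
  rw [displacement, displacement, ← intervalIntegral.integral_sub
    ((h.integrable_field x).mono_set hsub) ((h.integrable_field y).mono_set hsub),
    ← intervalIntegral.integral_mul_const]
  refine intervalIntegral.norm_integral_le_of_norm_le hst ?_
    ((h.integrable_lip.mono_set hsub).mul_const _)
  have := ae_restrict_Ioc h.lip hs ht
  rw [ae_restrict_iff' measurableSet_Ioc] at this
  filter_upwards [this] with τ hτ hmem using hτ hmem x y

theorem integral_norm_field_le (h : IsLipschitzTransport T v m F a)
    (hs : 0 ≤ s) (hst : s ≤ t) (ht : t ≤ T) (x : Space N) :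
    ∫ τ in s..t, ‖v τ x‖ ≤ (∫ τ in s..t, growth v m τ) * (1 + ‖x‖) := by
  have hsub := uIcc_subset_uIcc hs hst ht
  rw [← intervalIntegral.integral_mul_const]
  refine intervalIntegral.integral_mono_ae_restrict hst ((h.integrable_field x).mono_set hsub).norm
    ((h.integrable_growth.mono_set hsub).mul_const _) ?_
  have h1 := ae_restrict_Ioc h.norm_field_le hs ht
  rw [Filter.EventuallyLE, restrict_Ioc_eq_restrict_Icc.symm]
  filter_upwards [h1] with τ hτ using hτ x

theorem norm_displacement_le (h : IsLipschitzTransport T v m F a)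
    (hs : 0 ≤ s) (hst : s ≤ t) (ht : t ≤ T) (x : Space N) :
    ‖displacement v s t x‖ ≤ (∫ τ in s..t, growth v m τ) * (1 + ‖x‖) :=
  (intervalIntegral.norm_integral_le_integral_norm hst).trans (h.integral_norm_field_le hs hst ht x)

theorem antilipschitz_sub_displacement (h : IsLipschitzTransport T v m F a)
    (hs : 0 ≤ s) (hst : s ≤ t) (ht : t ≤ T) (hδ : ∫ τ in s..t, m τ ≤ 1 / 2) :
    AntilipschitzWith (Real.toNNReal (1 - ∫ τ in s..t, m τ)⁻¹)
      (fun x => x - displacement v s t x) := by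
  refine AntilipschitzWith.of_le_mul_dist fun x y => ?_
  have h1 := h.norm_displacement_sub_le hs hst ht x y
  have hpos : (0 : ℝ) < 1 - ∫ τ in s..t, m τ := by linarith
  rw [Real.coe_toNNReal _ (by positivity), dist_eq_norm, dist_eq_norm, inv_mul_eq_div,
    le_div_iff₀ hpos]
  have h2 := norm_add_le (x - displacement v s t x - (y - displacement v s t y))
    (displacement v s t x - displacement v s t y)
  rw [show x - displacement v s t x - (y - displacement v s t y) +
    (displacement v s t x - displacement v s t y) = x - y by abel] at h2
  linarith

theorem continuous_sub_displacement (h : IsLipschitzTransport T v m F a)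
    (hs : 0 ≤ s) (hst : s ≤ t) (ht : t ≤ T) : Continuous (fun x => x - displacement v s t x) := by
  refine continuous_id.sub ?_
  have h0 : 0 ≤ ∫ τ in s..t, m τ := intervalIntegral.integral_nonneg hst fun τ _ => h.nonneg τ
  refine (LipschitzWith.of_dist_le_mul (K := Real.toNNReal (∫ τ in s..t, m τ))
    fun x y => ?_).continuous
  rw [Real.coe_toNNReal _ h0, dist_eq_norm, dist_eq_norm]
  exact h.norm_displacement_sub_le hs hst ht x y

/-- Consistency error of a step along straight characteristics. -/
theorem norm_step_error_le (h : IsLipschitzTransport T v m F a)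
    (hs : 0 ≤ s) (hst : s ≤ t) (ht : t ≤ T) {ρ ε δ : ℝ} (hε : 0 ≤ ε)
    (hosc : ∀ τ ∈ Icc (0 : ℝ) T, ∀ τ' ∈ Icc (0 : ℝ) T, ∀ x ∈ Metric.closedBall (0 : Space N) ρ,
      ∀ x' ∈ Metric.closedBall (0 : Space N) ρ, |τ - τ'| < δ → ‖x - x'‖ < δ →
      ‖fderiv ℝ (a τ) x - fderiv ℝ (a τ') x'‖ ≤ ε)
    (hstδ : t - s < δ) (hgr : (∫ τ in s..t, growth v m τ) * ρ < δ) {x : Space N}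
    (hx : (1 + ∫ τ in s..t, growth v m τ) * (1 + ‖x‖) ≤ ρ) :
    ‖a t x - a s (x - displacement v s t x) - ∫ τ in s..t, F τ x‖ ≤
      2 * ε * ρ * ∫ τ in s..t, growth v m τ := by
  have hT : 0 ≤ T := by linarith
  have hsub := uIcc_subset_uIcc hs hst ht
  have hsT : s ∈ Icc 0 T := ⟨hs, by linarith⟩
  have htT : t ∈ Icc 0 T := ⟨by linarith, ht⟩
  set β := ∫ τ in s..t, growth v m τ with hβ
  have hβ0 : 0 ≤ β := intervalIntegral.integral_nonneg hst fun τ _ => h.growth_nonneg τ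
  set d := displacement v s t x with hd
  have hx1 : 1 + ‖x‖ ≤ ρ := by nlinarith [norm_nonneg x]
  have hdn : ‖d‖ ≤ β * ρ := (h.norm_displacement_le hs hst ht x).trans
    (mul_le_mul_of_nonneg_left hx1 hβ0)
  have hxb : x ∈ Metric.closedBall (0 : Space N) ρ := by simp; linarith
  have hxdb : x - d ∈ Metric.closedBall (0 : Space N) ρ := by
    have h1 := norm_sub_le x d
    have h2 := h.norm_displacement_le hs hst ht x
    simp only [mem_closedBall_zero_iff]
    nlinarith
  have hseg : segment ℝ x (x - d) ⊆ Metric.closedBall (0 : Space N) ρ :=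
    (convex_closedBall _ _).segment_subset hxb hxdb
  -- Taylor expansion in space
  have e1 : ‖a s (x - d) - a s x - fderiv ℝ (a s) x (x - d - x)‖ ≤ ε * ‖x - d - x‖ := by
    refine Convex.norm_image_sub_le_of_norm_hasFDerivWithin_le' (𝕜 := ℝ) (s := segment ℝ x (x - d))
      (fun z _ => ((h.differentiable s hsT) z).hasFDerivAt.hasFDerivWithinAt) (fun z hz => ?_)
      (convex_segment _ _) (left_mem_segment _ _ _) (right_mem_segment _ _ _)
    refine hosc s hsT s hsT z (hseg hz) x hxb (by simp; linarith) ?_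
    have := norm_sub_le_of_mem_segment hz
    rw [sub_sub_cancel_left, norm_neg] at this
    exact this.trans_lt (hdn.trans_lt hgr)
  -- oscillation in time
  have hadv := (h.integrable_advection hT x).mono_set hsub
  have hfield := (h.integrable_field x).mono_set hsub
  have e2 : ‖(∫ τ in s..t, fderiv ℝ (a τ) x (v τ x)) - fderiv ℝ (a s) x d‖ ≤ ε * (β * ρ) := by
    have h1 : fderiv ℝ (a s) x d = ∫ τ in s..t, fderiv ℝ (a s) x (v τ x) :=
      ((fderiv ℝ (a s) x).intervalIntegral_comp_comm hfield).symm
    have h2 : IntervalIntegrable (fun τ => fderiv ℝ (a s) x (v τ x)) volume s t :=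
      ⟨(fderiv ℝ (a s) x).integrable_comp hfield.1, (fderiv ℝ (a s) x).integrable_comp hfield.2⟩
    rw [h1, ← intervalIntegral.integral_sub hadv h2]
    refine (intervalIntegral.norm_integral_le_of_norm_le hst (g := fun τ => ε * ‖v τ x‖)
      (Filter.Eventually.of_forall fun τ hτ => ?_) (hfield.norm.const_mul ε)).trans ?_
    · rw [← sub_apply]
      refine (ContinuousLinearMap.le_opNorm _ _).trans
        (mul_le_mul_of_nonneg_right ?_ (norm_nonneg _))
      refine hosc τ ⟨by linarith [hτ.1], by linarith [hτ.2]⟩ s hsT x hxb x hxb ?_ ?_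
      · rw [abs_of_nonneg (by linarith [hτ.1])]; linarith [hτ.2]
      · simp; linarith
    · rw [intervalIntegral.integral_const_mul]
      refine mul_le_mul_of_nonneg_left ?_ hε
      exact (h.integral_norm_field_le hs hst ht x).trans (mul_le_mul_of_nonneg_left hx1 hβ0)
  have hF := (h.integrable_source x)
  have e3 : a t x = a s x + (∫ τ in s..t, F τ x) - ∫ τ in s..t, fderiv ℝ (a τ) x (v τ x) := by
    have hi : IntervalIntegrable (fun τ => F τ x - fderiv ℝ (a τ) x (v τ x)) volume 0 T :=
      hF.sub (h.integrable_advection hT x)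
    have h1 := intervalIntegral.integral_add_adjacent_intervals
      (hi.mono_set (uIcc_subset_uIcc le_rfl hs (by linarith))) (hi.mono_set hsub)
    have h2 := intervalIntegral.integral_sub (hF.mono_set hsub) hadv
    rw [h.equation t htT x, h.equation s hsT x, ← h1, h2]
    ring
  have e4 : a t x - a s (x - d) - ∫ τ in s..t, F τ x
      = -(a s (x - d) - a s x - fderiv ℝ (a s) x (x - d - x))
        - ((∫ τ in s..t, fderiv ℝ (a τ) x (v τ x)) - fderiv ℝ (a s) x d) := by
    rw [e3, sub_sub_cancel_left, map_neg]
    ring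
  rw [e4]
  refine (norm_sub_le _ _).trans ?_
  rw [norm_neg]
  have hn : ‖x - d - x‖ = ‖d‖ := by rw [sub_sub_cancel_left, norm_neg]
  rw [hn] at e1
  have := mul_le_mul_of_nonneg_left hdn hε
  linarith

end step

end IsLipschitzTransport

end transportEstimate

section transportEstimate2

variable {N : ℕ}

namespace IsLipschitzTransport

variable {T : ℝ} {v : ℝ → Space N → Space N} {m : ℝ → ℝ} {F a : ℝ → Space N → ℂ} {s t : ℝ}

theorem inv_one_sub_le_exp {δ : ℝ} (h0 : 0 ≤ δ) (h1 : δ ≤ 1 / 2) : (1 - δ)⁻¹ ≤ Real.exp (2 * δ) := by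
  have h2 := Real.add_one_le_exp (2 * δ)
  refine le_trans ?_ h2
  rw [inv_eq_one_div, div_le_iff₀ (by linarith)]
  nlinarith

/-- One step of the scheme along straight characteristics: the solution at time `t` is its value at
time `s` composed with an antilipschitz map, plus the source, plus a consistency error, which is
small because the gradient of the solution oscillates by at most `ε` during the step. -/
theorem eLpNorm_step_le (h : IsLipschitzTransport T v m F a)
    (hs : 0 ≤ s) (hst : s ≤ t) (ht : t ≤ T) {ρ ε δ : ℝ} (hε : 0 ≤ ε)
    (hosc : ∀ τ ∈ Icc (0 : ℝ) T, ∀ τ' ∈ Icc (0 : ℝ) T, ∀ x ∈ Metric.closedBall (0 : Space N) ρ,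
      ∀ x' ∈ Metric.closedBall (0 : Space N) ρ, |τ - τ'| < δ → ‖x - x'‖ < δ →
      ‖fderiv ℝ (a τ) x - fderiv ℝ (a τ') x'‖ ≤ ε)
    (hstδ : t - s < δ) (hgr : (∫ τ in s..t, growth v m τ) * ρ < δ)
    (hlip : ∫ τ in s..t, m τ ≤ 1 / 2) {r r' : ℝ}
    (hr : (1 + ∫ τ in s..t, growth v m τ) * r ≤ r') (hr' : r' ≤ ρ) {p : ℝ≥0∞} (hp : 1 ≤ p)
    (hp' : p ≠ ∞) :
    eLpNorm (a t) p (volume.restrict (shiftedBall N r)) ≤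
      ENNReal.ofReal (Real.exp (2 * N * ∫ τ in s..t, m τ)) *
        eLpNorm (a s) p (volume.restrict (shiftedBall N r'))
      + (∫⁻ τ in Ioc s t, eLpNorm (F τ) p volume)
      + ENNReal.ofReal (∫ τ in s..t, growth v m τ) * (ENNReal.ofReal (2 * ε * ρ) *
        volume (Metric.closedBall (0 : Space N) ρ) ^ p.toReal⁻¹) := by
  have hT : 0 ≤ T := by linarith
  have hsT : s ∈ Icc 0 T := ⟨hs, by linarith⟩
  have htT : t ∈ Icc 0 T := ⟨by linarith, ht⟩
  set β := ∫ τ in s..t, growth v m τ with hβ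
  have hβ0 : 0 ≤ β := intervalIntegral.integral_nonneg hst fun τ _ => h.growth_nonneg τ
  set δm := ∫ τ in s..t, m τ with hδm
  have hδ0 : 0 ≤ δm := intervalIntegral.integral_nonneg hst fun τ _ => h.nonneg τ
  have hac : ∀ τ ∈ Icc 0 T, Continuous (a τ) := fun τ hτ => (h.differentiable τ hτ).continuous
  set Φ := fun x => x - displacement v s t x with hΦ
  have hΦc : Continuous Φ := h.continuous_sub_displacement hs hst ht
  have hball : ∀ x ∈ shiftedBall N r, (1 + β) * (1 + ‖x‖) ≤ r' := fun x hx =>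
    (mul_le_mul_of_nonneg_left hx (by linarith)).trans hr
  have hmaps : MapsTo Φ (shiftedBall N r) (shiftedBall N r') := by
    intro x hx
    have h1 := norm_sub_le x (displacement v s t x)
    have h2 := h.norm_displacement_le hs hst ht x
    have h3 := hball x hx
    change 1 + ‖x - displacement v s t x‖ ≤ r'
    linarith
  set I : Space N → ℂ := fun x => ∫ τ in s..t, F τ x with hI
  have hFm : AEStronglyMeasurable (fun z : Space N × ℝ => F z.2 z.1)
      (volume.prod (volume.restrict (Ioc s t))) := by
    have h1 : AEStronglyMeasurable (fun z : ℝ × Space N => F z.1 z.2)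
        ((volume.restrict (Ioc s t)).prod volume) :=
      h.measurable_source.mono_measure
        (Measure.prod_mono (Measure.restrict_mono (Ioc_subset_Ioc hs ht) le_rfl) le_rfl)
    exact h1.prod_swap
  have hIm : AEStronglyMeasurable I volume := by
    have : AEStronglyMeasurable (fun x => ∫ τ in Ioc s t, F τ x) volume :=
      hFm.integral_prod_right'
    refine this.congr (Filter.Eventually.of_forall fun x => ?_)
    rw [hI]
    exact (intervalIntegral.integral_of_le hst).symm
  set R : Space N → ℂ := fun x => a t x - a s (Φ x) - I x with hR
  have hdec : a t = fun x => a s (Φ x) + I x + R x := by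
    ext x; rw [hR]; ring
  have hm1 : AEStronglyMeasurable (fun x => a s (Φ x)) (volume.restrict (shiftedBall N r)) :=
    ((hac s hsT).comp hΦc).aestronglyMeasurable
  have hm3 : AEStronglyMeasurable R (volume.restrict (shiftedBall N r)) :=
    ((hac t htT).aestronglyMeasurable.sub hm1).sub hIm.restrict
  have hn1 : eLpNorm (fun x => a s (Φ x)) p (volume.restrict (shiftedBall N r)) ≤
      ENNReal.ofReal (Real.exp (2 * N * δm)) *
        eLpNorm (a s) p (volume.restrict (shiftedBall N r')) := by
    have hK : 1 ≤ Real.toNNReal (1 - δm)⁻¹ := by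
      rw [Real.one_le_toNNReal]
      exact (one_le_inv₀ (by linarith)).2 (by linarith)
    refine (eLpNorm_comp_le_of_antilipschitz hΦc hK
      (h.antilipschitz_sub_displacement hs hst ht hlip) hmaps (hac s hsT) hp).trans ?_
    gcongr
    rw [ENNReal.rpow_natCast]
    change ENNReal.ofReal (1 - δm)⁻¹ ^ N ≤ _
    rw [← ENNReal.ofReal_pow (inv_nonneg.2 (by linarith))]
    refine ENNReal.ofReal_le_ofReal ?_
    rw [show 2 * (N : ℝ) * δm = N * (2 * δm) by ring, Real.exp_nat_mul]
    exact pow_le_pow_left₀ (inv_nonneg.2 (by linarith)) (inv_one_sub_le_exp hδ0 hlip) N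
  have hn2 : eLpNorm I p (volume.restrict (shiftedBall N r)) ≤
      ∫⁻ τ in Ioc s t, eLpNorm (F τ) p volume := by
    refine (eLpNorm_mono_measure I Measure.restrict_le_self).trans ?_
    refine eLpNorm_le_lintegral_eLpNorm hFm.enorm hp hp' (Filter.Eventually.of_forall fun x => ?_)
    rw [hI]
    simp only
    rw [intervalIntegral.integral_of_le hst]
    exact enorm_integral_le_lintegral_enorm _
  have hn3 : eLpNorm R p (volume.restrict (shiftedBall N r)) ≤
      ENNReal.ofReal β * (ENNReal.ofReal (2 * ε * ρ) *
        volume (Metric.closedBall (0 : Space N) ρ) ^ p.toReal⁻¹) := by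
    rcases (shiftedBall N r).eq_empty_or_nonempty with he | ⟨x₀, hx₀⟩
    · rw [he]; simp
    have hρ0 : 0 ≤ ρ := by
      have := hball x₀ hx₀
      nlinarith [norm_nonneg x₀]
    have hrρ : r ≤ ρ := by
      have : (0 : ℝ) ≤ r := le_trans (by positivity) hx₀
      nlinarith
    refine (eLpNorm_le_of_ae_bound (C := 2 * ε * ρ * β) ?_).trans ?_
    · filter_upwards [ae_restrict_mem (measurableSet_shiftedBall r)] with x hx
      exact h.norm_step_error_le hs hst ht hε hosc hstδ hgr ((hball x hx).trans hr')
    · rw [ENNReal.ofReal_mul (by positivity), Measure.restrict_apply_univ, mul_comm, mul_comm _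
        (ENNReal.ofReal β), mul_assoc]
      gcongr
      exact (shiftedBall_subset r).trans (Metric.closedBall_subset_closedBall hrρ)
  rw [hdec]
  refine (eLpNorm_add_le (hm1.add hIm.restrict) hm3 hp).trans ?_
  exact add_le_add ((eLpNorm_add_le hm1 hIm.restrict hp).trans (add_le_add hn1 hn2)) hn3

/-- Subdivision: a transitive relation that holds on all short subintervals of `[0, t]` holds
on `[0, t]`. -/
theorem rel_of_short {t η : ℝ} (ht : 0 ≤ t) (hη : 0 < η) {Q : ℝ → ℝ → Prop}
    (htrans : ∀ x y z, 0 ≤ x → x ≤ y → y ≤ z → z ≤ t → Q x y → Q y z → Q x z)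
    (hshort : ∀ x y, 0 ≤ x → x ≤ y → y ≤ t → y - x ≤ η → Q x y) : Q 0 t := by
  obtain ⟨n, hn⟩ := exists_nat_gt (t / η)
  have hn0 : 0 < (n : ℝ) := lt_of_le_of_lt (by positivity) hn
  have hstep : t / n ≤ η := by
    rw [div_lt_iff₀ hη] at hn
    rw [div_le_iff₀ hn0]; linarith
  have hq : 0 ≤ t / n := by positivity
  have key : ∀ i : ℕ, i ≤ n → Q 0 (i * (t / n)) := by
    intro i
    induction i with
    | zero => intro _; exact hshort _ _ le_rfl (by simp) (by simpa using ht) (by simp; exact hη.le)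
    | succ i ih =>
      intro hi
      have h1 : ((i + 1 : ℕ) : ℝ) * (t / n) ≤ t := by
        have : ((i + 1 : ℕ) : ℝ) ≤ n := by exact_mod_cast hi
        calc ((i + 1 : ℕ) : ℝ) * (t / n) ≤ n * (t / n) := by gcongr
          _ = t := by field_simp
      have h2 : (i : ℝ) * (t / n) ≤ ((i + 1 : ℕ) : ℝ) * (t / n) := by
        push_cast; nlinarith
      have h0 : 0 ≤ (i : ℝ) * (t / n) := by positivity
      refine htrans _ _ _ le_rfl h0 h2 h1 (ih (by omega)) (hshort _ _ h0 h2 h1 ?_)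
      push_cast; linarith
  have := key n le_rfl
  rwa [mul_div_cancel₀ t hn0.ne'] at this

theorem lintegral_Ioc_add {α : ℝ → ℝ≥0∞} {x y z : ℝ} (hxy : x ≤ y) (hyz : y ≤ z) :
    ∫⁻ τ in Ioc x z, α τ = (∫⁻ τ in Ioc x y, α τ) + ∫⁻ τ in Ioc y z, α τ := by
  rw [← Ioc_union_Ioc_eq_Ioc hxy hyz, lintegral_union measurableSet_Ioc]
  exact Set.disjoint_left.2 fun τ h1 h2 => absurd h1.2 (not_le.2 h2.1)

/-- The `L^p` estimate for a transport equation with a Lipschitz vector field. Short steps are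
composed on shrinking balls. The sum of the consistency errors is a multiple of the oscillation `ε`
of the gradient, and tends to zero with the length of the steps; the radius of the balls then tends
to infinity. -/
theorem eLpNorm_le (h : IsLipschitzTransport T v m F a) (ht0 : 0 ≤ t) (ht : t ≤ T) {p : ℝ≥0∞}
    (hp : 1 ≤ p) (hp' : p ≠ ∞) :
    ENNReal.ofReal (Real.exp (-(2 * N * ∫ τ in (0 : ℝ)..t, m τ))) * eLpNorm (a t) p volume ≤
      eLpNorm (a 0) p volume + ∫⁻ τ in Ioc 0 t,
        ENNReal.ofReal (Real.exp (-(2 * N * ∫ σ in (0 : ℝ)..τ, m σ))) *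
          eLpNorm (F τ) p volume := by
  have hT : 0 ≤ T := ht0.trans ht
  set Λ : ℝ → ℝ := fun t => ∫ τ in (0 : ℝ)..t, m τ with hΛ
  set b := growth v m with hb
  set Γ : ℝ → ℝ := fun t => ∫ τ in (0 : ℝ)..t, b τ with hΓ
  set E : ℝ → ℝ≥0∞ := fun τ => ENNReal.ofReal (Real.exp (-(2 * N * Λ τ))) with hE
  have hΛadd : ∀ x y, 0 ≤ x → x ≤ y → y ≤ t → Λ y = Λ x + ∫ τ in x..y, m τ := by
    intro x y hx hxy hy
    exact (intervalIntegral.integral_add_adjacent_intervals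
      (h.integrable_lip.mono_set (uIcc_subset_uIcc le_rfl hx (by linarith)))
      (h.integrable_lip.mono_set (uIcc_subset_uIcc hx hxy (by linarith)))).symm
  have hΓadd : ∀ x y, 0 ≤ x → x ≤ y → y ≤ t → Γ y = Γ x + ∫ τ in x..y, b τ := by
    intro x y hx hxy hy
    exact (intervalIntegral.integral_add_adjacent_intervals
      (h.integrable_growth.mono_set (uIcc_subset_uIcc le_rfl hx (by linarith)))
      (h.integrable_growth.mono_set (uIcc_subset_uIcc hx hxy (by linarith)))).symm
  have hm0 : ∀ x y, x ≤ y → 0 ≤ ∫ τ in x..y, m τ := fun x y hxy =>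
    intervalIntegral.integral_nonneg hxy fun τ _ => h.nonneg τ
  have hb0 : ∀ x y, x ≤ y → 0 ≤ ∫ τ in x..y, b τ := fun x y hxy =>
    intervalIntegral.integral_nonneg hxy fun τ _ => h.growth_nonneg τ
  have hEanti : ∀ x y, 0 ≤ x → x ≤ y → y ≤ t → E y ≤ E x := by
    intro x y hx hxy hy
    refine ENNReal.ofReal_le_ofReal (Real.exp_le_exp.2 ?_)
    have := hΛadd x y hx hxy hy
    have := hm0 x y hxy
    have h3 : Λ x ≤ Λ y := by linarith
    have : (0 : ℝ) ≤ N := Nat.cast_nonneg N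
    nlinarith
  have hE1 : ∀ y, 0 ≤ y → y ≤ t → E y ≤ 1 := by
    intro y hy hyt
    refine (hEanti 0 y le_rfl hy hyt).trans ?_
    simp [hE, hΛ]
  have hcont : ∀ f : ℝ → ℝ, IntervalIntegrable f volume 0 T →
      UniformContinuousOn (fun t => ∫ τ in (0 : ℝ)..t, f τ) (Icc 0 T) := by
    intro f hf
    refine isCompact_Icc.uniformContinuousOn_of_continuous ?_
    have := intervalIntegral.continuousOn_primitive_interval' hf left_mem_uIcc
    rwa [uIcc_of_le hT] at this
  -- the estimate on a ball, up to a small error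
  have hball : ∀ R : ℝ, 0 ≤ R → ∃ K : ℝ≥0∞, K ≠ ∞ ∧ ∀ ε : ℝ, 0 < ε →
      E t * eLpNorm (a t) p (volume.restrict (shiftedBall N (1 + R))) ≤
        eLpNorm (a 0) p volume + (∫⁻ τ in Ioc 0 t, E τ * eLpNorm (F τ) p volume)
          + ENNReal.ofReal ε * K := by
    intro R hR
    -- the radii are such that a backward step from the ball at time `τ` ends in the earlier ball
    set rad : ℝ → ℝ := fun τ => (1 + R) * Real.exp (Γ t - Γ τ) with hrad
    set ρ := rad 0 with hρ
    have hρ1 : 1 ≤ ρ := by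
      have h1 : Γ 0 = 0 := by simp [hΓ]
      have h2 : 0 ≤ Γ t := hb0 0 t ht0
      have : 1 ≤ Real.exp (Γ t - Γ 0) := Real.one_le_exp (by linarith)
      rw [hρ, hrad]
      nlinarith
    set vol := volume (Metric.closedBall (0 : Space N) ρ) ^ p.toReal⁻¹ with hvol
    have hvolt : vol ≠ ∞ := ENNReal.rpow_ne_top_of_nonneg (by positivity)
      (measure_closedBall_lt_top).ne
    refine ⟨ENNReal.ofReal (Γ t) * (ENNReal.ofReal (2 * ρ) * vol),
      ENNReal.mul_ne_top ENNReal.ofReal_ne_top (ENNReal.mul_ne_top ENNReal.ofReal_ne_top hvolt),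
      fun ε hε => ?_⟩
    have hcpt : IsCompact (Icc (0 : ℝ) T ×ˢ Metric.closedBall (0 : Space N) ρ) :=
      isCompact_Icc.prod (isCompact_closedBall _ _)
    have huc := hcpt.uniformContinuousOn_of_continuous
      (h.continuousOn.mono (Set.prod_mono le_rfl (subset_univ _)))
    obtain ⟨δ, hδ0, hδ⟩ := Metric.uniformContinuousOn_iff.1 huc ε hε
    obtain ⟨η₁, hη₁, hη₁'⟩ := Metric.uniformContinuousOn_iff.1 (hcont _ h.integrable_growth)
      (δ / ρ) (by positivity)
    obtain ⟨η₂, hη₂, hη₂'⟩ := Metric.uniformContinuousOn_iff.1 (hcont _ h.integrable_lip)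
      (1 / 2) (by norm_num)
    have key := rel_of_short (t := t) (η := min (δ / 2) (min (η₁ / 2) (η₂ / 2))) ht0 (by positivity)
      (Q := fun x y => E y * eLpNorm (a y) p (volume.restrict (shiftedBall N (rad y))) ≤
        E x * eLpNorm (a x) p (volume.restrict (shiftedBall N (rad x)))
        + (∫⁻ τ in Ioc x y, E τ * eLpNorm (F τ) p volume)
        + ENNReal.ofReal (∫ τ in x..y, b τ) * (ENNReal.ofReal (2 * ε * ρ) * vol)) ?_ ?_
    · have h0 : E 0 = 1 := by simp [hE, hΛ]
      have ht1 : rad t = 1 + R := by simp [hrad]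
      rw [h0, one_mul, ht1] at key
      refine key.trans ?_
      refine add_le_add (add_le_add (eLpNorm_mono_measure _ Measure.restrict_le_self) le_rfl)
        (le_of_eq ?_)
      rw [show 2 * ε * ρ = ε * (2 * ρ) by ring, ENNReal.ofReal_mul hε.le]
      ring
    · intro x y z hx hxy hyz hz h1 h2
      refine h2.trans ?_
      rw [lintegral_Ioc_add hxy hyz]
      have e1 : ∫ τ in x..z, b τ = (∫ τ in x..y, b τ) + ∫ τ in y..z, b τ := by
        have e1 := hΓadd x y hx hxy (by linarith)
        have e2 := hΓadd y z (by linarith) hyz hz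
        have e3 := hΓadd x z hx (by linarith) hz
        linarith
      rw [e1, ENNReal.ofReal_add (hb0 _ _ hxy) (hb0 _ _ hyz)]
      refine (add_le_add_left (add_le_add_left h1 _) _).trans_eq ?_
      ring
    · intro x y hx hxy hy hshort
      have hxy1 : y - x < δ := by
        have := hshort.trans (min_le_left _ _); linarith
      have hxy2 : y - x < η₁ := by
        have := hshort.trans ((min_le_right _ _).trans (min_le_left _ _)); linarith
      have hxy3 : y - x < η₂ := by
        have := hshort.trans ((min_le_right _ _).trans (min_le_right _ _)); linarith
      have hxT : x ∈ Icc 0 T := ⟨hx, by linarith⟩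
      have hyT : y ∈ Icc 0 T := ⟨by linarith, by linarith⟩
      have hdist : dist y x = y - x := by rw [Real.dist_eq, abs_of_nonneg (by linarith)]
      have hg := hη₁' y hyT x hxT (by rw [hdist]; exact hxy2)
      have hl := hη₂' y hyT x hxT (by rw [hdist]; exact hxy3)
      rw [Real.dist_eq] at hg hl
      have hg1 := hΓadd x y hx hxy hy
      have hl1 := hΛadd x y hx hxy hy
      have hg2 : ∫ τ in x..y, b τ < δ / ρ := by
        have := lt_of_le_of_lt (le_abs_self _) hg
        change Γ y - Γ x < _ at this
        linarith
      have hl2 : ∫ τ in x..y, m τ ≤ 1 / 2 := by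
        have := lt_of_le_of_lt (le_abs_self _) hl
        change Λ y - Λ x < _ at this
        linarith
      have hradx : (1 + ∫ τ in x..y, b τ) * rad y ≤ rad x := by
        rw [hrad]
        have e1 : Real.exp (Γ t - Γ x) = Real.exp (∫ τ in x..y, b τ) * Real.exp (Γ t - Γ y) := by
          rw [← Real.exp_add]; congr 1; linarith
        simp only [e1]
        have := Real.add_one_le_exp (∫ τ in x..y, b τ)
        calc _ = (1 + ∫ τ in x..y, b τ) * ((1 + R) * Real.exp (Γ t - Γ y)) := rfl
          _ ≤ Real.exp (∫ τ in x..y, b τ) * ((1 + R) * Real.exp (Γ t - Γ y)) := by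
              gcongr; linarith
          _ = _ := by ring
      have hradρ : rad x ≤ ρ := by
        rw [hρ, hrad]
        have e1 := hΓadd 0 x le_rfl hx (by linarith)
        have := hb0 0 x hx
        simp only
        gcongr
        linarith
      have hstep := h.eLpNorm_step_le hx hxy (by linarith) hε.le (ρ := ρ) (δ := δ)
        (fun τ hτ τ' hτ' z hz z' hz' h1 h2 => by
          have := hδ (τ, z) ⟨hτ, hz⟩ (τ', z') ⟨hτ', hz'⟩ (by
            rw [Prod.dist_eq, max_lt_iff, Real.dist_eq, dist_eq_norm]
            exact ⟨h1, h2⟩)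
          rw [dist_eq_norm] at this
          exact this.le) hxy1 (by rwa [← lt_div_iff₀ (by linarith)]) hl2 hradx hradρ hp hp'
      have hEE : E y * ENNReal.ofReal (Real.exp (2 * N * ∫ τ in x..y, m τ)) = E x := by
        rw [hE]
        simp only
        rw [← ENNReal.ofReal_mul (Real.exp_pos _).le, ← Real.exp_add, hl1]
        congr 2; ring
      have hEint : E y * ∫⁻ τ in Ioc x y, eLpNorm (F τ) p volume ≤
          ∫⁻ τ in Ioc x y, E τ * eLpNorm (F τ) p volume := by
        rw [← lintegral_const_mul' _ _ ENNReal.ofReal_ne_top]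
        refine setLIntegral_mono_ae' measurableSet_Ioc
          (Filter.Eventually.of_forall fun τ hτ => ?_)
        gcongr
        exact hEanti τ y (by linarith [hτ.1]) hτ.2 hy
      refine (mul_le_mul_right hstep _).trans ?_
      rw [mul_add, mul_add, ← mul_assoc, hEE]
      refine add_le_add (add_le_add le_rfl hEint) ?_
      exact mul_le_of_le_one_left zero_le (hE1 y (by linarith) hy)
  -- exhaust the space by balls
  have hR : ∀ R : ℝ, 0 ≤ R → E t * eLpNorm (a t) p (volume.restrict (shiftedBall N (1 + R))) ≤
      eLpNorm (a 0) p volume + ∫⁻ τ in Ioc 0 t, E τ * eLpNorm (F τ) p volume := by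
    intro R hR
    obtain ⟨K, hK, hKb⟩ := hball R hR
    refine ENNReal.le_of_forall_pos_le_add fun ε hε _ => ?_
    have hK1 : 0 < K.toReal + 1 := by positivity
    refine (hKb (ε / (K.toReal + 1)) (by positivity)).trans ?_
    gcongr
    nth_rewrite 2 [← ENNReal.ofReal_toReal hK]
    rw [← ENNReal.ofReal_mul (by positivity)]
    refine ENNReal.ofReal_le_of_le_toReal ?_
    rw [ENNReal.coe_toReal, div_mul_eq_mul_div, div_le_iff₀ hK1]
    have : (0 : ℝ) ≤ ε := ε.2
    nlinarith [ENNReal.toReal_nonneg (a := K)]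
  have hsup : eLpNorm (a t) p volume ≤
      ⨆ n : ℕ, eLpNorm (a t) p (volume.restrict (shiftedBall N (1 + n))) := by
    have hU : ⋃ n : ℕ, shiftedBall N (1 + n) = univ := by
      refine eq_univ_of_forall fun x => ?_
      obtain ⟨n, hn⟩ := exists_nat_ge ‖x‖
      exact mem_iUnion.2 ⟨n, by change 1 + ‖x‖ ≤ 1 + n; linarith⟩
    have hmono : Monotone fun n : ℕ => shiftedBall N (1 + n) := fun i j hij x hx => by
      have : (i : ℝ) ≤ j := by exact_mod_cast hij
      change 1 + ‖x‖ ≤ 1 + j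
      change 1 + ‖x‖ ≤ 1 + i at hx
      linarith
    have hp0 : p ≠ 0 := (zero_lt_one.trans_le hp).ne'
    have hr0 : 0 < p.toReal := ENNReal.toReal_pos hp0 hp'
    simp only [eLpNorm_eq_lintegral_rpow_enorm_toReal hp0 hp']
    have h1 : ∫⁻ x, ‖a t x‖ₑ ^ p.toReal = ⨆ n : ℕ, ∫⁻ x in shiftedBall N (1 + n),
        ‖a t x‖ₑ ^ p.toReal := by
      rw [← setLIntegral_univ, ← hU]
      exact setLIntegral_iUnion_of_directed _ hmono.directed_le
    rw [h1, (ENNReal.monotone_rpow_of_nonneg (by positivity)).map_iSup_of_continuousAt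
      (ENNReal.continuous_rpow_const.continuousAt) (by simp [hr0])]
  refine (mul_le_mul_right hsup _).trans ?_
  rw [ENNReal.mul_iSup]
  exact iSup_le fun n => hR n (Nat.cast_nonneg n)

end IsLipschitzTransport

end transportEstimate2

/-! ### Measurability of functions of time and space -/

section measurability

variable {α X E : Type*} [MeasurableSpace α] {μ : Measure α}

/-- A function which is almost everywhere measurable in the first variable for each value of the
second one, and continuous in the second variable for almost every value of the first one, is
almost everywhere measurable. -/
theorem aestronglyMeasurable_of_continuous_right [TopologicalSpace X]
    [TopologicalSpace.MetrizableSpace X] [SecondCountableTopology X] [MeasurableSpace X]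
    [OpensMeasurableSpace X] [Nonempty X] [TopologicalSpace E]
    [TopologicalSpace.PseudoMetrizableSpace E] [Zero E]
    {ν : Measure X} [SFinite ν] {u : α → X → E}
    (hu : ∀ x, AEStronglyMeasurable (fun a => u a x) μ) (hc : ∀ᵐ a ∂μ, Continuous (u a)) :
    AEStronglyMeasurable (fun z : α × X => u z.1 z.2) (μ.prod ν) := by
  obtain ⟨d, hd⟩ := TopologicalSpace.exists_dense_seq X
  have hgood : ∀ᵐ a ∂μ, (∀ n, u a (d n) = (hu (d n)).mk _ a) ∧ Continuous (u a) :=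
    (ae_all_iff.2 fun n => (hu (d n)).ae_eq_mk).and hc
  -- a measurable set of full measure on which both properties hold everywhere
  set G : Set α := (toMeasurable μ {a | ¬((∀ n, u a (d n) = (hu (d n)).mk _ a) ∧
    Continuous (u a))})ᶜ with hG
  have hGm : MeasurableSet G := (measurableSet_toMeasurable _ _).compl
  have hGae : ∀ᵐ a ∂μ, a ∈ G := by
    rw [ae_iff]
    simp only [hG, mem_compl_iff, not_not]
    exact (measure_toMeasurable _).trans hgood
  have hGp : ∀ a ∈ G, (∀ n, u a (d n) = (hu (d n)).mk _ a) ∧ Continuous (u a) := fun a ha => by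
    by_contra hcon
    exact ha (subset_toMeasurable _ _ hcon)
  set w : X → α → E := fun x => G.indicator fun a => u a x with hw
  have hwd : ∀ n, StronglyMeasurable (w (d n)) := fun n => by
    have : w (d n) = G.indicator ((hu (d n)).mk _) :=
      indicator_congr fun a ha => (hGp a ha).1 n
    rw [this]
    exact (hu (d n)).stronglyMeasurable_mk.indicator hGm
  have hwc : ∀ a, Continuous fun x => w x a := fun a => by
    by_cases ha : a ∈ G
    · simpa [hw, indicator_of_mem ha] using (hGp a ha).2
    · simpa [hw, indicator_of_notMem ha] using continuous_const
  have hwm : ∀ x, StronglyMeasurable (w x) := fun x => by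
    obtain ⟨y, hy, hyx⟩ := mem_closure_iff_seq_limit.1 (hd.closure_range ▸ mem_univ x)
    choose n hn using hy
    refine stronglyMeasurable_of_tendsto Filter.atTop (f := fun j => w (y j))
      (fun j => hn j ▸ hwd (n j)) (tendsto_pi_nhds.2 fun a => ((hwc a).tendsto x).comp hyx)
  have hmeas : StronglyMeasurable (Function.uncurry w) := by
    exact stronglyMeasurable_uncurry_of_continuous_of_stronglyMeasurable hwc hwm
  refine ⟨fun z => w z.2 z.1, hmeas.comp_measurable measurable_swap, ?_⟩
  have hae : ∀ᵐ z ∂μ.prod ν, z.1 ∈ G := Measure.quasiMeasurePreserving_fst.ae hGae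
  filter_upwards [hae] with z hz
  simp [hw, indicator_of_mem hz]

theorem aemeasurable_eLpNorm_right [MeasurableSpace X] {ν : Measure X} [SFinite ν]
    [NormedAddCommGroup E] {p : ℝ≥0∞} (hp0 : p ≠ 0) (hp : p ≠ ∞) [SFinite μ] {u : α → X → E}
    (hu : AEStronglyMeasurable (fun z : α × X => u z.1 z.2) (μ.prod ν)) :
    AEMeasurable (fun a => eLpNorm (u a) p ν) μ := by
  simp only [eLpNorm_eq_lintegral_rpow_enorm_toReal hp0 hp]
  exact ((hu.enorm.pow_const p.toReal).lintegral_prod_right').pow_const _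

end measurability

section field

variable {N : ℕ} {T : ℝ} {v : ℝ → Space N → Space N}

/-- A locally integrable field which is Lipschitz in space at almost every time, with an
integrable Lipschitz constant, is integrable in time at every point of space. -/
theorem integrableOn_of_locallyIntegrableOn {m : ℝ → ℝ}
    (hv : LocallyIntegrableOn (fun z : ℝ × Space N => v z.1 z.2) (Icc 0 T ×ˢ univ) volume)
    (hm : IntegrableOn m (Ioc 0 T))
    (hlip : ∀ᵐ τ ∂volume.restrict (Ioc 0 T), ∀ x y, ‖v τ x - v τ y‖ ≤ m τ * ‖x - y‖)
    (x : Space N) : IntegrableOn (fun τ => v τ x) (Ioc 0 T) := by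
  have hae : ∀ R : ℝ, ∀ᵐ y ∂volume.restrict (Metric.closedBall (0 : Space N) R),
      Integrable (fun τ => v τ y) (volume.restrict (Ioc 0 T)) := fun R => by
    have h1 : IntegrableOn (fun z : ℝ × Space N => v z.1 z.2)
        (Icc 0 T ×ˢ Metric.closedBall 0 R) volume :=
      hv.integrableOn_compact_subset (prod_mono le_rfl (subset_univ _))
        (isCompact_Icc.prod (isCompact_closedBall _ _))
    have h2 : IntegrableOn (fun z : ℝ × Space N => v z.1 z.2)
        (Ioc 0 T ×ˢ Metric.closedBall 0 R) volume :=
      h1.mono_set (prod_mono Ioc_subset_Icc_self le_rfl)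
    rw [IntegrableOn, Measure.volume_eq_prod, ← Measure.prod_restrict] at h2
    exact h2.prod_left_ae
  have hae' : ∀ᵐ y : Space N, Integrable (fun τ => v τ y) (volume.restrict (Ioc 0 T)) := by
    have h : ∀ᵐ y ∂volume.restrict (⋃ n : ℕ, Metric.closedBall (0 : Space N) n),
        Integrable (fun τ => v τ y) (volume.restrict (Ioc 0 T)) :=
      ae_restrict_iUnion_iff _ _ |>.2 fun n => hae n
    rwa [Metric.iUnion_closedBall_nat, Measure.restrict_univ] at h
  have hdense : Dense {y : Space N | Integrable (fun τ => v τ y) (volume.restrict (Ioc 0 T))} :=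
    Measure.dense_of_ae hae'
  obtain ⟨y, hy, hyx⟩ := mem_closure_iff_seq_limit.1 (hdense x)
  have hmeas : AEStronglyMeasurable (fun τ => v τ x) (volume.restrict (Ioc 0 T)) := by
    refine aestronglyMeasurable_of_tendsto_ae Filter.atTop (f := fun n τ => v τ (y n))
      (fun n => (hy n).1) ?_
    filter_upwards [hlip] with τ hτ
    rw [tendsto_iff_norm_sub_tendsto_zero]
    have h0 : Filter.Tendsto (fun n => m τ * ‖y n - x‖) Filter.atTop (nhds 0) := by
      simpa using (tendsto_iff_norm_sub_tendsto_zero.1 hyx).const_mul (m τ)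
    exact squeeze_zero (fun _ => norm_nonneg _) (fun n => hτ _ _) h0
  refine Integrable.mono' ((hm.mul_const ‖x - y 0‖).add (hy 0).norm) hmeas ?_
  filter_upwards [hlip] with τ hτ
  calc ‖v τ x‖ = ‖(v τ x - v τ (y 0)) + v τ (y 0)‖ := by rw [sub_add_cancel]
    _ ≤ _ := (norm_add_le _ _).trans (add_le_add (hτ _ _) le_rfl)

theorem aestronglyMeasurable_of_locallyIntegrableOn
    (hv : LocallyIntegrableOn (fun z : ℝ × Space N => v z.1 z.2) (Icc 0 T ×ˢ univ) volume) :
    AEStronglyMeasurable (fun z : ℝ × Space N => v z.1 z.2)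
      ((volume.restrict (Ioc 0 T)).prod volume) := by
  have h := hv.aestronglyMeasurable
  rw [Measure.volume_eq_prod, ← Measure.prod_restrict, Measure.restrict_univ] at h
  refine h.mono_measure (Measure.prod_mono (Measure.restrict_mono Ioc_subset_Icc_self le_rfl) le_rfl)

/-- The partial derivatives of the field are limits of difference quotients. -/
theorem aestronglyMeasurable_partialDeriv {μ : Measure ℝ} [SFinite μ]
    (hv : AEStronglyMeasurable (fun z : ℝ × Space N => v z.1 z.2) (μ.prod volume))
    (hd : ∀ᵐ τ ∂μ, Differentiable ℝ (v τ)) (i l : Fin N) :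
    AEStronglyMeasurable (fun z : ℝ × Space N => partialDeriv (v z.1) i l z.2)
      (μ.prod volume) := by
  have hshift : ∀ h : Space N, AEStronglyMeasurable (fun z : ℝ × Space N => v z.1 (z.2 + h))
      (μ.prod volume) := fun h =>
    hv.comp_measurePreserving ((MeasurePreserving.id μ).prod (measurePreserving_add_right volume h))
  have hlin : Continuous fun w : Space N => ((w l : ℝ) : ℂ) := by fun_prop
  refine aestronglyMeasurable_of_tendsto_ae Filter.atTop
    (f := fun (n : ℕ) (z : ℝ × Space N) => (((((n : ℝ)) • (v z.1 (z.2 + ((n : ℝ))⁻¹ •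
      EuclideanSpace.single i 1) - v z.1 z.2)) l : ℝ) : ℂ))
    (fun n => hlin.comp_aestronglyMeasurable
      (((hshift (((n : ℝ))⁻¹ • EuclideanSpace.single i 1)).sub hv).const_smul (n : ℝ))) ?_
  have hae : ∀ᵐ z ∂μ.prod (volume : Measure (Space N)), Differentiable ℝ (v z.1) :=
    Measure.quasiMeasurePreserving_fst.ae hd
  filter_upwards [hae] with z hz
  have hlim := ((hz z.2).hasFDerivAt.lim_real (EuclideanSpace.single i (1 : ℝ))).comp
    tendsto_natCast_atTop_atTop
  exact (hlin.tendsto _).comp hlim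

end field

/-- Reading the first and the third of three variables preserves null sets. -/
theorem quasiMeasurePreserving_fst_snd {α X Y : Type*} [MeasurableSpace α] [MeasurableSpace X]
    [MeasurableSpace Y] {μ : Measure α} {ν : Measure X} {ρ : Measure Y} [SFinite μ] [SFinite ν]
    [SFinite ρ] : Measure.QuasiMeasurePreserving (fun z : (α × X) × Y => (z.1.1, z.2))
      ((μ.prod ν).prod ρ) (μ.prod ρ) :=
  QuasiMeasurePreserving.prodMap Measure.quasiMeasurePreserving_fst
    (Measure.QuasiMeasurePreserving.id ρ)

section besov

variable {N : ℕ} {μ : Measure ℝ} [SFinite μ]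

theorem aestronglyMeasurable_conv (H : 𝓢(Space N, ℂ)) {D : ℝ → Space N → ℂ}
    (hD : AEStronglyMeasurable (fun z : ℝ × Space N => D z.1 z.2) (μ.prod volume)) :
    AEStronglyMeasurable (fun z : ℝ × Space N => conv H (D z.1) z.2) (μ.prod volume) := by
  have h : AEStronglyMeasurable (fun z : (ℝ × Space N) × Space N => H (z.1.2 - z.2) * D z.1.1 z.2)
      ((μ.prod volume).prod volume) :=
    (Continuous.aestronglyMeasurable (by fun_prop)).mul
      (hD.comp_quasiMeasurePreserving quasiMeasurePreserving_fst_snd)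
  exact h.integral_prod_right'

namespace LittlewoodPaley

variable (L : LittlewoodPaley N)

theorem aemeasurable_gradBesovNorm {v : ℝ → Space N → Space N} {p : ℝ≥0∞} (hp0 : p ≠ 0)
    (hp : p ≠ ∞) (s : ℝ)
    (hv : AEStronglyMeasurable (fun z : ℝ × Space N => v z.1 z.2) (μ.prod volume))
    (hr : ∀ᵐ τ ∂μ, L.HasRealizedGradient (v τ)) :
    AEMeasurable (fun τ => L.gradBesovNorm s p (v τ)) μ := by
  refine Finset.aemeasurable_fun_sum _ fun i _ => Finset.aemeasurable_fun_sum _ fun l _ => ?_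
  refine AEMeasurable.tsum fun k => AEMeasurable.const_mul ?_ _
  have hD := aestronglyMeasurable_partialDeriv hv (hr.mono fun τ h => h.differentiable) i l
  refine (aemeasurable_eLpNorm_right hp0 hp
    (u := fun τ => conv (L.ker k) (partialDeriv (v τ) i l)) (ν := volume)
    (aestronglyMeasurable_conv (L.ker k) (D := fun τ => partialDeriv (v τ) i l) hD)).congr ?_
  filter_upwards [hr] with τ hτ
  congr 1
  ext x
  exact (L.block_ofFun (hτ.bounded i l) k x).symm

/-- The Lipschitz bound for a vector field whose gradient is in `Ḃ^{N/p}_{p,1}`. -/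
theorem norm_sub_le_gradBesovNorm {p p' : ℝ≥0∞} [p'.HolderConjugate p] {u : Space N → Space N}
    (hu : L.HasRealizedGradient u)
    (hfin : L.gradBesovNorm ((N : ℝ) * (1 / p).toReal) p u ≠ ∞) (x y : Space N) :
    ‖u x - u y‖ ≤ N * (L.bernsteinConst p').toReal *
      (L.gradBesovNorm ((N : ℝ) * (1 / p).toReal) p u).toReal * ‖x - y‖ := by
  have hw := L.isRealized_vcomp hu hfin
  have h1 : ‖u x - u y‖ ≤ ∑ l, ‖vcomp u l x - vcomp u l y‖ := by
    have h2 : u x - u y = ∑ l, (u x - u y) l • EuclideanSpace.single l (1 : ℝ) := by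
      ext j
      simp [Pi.single_apply]
    rw [h2]
    refine (norm_sum_le _ _).trans (Finset.sum_le_sum fun l _ => ?_)
    rw [norm_smul, PiLp.norm_single, norm_one, mul_one, vcomp, vcomp,
      ← Complex.ofReal_sub, Complex.norm_real]
    rfl
  refine h1.trans ((Finset.sum_le_sum fun l _ => (hw l).norm_sub_le (p' := p') x y).trans_eq ?_)
  rw [gradBesovNorm_eq hu.differentiable, ENNReal.toReal_sum fun l _ => (hw l).finite,
    ← Finset.sum_mul]
  simp_rw [ENNReal.toReal_mul, Finset.mul_sum]
  congr 1
  exact Finset.sum_congr rfl fun l _ => (mul_assoc _ _ _).symm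

end LittlewoodPaley

end besov

/-! ### The dyadic blocks of a solution -/

namespace LittlewoodPaley

variable {N : ℕ} {L : LittlewoodPaley N} {s T : ℝ} {p p' : ℝ≥0∞} {v : ℝ → Space N → Space N}
  {g f : ℝ → ZDual N} {f₀ : ZDual N}

variable (L) in
theorem mul_eLpNorm_block_le_besovNorm (w : ℤ → ℝ) (s : ℝ) (p : ℝ≥0∞) (f : ZDual N) (k : ℤ) :
    ENNReal.ofReal ((2 : ℝ) ^ ((k : ℝ) * s) * w k) * eLpNorm (L.block k f) p volume ≤
      L.besovNorm w s p f :=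
  ENNReal.le_tsum k

variable (L) in
theorem eLpNorm_block_le_besovNorm (s : ℝ) (p : ℝ≥0∞) (f : ZDual N) (k : ℤ) :
    eLpNorm (L.block k f) p volume ≤
      2 ^ (-((k : ℝ) * s)) * L.besovNorm (fun _ => 1) s p f := by
  have h := L.mul_eLpNorm_block_le_besovNorm (fun _ => 1) s p f k
  rw [mul_one, ← ENNReal.ofReal_rpow_of_pos two_pos, ENNReal.ofReal_ofNat] at h
  refine le_trans ?_ (mul_le_mul_right h _)
  rw [← mul_assoc, ← ENNReal.rpow_add _ _ two_ne_zero ENNReal.ofNat_ne_top, neg_add_cancel,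
    ENNReal.rpow_zero, one_mul]

theorem ae_besovNorm_le (w : ℤ → ℝ) (f : ℝ → ZDual N) :
    ∀ᵐ τ ∂volume.restrict (Ioc 0 T), L.besovNorm w s p (f τ) ≤ L.timeBesovNorm ∞ T w s p f := by
  have h := ae_le_eLpNormEssSup (f := fun τ => L.besovNorm w s p (f τ))
    (μ := volume.restrict (Ioc 0 T))
  rw [timeBesovNorm, eLpNorm_exponent_top]
  filter_upwards [h] with τ hτ
  rwa [enorm_eq_self] at hτ

namespace IsTransportSolution

theorem intervalIntegrable (h : L.IsTransportSolution T v g f₀ f) (hT : 0 ≤ T) (ψ : ZSpace N) :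
    IntervalIntegrable (fun τ => g τ ψ - L.transport (v τ) (f τ) ψ) volume 0 T :=
  (intervalIntegrable_iff_integrableOn_Ioc_of_le hT).2 ((h.integrable ψ).1.sub (h.integrable ψ).2)

theorem continuousOn (h : L.IsTransportSolution T v g f₀ f) (hT : 0 ≤ T) (ψ : ZSpace N) :
    ContinuousOn (fun τ => f τ ψ) (Icc 0 T) := by
  have h1 := intervalIntegral.continuousOn_primitive_interval' (h.intervalIntegrable hT ψ)
    left_mem_uIcc
  rw [uIcc_of_le hT] at h1
  exact (continuousOn_const.add h1).congr fun t ht => h.equation t ht ψ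

/-- The dyadic blocks of a solution are bounded at every time: the bound holds at almost every
time, and the blocks are continuous in time. -/
theorem exists_norm_block_le [p'.HolderConjugate p] (h : L.IsTransportSolution T v g f₀ f)
    (hT : 0 < T) (hf : L.timeBesovNorm ∞ T (fun _ => 1) s p f < ∞) (k : ℤ) :
    ∃ M : ℝ, ∀ τ ∈ Icc 0 T, ∀ x, ‖L.block k (f τ) x‖ ≤ M := by
  set B := (2 : ℝ≥0∞) ^ ((k : ℝ) * N * (1 / p).toReal) * (L.bernsteinConst p' *
    (2 ^ (-((k : ℝ) * s)) * L.timeBesovNorm ∞ T (fun _ => 1) s p f)) with hB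
  have hBt : B ≠ ∞ := ENNReal.mul_ne_top (two_rpow_ne_top _)
    (ENNReal.mul_ne_top (L.bernsteinConst_ne_top p') (ENNReal.mul_ne_top (two_rpow_ne_top _) hf.ne))
  refine ⟨B.toReal, fun τ hτ x => ?_⟩
  have hae : ∀ᵐ τ ∂volume.restrict (Ioc 0 T), ‖L.block k (f τ) x‖ ≤ B.toReal := by
    filter_upwards [ae_besovNorm_le (L := L) (T := T) (s := s) (p := p) (fun _ => 1) f] with τ hτ
    rw [← ENNReal.ofReal_le_iff_le_toReal hBt, ofReal_norm]
    refine (L.enorm_block_le (p := p) (p' := p') (f τ) k x).trans ?_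
    rw [hB]
    gcongr
    exact (L.eLpNorm_block_le_besovNorm s p (f τ) k).trans (by gcongr)
  rw [Measure.restrict_congr_set Ioc_ae_eq_Icc] at hae
  have hc := (h.continuousOn hT.le ⟨L.kernel k x, L.kernel_mem k x⟩).norm
  have heq := Measure.eqOn_Icc_of_ae_eq volume hT.ne
    (f := fun τ => max ‖L.block k (f τ) x‖ B.toReal) (g := fun _ => B.toReal)
    (hae.mono fun τ hτ => max_eq_right hτ) (hc.sup continuousOn_const) continuousOn_const
  exact max_eq_right_iff.1 (heq hτ)

end IsTransportSolution

theorem continuousOn_fderiv_block {S : Set ℝ} {k : ℤ} {M : ℝ}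
    (hM : ∀ τ ∈ S, ∀ x, ‖L.block k (f τ) x‖ ≤ M)
    (hc : ∀ ψ : ZSpace N, ContinuousOn (fun τ => f τ ψ) S) :
    ContinuousOn (fun z : ℝ × Space N => fderiv ℝ (L.block k (f z.1)) z.2) (S ×ˢ univ) := by
  have hint : Integrable fun y => fderiv ℝ (L.wker k) y :=
    (SchwartzMap.fderivCLM ℝ (Space N) ℂ (L.wker k)).integrable
  have hD : ∀ τ ∈ S, ∀ x, HasFDerivAt (L.block k (f τ))
      (∫ y, L.block k (f τ) (x - y) • fderiv ℝ (L.wker k) y) x := fun τ hτ x => by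
    have h := L.hasFDerivAt_block (hM τ hτ) x
    rw [← integral_sub_left_eq_self _ volume x] at h
    simpa only [sub_sub_cancel] using h
  have hbd : ∀ τ ∈ S, ∀ x y, ‖L.block k (f τ) (x - y) • fderiv ℝ (L.wker k) y‖ ≤
      M * ‖fderiv ℝ (L.wker k) y‖ := fun τ hτ x y => by
    rw [norm_smul]
    exact mul_le_mul_of_nonneg_right (hM τ hτ _) (norm_nonneg _)
  -- joint continuity of the block: it is continuous in time, and Lipschitz in space
  have hblock : ContinuousOn (fun z : ℝ × Space N => L.block k (f z.1) z.2) (S ×ˢ univ) := by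
    refine continuousOn_prod_of_continuousOn_lipschitzOnWith' _
      (∫ y, M * ‖fderiv ℝ (L.wker k) y‖).toNNReal (fun τ hτ => ?_)
      (fun x _ => hc ⟨L.kernel k x, L.kernel_mem k x⟩)
    refine Convex.lipschitzOnWith_of_nnnorm_hasFDerivWithin_le (𝕜 := ℝ) (s := univ)
      (fun x _ => (hD τ hτ x).hasFDerivWithinAt) (fun x _ => ?_) convex_univ
    rw [← NNReal.coe_le_coe, coe_nnnorm]
    refine le_trans ?_ (Real.le_coe_toNNReal _)
    exact norm_integral_le_of_norm_le (hint.norm.const_mul M)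
      (Filter.Eventually.of_forall (hbd τ hτ x))
  have hcont : ContinuousOn (fun z : ℝ × Space N =>
      ∫ y, L.block k (f z.1) (z.2 - y) • fderiv ℝ (L.wker k) y) (S ×ˢ univ) := by
    refine continuousOn_of_dominated (bound := fun y => M * ‖fderiv ℝ (L.wker k) y‖)
      (fun z hz => ?_) (fun z hz => Filter.Eventually.of_forall (hbd z.1 hz.1 z.2))
      (hint.norm.const_mul M) (Filter.Eventually.of_forall fun y => ?_)
    · exact (((L.continuous_block (f z.1) k).comp
        (continuous_const.sub continuous_id)).aestronglyMeasurable).smul hint.1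
    · have hsub : Continuous fun z : ℝ × Space N => ((z.1, z.2 - y) : ℝ × Space N) := by fun_prop
      exact (hblock.comp hsub.continuousOn fun z hz => ⟨hz.1, mem_univ _⟩).smul continuousOn_const
  exact hcont.congr fun z hz => (hD z.1 hz.1 z.2).fderiv

variable (L) in
/-- The Lipschitz constant of `v(τ)`. -/
def lipConst (p p' : ℝ≥0∞) (v : ℝ → Space N → Space N) (τ : ℝ) : ℝ :=
  N * (L.bernsteinConst p').toReal * (L.gradBesovNorm ((N : ℝ) * (1 / p).toReal) p (v τ)).toReal

theorem lipConst_nonneg (τ : ℝ) : 0 ≤ L.lipConst p p' v τ := by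
  unfold lipConst; positivity

/-- The assumptions on the vector field: it is locally integrable, and its gradient belongs to
`L¹(0, T; Ḃ^{N/p}_{p,1})`. -/
structure IsBesovField (L : LittlewoodPaley N) (p : ℝ≥0∞) (T : ℝ) (v : ℝ → Space N → Space N) :
    Prop where
  locallyIntegrable :
    LocallyIntegrableOn (fun z : ℝ × Space N => v z.1 z.2) (Icc 0 T ×ˢ univ) volume
  realized : ∀ᵐ τ ∂(volume.restrict (Ioc 0 T)), L.HasRealizedGradient (v τ)
  finite : L.gradIntegral p v T < ∞

namespace IsBesovField

theorem aemeasurable_gradBesovNorm (hv : L.IsBesovField p T v) (hp0 : p ≠ 0) (hp : p ≠ ∞) :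
    AEMeasurable (fun τ => L.gradBesovNorm ((N : ℝ) * (1 / p).toReal) p (v τ))
      (volume.restrict (Ioc 0 T)) :=
  L.aemeasurable_gradBesovNorm hp0 hp _
    (aestronglyMeasurable_of_locallyIntegrableOn hv.locallyIntegrable) hv.realized

theorem ae_gradBesovNorm_lt_top (hv : L.IsBesovField p T v) (hp0 : p ≠ 0) (hp : p ≠ ∞) :
    ∀ᵐ τ ∂volume.restrict (Ioc 0 T),
      L.gradBesovNorm ((N : ℝ) * (1 / p).toReal) p (v τ) < ∞ :=
  ae_lt_top' (hv.aemeasurable_gradBesovNorm hp0 hp) hv.finite.ne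

theorem integrableOn_toReal (hv : L.IsBesovField p T v) (hp0 : p ≠ 0) (hp : p ≠ ∞) :
    IntegrableOn (fun τ => (L.gradBesovNorm ((N : ℝ) * (1 / p).toReal) p (v τ)).toReal)
      (Ioc 0 T) :=
  integrable_toReal_of_lintegral_ne_top (hv.aemeasurable_gradBesovNorm hp0 hp) hv.finite.ne

theorem integrableOn_lipConst (hv : L.IsBesovField p T v) (hp0 : p ≠ 0) (hp : p ≠ ∞) :
    IntegrableOn (L.lipConst p p' v) (Ioc 0 T) :=
  (hv.integrableOn_toReal hp0 hp).const_mul _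

theorem ae_norm_sub_le [p'.HolderConjugate p] (hv : L.IsBesovField p T v) (hp0 : p ≠ 0)
    (hp : p ≠ ∞) : ∀ᵐ τ ∂volume.restrict (Ioc 0 T), ∀ x y,
      ‖v τ x - v τ y‖ ≤ L.lipConst p p' v τ * ‖x - y‖ := by
  filter_upwards [hv.realized, hv.ae_gradBesovNorm_lt_top hp0 hp] with τ h1 h2 x y
  exact L.norm_sub_le_gradBesovNorm h1 h2.ne x y

end IsBesovField

theorem aestronglyMeasurable_fderiv_apply {a : ℝ → Space N → ℂ}
    (hvm : AEStronglyMeasurable (fun z : ℝ × Space N => v z.1 z.2)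
      ((volume.restrict (Ioc 0 T)).prod volume))
    (hD : ContinuousOn (fun z : ℝ × Space N => fderiv ℝ (a z.1) z.2) (Icc 0 T ×ˢ univ)) :
    AEStronglyMeasurable (fun z : ℝ × Space N => fderiv ℝ (a z.1) z.2 (v z.1 z.2))
      ((volume.restrict (Ioc 0 T)).prod volume) := by
  have h : AEStronglyMeasurable (fun z : ℝ × Space N => fderiv ℝ (a z.1) z.2)
      ((volume.restrict (Ioc 0 T)).prod volume) := by
    have h1 := (hD.mono (prod_mono Ioc_subset_Icc_self le_rfl)).aestronglyMeasurable
      (μ := (volume : Measure (ℝ × Space N))) (measurableSet_Ioc.prod MeasurableSet.univ)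
    rwa [Measure.volume_eq_prod, ← Measure.prod_restrict, Measure.restrict_univ] at h1
  exact isBoundedBilinearMap_apply.continuous.comp_aestronglyMeasurable (h.prodMk hvm)

/-- The pairings of `v · ∇f` with the kernels are measurable functions of time and space. -/
theorem aestronglyMeasurable_transport
    (hvm : AEStronglyMeasurable (fun z : ℝ × Space N => v z.1 z.2)
      ((volume.restrict (Ioc 0 T)).prod volume))
    (hD : ∀ j, ContinuousOn (fun z : ℝ × Space N => fderiv ℝ (L.block j (f z.1)) z.2)
      (Icc 0 T ×ˢ univ))
    (hs : ∀ᵐ τ ∂(volume.restrict (Ioc 0 T)), ∀ ψ : ZSpace N,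
      Summable fun k : ℤ => L.blockTransport (v τ) k (f τ) ψ) (k : ℤ) :
    AEStronglyMeasurable (fun z : ℝ × Space N =>
      L.transport (v z.1) (f z.1) ⟨L.kernel k z.2, L.kernel_mem k z.2⟩)
      ((volume.restrict (Ioc 0 T)).prod volume) := by
  have hterm : ∀ j, AEStronglyMeasurable (fun z : ℝ × Space N =>
      L.blockTransport (v z.1) j (f z.1) ⟨L.kernel k z.2, L.kernel_mem k z.2⟩)
      ((volume.restrict (Ioc 0 T)).prod volume) := fun j => by
    have h1 : AEStronglyMeasurable (fun z : ℝ × Space N =>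
        fderiv ℝ (L.block j (f z.1)) z.2 (v z.1 z.2))
        ((volume.restrict (Ioc 0 T)).prod volume) :=
      aestronglyMeasurable_fderiv_apply (a := fun τ => L.block j (f τ)) hvm (hD j)
    have h2 : AEStronglyMeasurable (fun z : (ℝ × Space N) × Space N =>
        fderiv ℝ (L.block j (f z.1.1)) z.2 (v z.1.1 z.2) * L.ker k (z.1.2 - z.2))
        (((volume.restrict (Ioc 0 T)).prod volume).prod volume) :=
      (h1.comp_quasiMeasurePreserving quasiMeasurePreserving_fst_snd).mul
        (Continuous.aestronglyMeasurable (by fun_prop))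
    refine h2.integral_prod_right'.congr (Filter.Eventually.of_forall fun z => ?_)
    simp only [blockTransport, kernel_eq]
  refine aestronglyMeasurable_of_tendsto_ae Filter.atTop
    (f := fun (S : Finset ℤ) (z : ℝ × Space N) => ∑ j ∈ S,
      L.blockTransport (v z.1) j (f z.1) ⟨L.kernel k z.2, L.kernel_mem k z.2⟩)
    (fun S => Finset.aestronglyMeasurable_fun_sum _ fun j _ => hterm j) ?_
  have hae : ∀ᵐ z ∂(volume.restrict (Ioc 0 T)).prod (volume : Measure (Space N)),
      ∀ ψ : ZSpace N, Summable fun k : ℤ => L.blockTransport (v z.1) k (f z.1) ψ :=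
    Measure.quasiMeasurePreserving_fst.ae hs
  filter_upwards [hae] with z hz
  exact (hz _).hasSum

/-- The dyadic blocks of a solution satisfy transport equations, with the commutators as
additional sources. -/
theorem IsTransportSolution.isLipschitzTransport [p'.HolderConjugate p] (hp : 1 ≤ p)
    (hp' : p ≠ ∞) (hT : 0 < T) (hv : L.IsBesovField p T v)
    (hf : L.timeBesovNorm ∞ T (fun _ => 1) s p f < ∞) (h : L.IsTransportSolution T v g f₀ f)
    (k : ℤ) :
    IsLipschitzTransport T v (L.lipConst p p' v)
      (fun τ x => L.block k (g τ) x + L.commutator (v τ) (f τ) k x)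
      (fun τ => L.block k (f τ)) := by
  have hp0 : p ≠ 0 := (zero_lt_one.trans_le hp).ne'
  have hD : ∀ j, ContinuousOn (fun z : ℝ × Space N => fderiv ℝ (L.block j (f z.1)) z.2)
      (Icc 0 T ×ˢ univ) := fun j => by
    obtain ⟨M, hM⟩ := h.exists_norm_block_le (p' := p') hT hf j
    exact continuousOn_fderiv_block hM (h.continuousOn hT.le)
  have hvm := aestronglyMeasurable_of_locallyIntegrableOn hv.locallyIntegrable
  have hlip := hv.ae_norm_sub_le (p' := p') hp0 hp'
  have hvx := integrableOn_of_locallyIntegrableOn hv.locallyIntegrable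
    (hv.integrableOn_lipConst (p' := p') hp0 hp') hlip
  have hadv : ∀ x, IntegrableOn (fun τ => fderiv ℝ (L.block k (f τ)) x (v τ x)) (Ioc 0 T) :=
    fun x => by
    have hc : ContinuousOn (fun τ => fderiv ℝ (L.block k (f τ)) x) (Icc 0 T) :=
      (hD k).comp (f := fun τ => (τ, x)) (by fun_prop) fun τ hτ => ⟨hτ, mem_univ _⟩
    obtain ⟨M, hM⟩ := isCompact_Icc.exists_bound_of_continuousOn hc
    refine Integrable.mono' ((hvx x).norm.const_mul M)
      (isBoundedBilinearMap_apply.continuous.comp_aestronglyMeasurable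
        (((hc.mono Ioc_subset_Icc_self).aestronglyMeasurable measurableSet_Ioc).prodMk (hvx x).1))
      ((ae_restrict_mem measurableSet_Ioc).mono fun τ hτ => ?_)
    exact (ContinuousLinearMap.le_opNorm _ _).trans
      (mul_le_mul_of_nonneg_right (hM τ (Ioc_subset_Icc_self hτ)) (norm_nonneg _))
  have hii : ∀ {E : Type} [NormedAddCommGroup E] {φ : ℝ → E}, IntegrableOn φ (Ioc 0 T) →
      IntervalIntegrable φ volume 0 T :=
    fun hφ => (intervalIntegrable_iff_integrableOn_Ioc_of_le hT.le).2 hφ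
  refine
    { nonneg := fun τ => lipConst_nonneg τ
      integrable_lip := hii (hv.integrableOn_lipConst hp0 hp')
      lip := hlip
      integrable_field := fun x => hii (hvx x)
      integrable_source := fun x => hii ((h.integrable _).1.add ((hadv x).sub (h.integrable _).2))
      measurable_source := ?_
      differentiable := fun τ hτ => ?_
      continuousOn := hD k
      equation := fun t ht x => ?_ }
  · refine AEStronglyMeasurable.add ?_ ((aestronglyMeasurable_fderiv_apply
      (a := fun τ => L.block k (f τ)) hvm (hD k)).sub
      (aestronglyMeasurable_transport hvm hD h.summable k))
    exact aestronglyMeasurable_of_continuous_right (fun x => (h.integrable _).1.1)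
      (Filter.Eventually.of_forall fun τ => L.continuous_block (g τ) k)
  · obtain ⟨M, hM⟩ := h.exists_norm_block_le (p' := p') hT hf k
    exact fun x => (L.hasFDerivAt_block (hM τ hτ) x).differentiableAt
  · have h0 := h.equation 0 ⟨le_rfl, hT.le⟩ ⟨L.kernel k x, L.kernel_mem k x⟩
    rw [intervalIntegral.integral_same, add_zero] at h0
    simp only [block, commutator]
    rw [h.equation t ht, h0]
    congr 1
    refine intervalIntegral.integral_congr fun τ _ => ?_
    ring

end LittlewoodPaley

/-! ### The weighted estimate of a solution -/

theorem summable_weight {e : ℤ → ℝ → ℝ} (he : IsWeightSequence e) {t : ℝ} (ht : 0 ≤ t) (k : ℤ) :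
    Summable fun m : ℕ => (2 : ℝ) ^ (-(m : ℤ)) * e (k + m) t := by
  refine Summable.of_nonneg_of_le (fun m => mul_nonneg (by positivity) (he.mem_Icc _ t ht).1)
    (fun m => ?_) summable_geometric_two
  rw [zpow_neg, zpow_natCast, one_div, inv_pow]
  exact mul_le_of_le_one_right (by positivity) (he.mem_Icc _ t ht).2

theorem weight_le_two {e : ℤ → ℝ → ℝ} (he : IsWeightSequence e) {t : ℝ} (ht : 0 ≤ t) (k : ℤ) :
    weight e t k ≤ 2 := by
  refine ((summable_weight he ht k).tsum_le_tsum (fun m => ?_) summable_geometric_two).trans_eq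
    tsum_geometric_two
  rw [zpow_neg, zpow_natCast, one_div, inv_pow]
  exact mul_le_of_le_one_right (by positivity) (he.mem_Icc _ t ht).2

theorem isSlowWeight_weight {e : ℤ → ℝ → ℝ} (he : IsWeightSequence e) {t : ℝ} (ht : 0 ≤ t) :
    IsSlowWeight fun k => ENNReal.ofReal (weight e t k) where
  mono k k' hk := ENNReal.ofReal_le_ofReal ((summable_weight he ht k).tsum_le_tsum
    (fun m => mul_le_mul_of_nonneg_left (he.mono _ _ t ht (by omega)) (by positivity))
    (summable_weight he ht k'))
  slow k k' hk := by
    obtain ⟨n, rfl⟩ := Int.le.dest hk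
    -- the series of `ω_{k + n}` is `2^n` times a tail of the series of `ω_k`
    have h : weight e t (k + n) ≤ (2 : ℝ) ^ (n : ℤ) * weight e t k := by
      have h1 := (summable_weight he ht k).sum_add_tsum_nat_add n
      have h2 : 0 ≤ ∑ m ∈ Finset.range n, (2 : ℝ) ^ (-(m : ℤ)) * e (k + m) t :=
        Finset.sum_nonneg fun m _ => mul_nonneg (by positivity) (he.mem_Icc _ t ht).1
      have h3 : weight e t (k + n) = (2 : ℝ) ^ (n : ℤ) *
          ∑' m : ℕ, (2 : ℝ) ^ (-((m + n : ℕ) : ℤ)) * e (k + (m + n : ℕ)) t := by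
        rw [weight, ← tsum_mul_left]
        refine tsum_congr fun m => ?_
        rw [← mul_assoc, ← zpow_add₀ two_ne_zero]
        congr 2 <;> push_cast <;> ring
      rw [h3]
      refine mul_le_mul_of_nonneg_left ?_ (by positivity)
      rw [weight]
      linarith
    refine (ENNReal.ofReal_le_ofReal h).trans_eq ?_
    rw [ENNReal.ofReal_mul (by positivity), ENNReal_ofReal_two_zpow]
    congr 2
    push_cast
    ring

namespace LittlewoodPaley

variable {N : ℕ} {L : LittlewoodPaley N} {s T : ℝ} {p p' : ℝ≥0∞} {v : ℝ → Space N → Space N}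
  {g f : ℝ → ZDual N} {f₀ : ZDual N}

theorem ofReal_two_rpow_mul (x y : ℝ) :
    ENNReal.ofReal ((2 : ℝ) ^ x * y) = 2 ^ x * ENNReal.ofReal y := by
  rw [ENNReal.ofReal_mul (by positivity), ← ENNReal.ofReal_rpow_of_pos two_pos,
    ENNReal.ofReal_ofNat]

theorem besovNorm_le_mul {w : ℤ → ℝ} (hw : ∀ k, w k ≤ 2) (f : ZDual N) :
    L.besovNorm w s p f ≤ 2 * L.besovNorm (fun _ => 1) s p f := by
  rw [besovNorm, besovNorm, ← ENNReal.tsum_mul_left]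
  refine ENNReal.tsum_le_tsum fun k => ?_
  rw [← mul_assoc]
  gcongr
  rw [ofReal_two_rpow_mul, ofReal_two_rpow_mul, ENNReal.ofReal_one, mul_one, mul_comm]
  gcongr
  exact ENNReal.ofReal_le_of_le_toReal (hw k)

/-- The Besov norms of a function of time are measurable, if it is weakly measurable. -/
theorem aemeasurable_besovNorm {μ : Measure ℝ} [SFinite μ] (hp0 : p ≠ 0) (hp : p ≠ ∞)
    (w : ℤ → ℝ) (hg : ∀ ψ, AEStronglyMeasurable (fun τ => g τ ψ) μ) :
    AEMeasurable (fun τ => L.besovNorm w s p (g τ)) μ := by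
  refine AEMeasurable.tsum fun k => AEMeasurable.const_mul (aemeasurable_eLpNorm_right hp0 hp
    (u := fun τ => L.block k (g τ)) (ν := volume) ?_) _
  exact aestronglyMeasurable_of_continuous_right (fun x => hg _)
    (Filter.Eventually.of_forall fun τ => L.continuous_block (g τ) k)

theorem IsBesovField.toReal_gradIntegral (hv : L.IsBesovField p T v) (hp0 : p ≠ 0) (hp : p ≠ ∞)
    {t : ℝ} (ht : t ∈ Icc 0 T) : (L.gradIntegral p v t).toReal =
      ∫ τ in (0 : ℝ)..t, (L.gradBesovNorm ((N : ℝ) * (1 / p).toReal) p (v τ)).toReal := by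
  have hμ : volume.restrict (Ioc 0 t) ≤ volume.restrict (Ioc 0 T) :=
    Measure.restrict_mono (Ioc_subset_Ioc_right ht.2) le_rfl
  rw [intervalIntegral.integral_of_le ht.1, gradIntegral,
    integral_toReal ((hv.aemeasurable_gradBesovNorm hp0 hp).mono_measure hμ)
      (ae_mono hμ (hv.ae_gradBesovNorm_lt_top hp0 hp))]

/-- The estimate of a solution, given the weighted estimate of the commutators: the blocks satisfy
transport equations, whose `L^p` estimates are summed before Gronwall's inequality is applied. -/
theorem IsTransportSolution.tildeBesovNorm_le [p'.HolderConjugate p] (hp : 1 ≤ p)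
    (hp' : p ≠ ∞) (hT : 0 < T) (hv : L.IsBesovField p T v)
    (hf : L.timeBesovNorm ∞ T (fun _ => 1) s p f < ∞) (h : L.IsTransportSolution T v g f₀ f)
    {w : ℤ → ℝ} (hw : ∀ k, w k ≤ 2) {c : ℝ} (hc : 0 ≤ c)
    (hcomm : ∀ᵐ τ ∂volume.restrict (Ioc 0 T),
      ∑' k : ℤ, ENNReal.ofReal ((2 : ℝ) ^ ((k : ℝ) * s) * w k) *
        eLpNorm (L.commutator (v τ) (f τ) k) p volume ≤
      ENNReal.ofReal c * L.gradBesovNorm ((N : ℝ) * (1 / p).toReal) p (v τ) *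
        L.besovNorm w s p (f τ)) {t : ℝ} (ht : t ∈ Icc 0 T) {C : ℝ}
    (hC : C = 2 * N * (N * (L.bernsteinConst p').toReal) + c) :
    L.tildeBesovNorm ∞ t w s p f ≤ ENNReal.ofReal (Real.exp (C * (L.gradIntegral p v t).toReal)) *
      (L.besovNorm w s p f₀ + ∫⁻ τ in Ioc 0 t,
        ENNReal.ofReal (Real.exp (-(C * (L.gradIntegral p v τ).toReal))) *
          L.besovNorm w s p (g τ)) := by
  have hp0 : p ≠ 0 := (zero_lt_one.trans_le hp).ne'
  have hf0 : f 0 = f₀ := by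
    ext ψ
    rw [h.equation 0 ⟨le_rfl, hT.le⟩ ψ, intervalIntegral.integral_same, add_zero]
  set β : ℝ → ℝ≥0∞ := fun τ => L.gradBesovNorm ((N : ℝ) * (1 / p).toReal) p (v τ) with hβ
  set m : ℝ → ℝ := fun τ => (β τ).toReal with hm
  set V : ℝ → ℝ := fun τ => ∫ σ in (0 : ℝ)..τ, m σ with hV
  have hm0 : ∀ τ, 0 ≤ m τ := fun τ => ENNReal.toReal_nonneg
  have hmi : IntervalIntegrable m volume 0 T :=
    (intervalIntegrable_iff_integrableOn_Ioc_of_le hT.le).2 (hv.integrableOn_toReal hp0 hp')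
  have hVi : ∀ τ ∈ Icc 0 T, (L.gradIntegral p v τ).toReal = V τ := fun τ hτ =>
    hv.toReal_gradIntegral hp0 hp' hτ
  have hVmono : ∀ τ ∈ Icc 0 t, V τ ≤ V t := fun τ hτ => by
    refine intervalIntegral.integral_mono_interval le_rfl hτ.1 hτ.2
      (Filter.Eventually.of_forall hm0) (hmi.mono_set ?_)
    rw [uIcc_of_le ht.1, uIcc_of_le hT.le]
    exact Icc_subset_Icc_right ht.2
  set c' : ℝ := 2 * N * (N * (L.bernsteinConst p').toReal) with hc'
  have hc'0 : 0 ≤ c' := by positivity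
  set E : ℝ → ℝ≥0∞ := fun τ => ENNReal.ofReal (Real.exp (-(c' * V τ))) with hE
  have hElip : ∀ τ, ENNReal.ofReal (Real.exp (-(2 * N * ∫ σ in (0 : ℝ)..τ, L.lipConst p p' v σ)))
      = E τ := fun τ => by
    have h1 : ∫ σ in (0 : ℝ)..τ, L.lipConst p p' v σ = N * (L.bernsteinConst p').toReal * V τ :=
      intervalIntegral.integral_const_mul _ _
    rw [h1, hE, hc', ← mul_assoc]
  have hV0 : ∀ τ, 0 ≤ τ → 0 ≤ V τ := fun τ hτ =>
    intervalIntegral.integral_nonneg hτ fun σ _ => hm0 σ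
  have hE1 : ∀ τ, 0 ≤ τ → E τ ≤ 1 := fun τ hτ => by
    rw [hE, ← ENNReal.ofReal_one]
    refine ENNReal.ofReal_le_ofReal (Real.exp_le_one_iff.2 ?_)
    have := mul_nonneg hc'0 (hV0 τ hτ)
    linarith
  have hEm : AEMeasurable E (volume.restrict (Ioc 0 T)) := by
    have h1 : ContinuousOn V (Icc 0 T) := by
      have := intervalIntegral.continuousOn_primitive_interval' hmi left_mem_uIcc
      rwa [uIcc_of_le hT.le] at this
    have h2 : ContinuousOn (fun τ => Real.exp (-(c' * V τ))) (Ioc 0 T) := by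
      have := h1.mono Ioc_subset_Icc_self
      fun_prop
    exact (h2.aemeasurable measurableSet_Ioc).ennreal_ofReal
  set W : ℤ → ℝ≥0∞ := fun k => ENNReal.ofReal ((2 : ℝ) ^ ((k : ℝ) * s) * w k) with hW
  set F : ℤ → ℝ → Space N → ℂ := fun k τ x => L.block k (g τ) x + L.commutator (v τ) (f τ) k x
    with hF
  have htr : ∀ k, IsLipschitzTransport T v (L.lipConst p p' v) (F k) (fun τ => L.block k (f τ)) :=
    fun k => h.isLipschitzTransport hp hp' hT hv hf k
  have hFm : ∀ k, AEMeasurable (fun τ => E τ * eLpNorm (F k τ) p volume)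
      (volume.restrict (Ioc 0 T)) := fun k =>
    hEm.mul (aemeasurable_eLpNorm_right hp0 hp' (htr k).measurable_source)
  have hGm : AEMeasurable (fun τ => L.besovNorm w s p (g τ)) (volume.restrict (Ioc 0 T)) :=
    aemeasurable_besovNorm hp0 hp' w fun ψ => (h.integrable ψ).1.1
  have hfm : AEMeasurable (fun τ => L.besovNorm w s p (f τ)) (volume.restrict (Ioc 0 T)) :=
    aemeasurable_besovNorm hp0 hp' w fun ψ =>
      ((h.continuousOn hT.le ψ).mono Ioc_subset_Icc_self).aestronglyMeasurable measurableSet_Ioc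
  set y : ℝ → ℝ≥0∞ := fun τ => E τ * L.besovNorm w s p (f τ) with hy
  set α : ℝ → ℝ≥0∞ := fun τ => E τ * L.besovNorm w s p (g τ) with hα
  have hym : AEMeasurable y (volume.restrict (Ioc 0 T)) := hEm.mul hfm
  have hαm : AEMeasurable α (volume.restrict (Ioc 0 T)) := hEm.mul hGm
  -- the sources of the transport equations of the blocks
  have hsource : ∀ᵐ τ ∂volume.restrict (Ioc 0 T),
      ∑' k, W k * (E τ * eLpNorm (F k τ) p volume) ≤ α τ + ENNReal.ofReal (c * m τ) * y τ := by
    have hmeas : ∀ᵐ τ ∂volume.restrict (Ioc 0 T), ∀ k,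
        AEStronglyMeasurable (F k τ) volume :=
      ae_all_iff.2 fun k => (htr k).measurable_source.prodMk_left
    filter_upwards [hcomm, hmeas, hv.ae_gradBesovNorm_lt_top hp0 hp'] with τ h1 h2 h3
    have h4 : ∀ k, eLpNorm (F k τ) p volume ≤ eLpNorm (L.block k (g τ)) p volume +
        eLpNorm (L.commutator (v τ) (f τ) k) p volume := fun k => by
      have hg := (L.continuous_block (g τ) k).aestronglyMeasurable (μ := (volume : Measure (Space N)))
      refine eLpNorm_add_le hg ?_ hp
      refine ((h2 k).sub hg).congr (Filter.Eventually.of_forall fun x => ?_)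
      simp [hF]
    calc ∑' k, W k * (E τ * eLpNorm (F k τ) p volume)
        ≤ ∑' k, (E τ * (W k * eLpNorm (L.block k (g τ)) p volume) +
          E τ * (W k * eLpNorm (L.commutator (v τ) (f τ) k) p volume)) := by
          refine ENNReal.tsum_le_tsum fun k => ?_
          rw [mul_left_comm, ← mul_add, ← mul_add]
          gcongr
          exact h4 k
      _ = α τ + E τ * ∑' k, W k * eLpNorm (L.commutator (v τ) (f τ) k) p volume := by
          rw [ENNReal.tsum_add, ENNReal.tsum_mul_left, ENNReal.tsum_mul_left]
          rfl
      _ ≤ α τ + E τ * (ENNReal.ofReal c * β τ * L.besovNorm w s p (f τ)) := by gcongr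
      _ = α τ + ENNReal.ofReal (c * m τ) * y τ := by
          rw [ENNReal.ofReal_mul hc, hm, ENNReal.ofReal_toReal h3.ne, hy]
          ring
  -- the sum of the estimates of the blocks
  have hsum : ∀ τ ∈ Icc 0 T,
      ∑' k, W k * (eLpNorm (L.block k f₀) p volume +
        ∫⁻ σ in Ioc 0 τ, E σ * eLpNorm (F k σ) p volume) ≤
      L.besovNorm w s p f₀ + ((∫⁻ σ in Ioc 0 τ, α σ) +
        ∫⁻ σ in Ioc 0 τ, ENNReal.ofReal (c * m σ) * y σ) := fun τ hτ => by
    have hμ : volume.restrict (Ioc 0 τ) ≤ volume.restrict (Ioc 0 T) :=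
      Measure.restrict_mono (Ioc_subset_Ioc_right hτ.2) le_rfl
    simp_rw [mul_add]
    rw [ENNReal.tsum_add]
    refine add_le_add le_rfl ?_
    rw [← lintegral_add_left' (hαm.mono_measure hμ)]
    simp_rw [← lintegral_const_mul'' _ ((hFm _).mono_measure hμ)]
    rw [← lintegral_tsum fun k => ((hFm k).mono_measure hμ).const_mul _]
    exact lintegral_mono_ae (ae_mono hμ hsource)
  have hblock : ∀ k, ∀ τ ∈ Icc 0 T, E τ * eLpNorm (L.block k (f τ)) p volume ≤
      eLpNorm (L.block k f₀) p volume + ∫⁻ σ in Ioc 0 τ, E σ * eLpNorm (F k σ) p volume :=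
    fun k τ hτ => by
    have h1 := (htr k).eLpNorm_le hτ.1 hτ.2 hp hp'
    simp_rw [hElip, hf0] at h1
    exact h1
  have hyle : ∀ τ ∈ Icc 0 T, y τ ≤ L.besovNorm w s p f₀ + ((∫⁻ σ in Ioc 0 τ, α σ) +
        ∫⁻ σ in Ioc 0 τ, ENNReal.ofReal (c * m σ) * y σ) := fun τ hτ => by
    refine le_trans ?_ (hsum τ hτ)
    rw [hy]
    simp only [besovNorm]
    rw [← ENNReal.tsum_mul_left]
    refine ENNReal.tsum_le_tsum fun k => ?_
    rw [mul_left_comm]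
    exact mul_le_mul_right (hblock k τ hτ) _
  have hμt : volume.restrict (Ioc 0 t) ≤ volume.restrict (Ioc 0 T) :=
    Measure.restrict_mono (Ioc_subset_Ioc_right ht.2) le_rfl
  have hgron := gronwall_lintegral ht.1 (m := fun τ => c * m τ) (fun τ => mul_nonneg hc (hm0 τ))
    ((hmi.mono_set (by
      rw [uIcc_of_le ht.1, uIcc_of_le hT.le]
      exact Icc_subset_Icc_right ht.2)).const_mul c)
    (hym.mono_measure hμt) (hαm.mono_measure hμt)
    (A := L.besovNorm w s p f₀) (B := 2 * L.timeBesovNorm ∞ T (fun _ => 1) s p f)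
    (ENNReal.mul_ne_top ENNReal.ofNat_ne_top hf.ne) (by
      filter_upwards [ae_restrict_mem measurableSet_Ioc, ae_mono hμt
        (ae_besovNorm_le (L := L) (T := T) (s := s) (p := p) (fun _ => 1) f)] with τ h1 h2
      refine (mul_le_of_le_one_left zero_le (hE1 τ h1.1.le)).trans ?_
      exact (besovNorm_le_mul hw _).trans (mul_le_mul_right h2 _))
    ((ae_restrict_mem measurableSet_Ioc).mono fun τ hτ =>
      hyle τ ⟨hτ.1.le, hτ.2.trans ht.2⟩)
  -- pass from the estimates at all times up to `t` to the norm of the block in `L^∞(0, t; L^p)`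
  have htilde : L.tildeBesovNorm ∞ t w s p f ≤ ENNReal.ofReal (Real.exp (c' * V t)) *
      ∑' k, W k * (eLpNorm (L.block k f₀) p volume +
        ∫⁻ σ in Ioc 0 t, E σ * eLpNorm (F k σ) p volume) := by
    rw [tildeBesovNorm, ← ENNReal.tsum_mul_left]
    refine ENNReal.tsum_le_tsum fun k => ?_
    rw [mul_left_comm]
    refine mul_le_mul_right ?_ _
    rw [eLpNorm_exponent_top]
    refine eLpNormEssSup_le_of_ae_enorm_bound ?_
    filter_upwards [ae_restrict_mem measurableSet_Ioc] with τ hτ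
    rw [enorm_eq_self]
    have hτT : τ ∈ Icc 0 T := ⟨hτ.1.le, hτ.2.trans ht.2⟩
    have h1 : 1 ≤ ENNReal.ofReal (Real.exp (c' * V t)) * E τ := by
      rw [hE, ← ENNReal.ofReal_mul (Real.exp_nonneg _), ← Real.exp_add, ← ENNReal.ofReal_one]
      refine ENNReal.ofReal_le_ofReal (Real.one_le_exp ?_)
      have := mul_le_mul_of_nonneg_left (hVmono τ ⟨hτ.1.le, hτ.2⟩) hc'0
      linarith
    calc eLpNorm (L.block k (f τ)) p volume
        ≤ ENNReal.ofReal (Real.exp (c' * V t)) * E τ * eLpNorm (L.block k (f τ)) p volume :=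
          le_mul_of_one_le_left zero_le h1
      _ ≤ _ := by
          rw [mul_assoc]
          refine mul_le_mul_right ((hblock k τ hτT).trans ?_) _
          gcongr
          exact hτ.2
  refine (htilde.trans (mul_le_mul_right ((hsum t ht).trans hgron) _)).trans_eq ?_
  rw [← mul_assoc, ← ENNReal.ofReal_mul (Real.exp_nonneg _), ← Real.exp_add,
    intervalIntegral.integral_const_mul, hVi t ht, hC, add_mul]
  congr 2
  refine setLIntegral_congr_fun measurableSet_Ioc fun τ hτ => ?_
  simp only [hα, hE]
  rw [← mul_assoc, ← ENNReal.ofReal_mul (Real.exp_nonneg _), ← Real.exp_add,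
    intervalIntegral.integral_const_mul, hVi τ ⟨hτ.1.le, hτ.2.trans ht.2⟩]
  congr 3
  ring

end LittlewoodPaley

/-- The weighted commutator estimate in the admissible range of the exponent `s`. -/
theorem LittlewoodPaley.exists_tsum_commutator_le_besovNorm {N : ℕ} (L : LittlewoodPaley N)
    {p p' : ℝ≥0∞} [p'.HolderConjugate p] (hp : 1 ≤ p) (hp' : p ≠ ∞) {s : ℝ}
    (hs : -((N : ℝ) * min (1 / p).toReal (1 - 1 / p).toReal) < s)
    (hs' : s ≤ (N : ℝ) * (1 / p).toReal) :
    ∃ c : ℝ, 0 ≤ c ∧ ∀ (w : ℤ → ℝ) (u : Space N → Space N) (f : ZDual N),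
      IsSlowWeight (fun k => ENNReal.ofReal (w k)) → L.HasRealizedGradient u →
      L.gradBesovNorm ((N : ℝ) * (1 / p).toReal) p u ≠ ∞ →
      (∀ j, eLpNorm (L.block j f) p volume ≠ ∞) →
      (∀ ψ, Summable fun j => L.blockTransport u j f ψ) →
      ∑' k : ℤ, ENNReal.ofReal ((2 : ℝ) ^ ((k : ℝ) * s) * w k) *
          eLpNorm (L.commutator u f k) p volume ≤
        ENNReal.ofReal c * L.gradBesovNorm ((N : ℝ) * (1 / p).toReal) p u *
          L.besovNorm w s p f := by
  have h1 : (1 - 1 / p).toReal = (1 / p').toReal := by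
    rw [ENNReal.toReal_sub_of_le (by rw [one_div]; exact ENNReal.inv_le_one.2 hp)
      ENNReal.one_ne_top, ENNReal.toReal_one]
    have := ENNReal.HolderConjugate.toReal_add (q := p') (q' := p)
    linarith
  rw [h1] at hs
  have hN : (0 : ℝ) ≤ N := N.cast_nonneg
  obtain ⟨C, hC, h⟩ : ∃ C : ℝ≥0∞, C ≠ ∞ ∧
      ∀ (Ω : ℤ → ℝ≥0∞) (u : Space N → Space N) (f : ZDual N),
      IsSlowWeight Ω → L.HasRealizedGradient u →
      L.gradBesovNorm ((N : ℝ) * (1 / p).toReal) p u ≠ ∞ →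
      (∀ j, eLpNorm (L.block j f) p volume ≠ ∞) →
      (∀ ψ, Summable fun j => L.blockTransport u j f ψ) →
      ∑' k : ℤ, 2 ^ ((k : ℝ) * s) * Ω k * eLpNorm (L.commutator u f k) p volume ≤
        C * L.gradBesovNorm ((N : ℝ) * (1 / p).toReal) p u *
          ∑' j : ℤ, 2 ^ ((j : ℝ) * s) * Ω j * eLpNorm (L.block j f) p volume := by
    rcases le_total p' p with hpp | hpp
    · have hmin := mul_le_mul_of_nonneg_left (min_le_left (1 / p).toReal (1 / p').toReal) hN
      have : p.HolderConjugate p' := ENNReal.HolderConjugate.symm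
      exact L.exists_tsum_commutator_le (p' := p') (q := p) (q' := p') hp hp' le_rfl hpp hs'
        (by linarith)
    · have hmin := mul_le_mul_of_nonneg_left (min_le_right (1 / p).toReal (1 / p').toReal) hN
      exact L.exists_tsum_commutator_le (p' := p') (q := p') (q' := p) hp hp' hpp le_rfl hs'
        (by linarith)
  refine ⟨C.toReal, ENNReal.toReal_nonneg, fun w u f hw hu hfin hf hsum => ?_⟩
  rw [ENNReal.ofReal_toReal hC, besovNorm]
  simp only [ofReal_two_rpow_mul]
  exact h _ u f hw hu hfin hf hsum

end

theorem mainTheorem3 (N : ℕ) (hN : 1 ≤ N) (L : LittlewoodPaley N) (p : ℝ≥0∞) (hp : 1 ≤ p)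
    (s : ℝ) (hs : -((N : ℝ) * min (1 / p).toReal (1 - 1 / p).toReal) < s)
    (hs' : s ≤ (N : ℝ) * (1 / p).toReal) :
    ∃ C : ℝ, 0 < C ∧
      ∀ e : ℤ → ℝ → ℝ, IsWeightSequence e →
      ∀ T : ℝ, 0 < T →
      ∀ v : ℝ → Space N → Space N,
        LocallyIntegrableOn (fun z : ℝ × Space N => v z.1 z.2) (Icc 0 T ×ˢ univ) volume →
        (∀ᵐ τ ∂(volume.restrict (Ioc 0 T)), L.HasRealizedGradient (v τ)) →
        L.gradIntegral p v T < ∞ →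
      ∀ f₀ : ZDual N, L.besovNorm (fun _ => 1) s p f₀ < ∞ →
      ∀ g : ℝ → ZDual N, L.timeBesovNorm 1 T (fun _ => 1) s p g < ∞ →
      ∀ f : ℝ → ZDual N, L.timeBesovNorm ∞ T (fun _ => 1) s p f < ∞ →
        L.IsTransportSolution T v g f₀ f →
      ∀ t ∈ Icc (0 : ℝ) T,
        L.tildeBesovNorm ∞ t (weight e T) s p f ≤
          ENNReal.ofReal (Real.exp (C * (L.gradIntegral p v t).toReal)) *
            (L.besovNorm (weight e T) s p f₀ +
              ∫⁻ τ in Ioc 0 t, ENNReal.ofReal (Real.exp (-(C * (L.gradIntegral p v τ).toReal))) *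
                L.besovNorm (weight e T) s p (g τ)) := by
  have hp' : p ≠ ∞ := by
    -- for `p = ∞` the range of `s` is empty
    rintro rfl
    simp at hs hs'
    linarith
  obtain ⟨p', hconj⟩ : ∃ p' : ℝ≥0∞, p'.HolderConjugate p :=
    ⟨_, (ENNReal.HolderConjugate.conjExponent hp).symm⟩
  obtain ⟨c, hc, hcomm⟩ := L.exists_tsum_commutator_le_besovNorm (p' := p') hp hp' hs hs'
  have hb : 1 ≤ (L.bernsteinConst p').toReal := by
    rw [← ENNReal.toReal_one, ENNReal.toReal_le_toReal ENNReal.one_ne_top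
      (L.bernsteinConst_ne_top p')]
    exact L.one_le_bernsteinConst p'
  have hN' : (0 : ℝ) < N := by exact_mod_cast hN
  refine ⟨2 * N * (N * (L.bernsteinConst p').toReal) + c, by positivity, ?_⟩
  intro e he T hT v hvl hvr hvf f₀ _ g _ f hf h t ht
  have hv : L.IsBesovField p T v := ⟨hvl, hvr, hvf⟩
  refine h.tildeBesovNorm_le (p' := p') hp hp' hT hv hf
    (weight_le_two he hT.le) hc ?_ ht rfl
  filter_upwards [hvr, hv.ae_gradBesovNorm_lt_top (zero_lt_one.trans_le hp).ne' hp', h.summable,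
    LittlewoodPaley.ae_besovNorm_le (L := L) (T := T) (s := s) (p := p) (fun _ => 1) f]
    with τ h1 h2 h3 h4
  refine hcomm _ (v τ) (f τ) (isSlowWeight_weight he hT.le) h1 h2.ne (fun j => ?_) h3
  exact ne_top_of_le_ne_top (ENNReal.mul_ne_top (two_rpow_ne_top _) (h4.trans_lt hf).ne)
    (L.eLpNorm_block_le_besovNorm s p (f τ) j)
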